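/- Let $F$ be a non-Archimedean local field of characteristic zero with residue field of cardinality $q$, normalised absolute value $|\cdot|$ (so $|F^\times|=q^{\mathbb Z}$), ring of integers with maximal ideal $\mathfrak p_F$, and $\zeta_F(s)=(1-q^{-s})^{-1}$. Let $\psi:F\to\mathbb C^\times$ be a nontrivial continuous additive character, $n(\psi)$ the largest integer $n$ such that $\psi$ is trivial on $\mathfrak p_F^{-n}$, and $$\gamma(s,\mathbf 1_F,\psi)=q^{n(\psi)(1/2-s)}\frac{\zeta_F(1-s)}{\zeta_F(s)}.$$ Let $d\ge 1$, $V=F^d$, $M=\mathrm{GL}(V)$, with center $A=F^\times$. Let $\widetilde M$ be the space of nondegenerate bilinear forms on $V$, with the commuting left and right actions of $M$ given by $(mBm')(x,y)=B(m'x,m^{-1}y)$, and put $\mathrm{Ad}(m)B=mBm^{-1}$. For $t\in F^\times$ fix $\gamma_t\in\widetilde M$ such that $\gamma_t(x,y)+\gamma_t(y,x)=t\,\ell(x)\ell(y)$ for some nonzero linear form $\ell$ on $V$. Fix nonzero $\mathrm{Ad}(M)$-invariant Radon measures $d_t$ on the conjugacy classes $\mathrm{Ad}(M)\gamma_t$ such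 that for all $a,t\in F^\times$ the bijection $\mathrm{Ad}(M)\gamma_t\to\mathrm{Ad}(M)\gamma_{at}$, $B\mapsto Ba=aB$, is measure preserving. For $f\in C_c^\infty(\widetilde M)$ and a quadratic (possibly trivial) character $\chi:F^\times\to\{\pm1\}$ put $$O(\gamma_t,f)=\int_{\mathrm{Ad}(M)\gamma_t}f\,d_t,\qquad I_\chi(f)=\sum_{t\in F^\times/F^{\times,2}}\chi(-t)\,O(\gamma_t,f).$$ Let $U=V\oplus L\oplus V^*$ with $L=F$, let $Q((x,\lambda,x^*),(y,\mu,y^*))=\langle x,y^*\rangle+\langle y,x^*\rangle+\lambda\mu$, and let $G=\mathrm{SO}(U,Q)$. Let $P$ and $\overline P$ be the stabilizers in $G$ of $V$ and $V^*$, and $N$, $\overline N$ their unipotent radicals; $M$ is identified with $P\cap\overline P$ by restriction to $V$, and $\widetilde M$ with $\mathrm{Norm}_G(M)\setminus M$ by letting $g$ correspond to the form $(x,y)\mapsto Q(gx,y)$ on $V$. Put $G'=N\widetilde M N\subset G$. Fix Haar measures on $A$, $N$, $\overline N$. Let $\delta$ be the modular character of $P$ (so that $\delta(m)=|\det m|^d$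 for $m\in M$), and for $B\in\widetilde M$ let $\widetilde\delta(B)$ be the Jacobian of the isomorphism $\mathrm{Ad}(B):N\to\overline N$. Let $\Phi\in C_c^\infty(N\backslash G')$, that is, $\Phi:G\to\mathbb C$ is left $N$-invariant and right invariant by a compact open subgroup, and its support is contained in $G'$ and has compact image in $N\backslash G$. The convenient section attached to $\Phi$ and $\chi$ is $$\Phi_s(g)=\int_A\Phi(ag)\,\chi(a)\,\delta(a)^{-1/2}\,|\det a|^{-s}\,da,\qquad s\in\mathbb C,\ g\in G.$$ Then there is a constant $C_1>0$, depending on $F,\psi,d$ and on the measures fixed above but not on $\chi$, $f$ or $\Phi$, such that for every quadratic character $\chi$, every $f\in C_c^\infty(\widetilde M)$ and every $\Phi\in C_c^\infty(N\backslash G')$ with $f(B)=\widetilde\delta(B)^{1/2}\,\Phi(B^{-1})$ for all $B\in\widetilde M$ (inverse taken in $G$), the integral $\int_{\overline N}\Phi_s(\bar u)\,d\bar u$ converges absolutely for $\mathrm{Re}(s)>0$, the orbital integrals $O(\gamma_t,f)$ converge absolutely, and $$\lim_{s\to0^+}\gamma(s,\mathbf 1_F,\psi)\int_{\overline N}\Phi_s(\bar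 u)\,d\bar u=C_1\cdot I_\chi(f).$$ -/

import Mathlib

open MeasureTheory Matrix Filter Topology

noncomputable section

namespace OddSO

/-! ## The local field -/

section Field

variable (F : Type*) [NontriviallyNormedField F] [IsUltrametricDist F]

/-- `q`, the cardinality of the residue field `𝒪_F / 𝔭_F`. -/
def residueCard : ℕ :=
  Nat.card (IsLocalRing.ResidueField (NormedField.valuation (K := F)).valuationSubring)

/-- The absolute value of `F` is the normalised one: `|F^×| = q^ℤ`. -/
def IsNormalizedAbs : Prop :=
  Set.range (fun x : Fˣ => ‖(x : F)‖) = Set.range (fun n : ℤ => (residueCard F : ℝ) ^ n)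

/-- The local zeta factor `ζ_F(s) = (1 - q^{-s})⁻¹`. -/
def zetaF (s : ℂ) : ℂ := (1 - (residueCard F : ℂ) ^ (-s))⁻¹

variable {F}

/-- The level of a continuous nontrivial additive character: the largest integer `n` such that
`ψ` is trivial on `𝔭_F^{-n} = {x | |x| ≤ q^n}`. -/
def level (ψ : AddChar F ℂ) : ℤ :=
  sSup {n : ℤ | ∀ x : F, ‖x‖ ≤ (residueCard F : ℝ) ^ n → ψ x = 1}

/-- The gamma factor `γ(s, 1_F, ψ) = q^{n(ψ)(1/2 - s)} ζ_F(1 - s) / ζ_F(s)`. -/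
def gammaF (ψ : AddChar F ℂ) (s : ℂ) : ℂ :=
  (residueCard F : ℂ) ^ ((level ψ : ℂ) * (1 / 2 - s)) * (zetaF F (1 - s) / zetaF F s)

end Field

/-! ## Jacobians of isomorphisms of locally compact groups -/

section Jacobian

/-- The isomorphism `H ≃ H'`, `x ↦ g x g⁻¹`, for subgroups with `g H g⁻¹ = H'`. -/
def conjIso {G : Type*} [Group G] [TopologicalSpace G] [IsTopologicalGroup G] (g : G)
    (H H' : Subgroup G) (h : ∀ x, x ∈ H ↔ g * x * g⁻¹ ∈ H') : H ≃ₜ* H' where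
  toFun x := ⟨g * x * g⁻¹, (h x).1 x.2⟩
  invFun y := ⟨g⁻¹ * y * g, (h _).2 (by simp [mul_assoc])⟩
  left_inv x := by ext; simp [mul_assoc]
  right_inv y := by ext; simp [mul_assoc]
  map_mul' x y := by ext; simp [mul_assoc]
  continuous_toFun := by fun_prop
  continuous_invFun := by fun_prop

/-- The Jacobian of `φ : H ≃ H'` with respect to Haar measures `μ`, `μ'`: the constant `c` such
that `μ' (φ E) = c * μ E`, i.e. `μ' = c • φ_* μ`. -/
def jacobian {H H' : Type*} [Group H] [TopologicalSpace H] [IsTopologicalGroup H]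
    [MeasurableSpace H] [BorelSpace H] [Group H'] [TopologicalSpace H'] [IsTopologicalGroup H']
    [MeasurableSpace H'] [BorelSpace H'] (φ : H ≃ₜ* H') (μ : Measure H) (μ' : Measure H')
    [μ.IsHaarMeasure] [μ'.IsHaarMeasure] : ℝ :=
  haveI : (μ.map φ).IsHaarMeasure := φ.isHaarMeasure_map μ
  (Measure.haarScalarFactor μ' (μ.map φ) : ℝ)

end Jacobian

/-! ## The group `M = GL(V)`, `V = F^d`, and the twisted space of nondegenerate bilinear forms

A bilinear form `B` on `V` is given by its Gram matrix `(B(e_i, e_j))`, so that the nondegenerate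
forms are the elements of `GL (Fin d) F`. -/

section Twisted

variable {F : Type*} [Field F] {d : ℕ}

/-- The transpose of an invertible matrix. -/
def transposeGL (b : GL (Fin d) F) : GL (Fin d) F where
  val := (b : Matrix (Fin d) (Fin d) F)ᵀ
  inv := ((b⁻¹ : GL (Fin d) F) : Matrix (Fin d) (Fin d) F)ᵀ
  val_inv := by rw [← Matrix.transpose_mul, ← Units.val_mul]; simp
  inv_val := by rw [← Matrix.transpose_mul, ← Units.val_mul]; simp

/-- The two commuting actions of `M` on bilinear forms: `(m B m')(x, y) = B(m' x, m⁻¹ y)`. -/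
def biact (m b m' : GL (Fin d) F) : GL (Fin d) F := transposeGL m' * b * m⁻¹

/-- The conjugation action `Ad(m) B = m B m⁻¹`. -/
def adM (m b : GL (Fin d) F) : GL (Fin d) F := biact m b m⁻¹

/-- The right action of the central element `a ∈ A = F^×`, i.e. `B ↦ B a = a B`. -/
def rightA (a : Fˣ) (b : GL (Fin d) F) : GL (Fin d) F :=
  biact 1 b (GeneralLinearGroup.scalar (Fin d) a)

/-- The conjugacy class `Ad(M) b`. -/
def orbit (b : GL (Fin d) F) : Set (GL (Fin d) F) := Set.range fun m => adM m b

/-- The symmetric form `B^s(x, y) = B(x, y) + B(y, x)` has rank one and is isomorphic to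
`x ↦ t x²`, i.e. `B^s(x, y) = t ℓ(x) ℓ(y)` for a nonzero linear form `ℓ`. -/
def HasSymPart (t : Fˣ) (b : GL (Fin d) F) : Prop :=
  ∃ ℓ : Fin d → F, ℓ ≠ 0 ∧
    (b : Matrix (Fin d) (Fin d) F) + (b : Matrix (Fin d) (Fin d) F)ᵀ = (t : F) • vecMulVec ℓ ℓ

end Twisted

section Orbital

variable {F : Type*} [NontriviallyNormedField F] {d : ℕ}

/-- `C_c^∞` of the space of nondegenerate bilinear forms. -/
def IsTestFun (f : GL (Fin d) F → ℂ) : Prop := IsLocallyConstant f ∧ HasCompactSupport f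

/-- `μ t` is a nonzero `Ad(M)`-invariant Radon measure on the conjugacy class of `γ t`, for every
`t ∈ F^×`, and the bijections `Ad(M) γ_t → Ad(M) γ_{at}`, `B ↦ B a`, are measure preserving. -/
structure IsOrbitMeasures [MeasurableSpace (GL (Fin d) F)] (γ : Fˣ → GL (Fin d) F)
    (μ : Fˣ → Measure (GL (Fin d) F)) : Prop where
  compl_orbit : ∀ t, μ t (orbit (γ t))ᶜ = 0
  ne_zero : ∀ t, μ t ≠ 0
  lt_top : ∀ t, ∀ K ⊆ orbit (γ t), IsCompact K → μ t K < ⊤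
  invariant : ∀ t m, (μ t).map (adM m) = μ t
  map_rightA : ∀ t a, (μ t).map (rightA a) = μ (a * t)

/-- The orbital integral `O(γ_t, f)`, where `μt` is the measure on the class of `γ_t`. -/
def orbInt [MeasurableSpace (GL (Fin d) F)] (μt : Measure (GL (Fin d) F))
    (f : GL (Fin d) F → ℂ) : ℂ := ∫ b, f b ∂μt

/-- `I_χ(f) = ∑_{t ∈ F^× / F^{×,2}} χ(-t) O(γ_t, f)` (a sum over a finite group). -/
def Ichi [MeasurableSpace (GL (Fin d) F)] (μ : Fˣ → Measure (GL (Fin d) F)) (χ : Fˣ →* ℤˣ)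
    (f : GL (Fin d) F → ℂ) : ℂ :=
  ∑ᶠ c : Fˣ ⧸ Subgroup.square Fˣ, ((χ (-c.out) : ℤ) : ℂ) * orbInt (μ c.out) f

end Orbital

/-! ## The odd special orthogonal group of `U = V ⊕ V^* ⊕ L`, `L = F` -/

section Group

/-- Indices of the standard basis of `U`: first `e_i` (of `V`), then the dual basis `e_i^*`
(of `V^*`), then the basis vector of `L`. -/
abbrev Idx (d : ℕ) : Type := (Fin d ⊕ Fin d) ⊕ Unit

variable (F : Type*) [Field F] (d : ℕ)

/-- The Gram matrix of `Q((x, x^*, lam), (y, y^*, mu)) = ⟨x, y^*⟩ + ⟨y, x^*⟩ + lam mu`. -/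
def gramQ : Matrix (Idx d) (Idx d) F := fromBlocks (fromBlocks 0 1 1 0) 0 0 1

/-- The special orthogonal group of `(U, Q)`, as a subgroup of `SL(U)`. -/
def SO : Subgroup (SpecialLinearGroup (Idx d) F) where
  carrier := {g | (g : Matrix (Idx d) (Idx d) F)ᵀ * gramQ F d * g = gramQ F d}
  mul_mem' {a b} ha hb := by
    change a.1ᵀ * gramQ F d * a.1 = gramQ F d at ha
    change b.1ᵀ * gramQ F d * b.1 = gramQ F d at hb
    change (a.1 * b.1)ᵀ * gramQ F d * (a.1 * b.1) = gramQ F d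
    calc (a.1 * b.1)ᵀ * gramQ F d * (a.1 * b.1)
        = b.1ᵀ * (a.1ᵀ * gramQ F d * a.1) * b.1 := by
          simp only [transpose_mul, Matrix.mul_assoc]
      _ = gramQ F d := by rw [ha, hb]
  one_mem' := by simp
  inv_mem' {a} ha := by
    change a.1ᵀ * gramQ F d * a.1 = gramQ F d at ha
    change (a⁻¹).1ᵀ * gramQ F d * (a⁻¹).1 = gramQ F d
    have h1 : a.1 * (a⁻¹).1 = 1 := congrArg Subtype.val (mul_inv_cancel a)
    have h2 : (a⁻¹).1ᵀ * a.1ᵀ = 1 := by rw [← transpose_mul, h1, transpose_one]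
    calc (a⁻¹).1ᵀ * gramQ F d * (a⁻¹).1
        = (a⁻¹).1ᵀ * (a.1ᵀ * gramQ F d * a.1) * (a⁻¹).1 := by rw [ha]
      _ = ((a⁻¹).1ᵀ * a.1ᵀ) * gramQ F d * (a.1 * (a⁻¹).1) := by
          simp only [Matrix.mul_assoc]
      _ = gramQ F d := by rw [h1, h2, Matrix.one_mul, Matrix.mul_one]

/-- `G = SO(U, Q)`. -/
abbrev G : Type _ := ↥(SO F d)

variable {F d}

/-- The matrix of an element of `G`. -/
def mat (g : G F d) : Matrix (Idx d) (Idx d) F := g.1.1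

/-- The inclusion `V ⊂ U`. -/
def inV (x : Fin d → F) : Idx d → F := Sum.elim (Sum.elim x 0) 0

/-- The inclusion `V^* ⊂ U`. -/
def inVdual (x : Fin d → F) : Idx d → F := Sum.elim (Sum.elim 0 x) 0

theorem mat_mul (g h : G F d) : mat (g * h) = mat g * mat h := by
  simp [mat]

theorem mat_one : mat (1 : G F d) = 1 := by
  simp [mat]

theorem mat_inv_mulVec {g : G F d} {v w : Idx d → F} (h : mat g *ᵥ v = w) :
    mat g⁻¹ *ᵥ w = v := by
  rw [← h, mulVec_mulVec, ← mat_mul]; simp [mat_one]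

variable (F d)

/-- The unipotent radical of `P = Stab_G(V)`. An element of `G` that fixes `V` pointwise acts
trivially on `U / V^⊥ = V^*`, hence (having determinant one) also on `V^⊥ / V = L`. -/
def N : Subgroup (G F d) where
  carrier := {u | ∀ x : Fin d → F, mat u *ᵥ inV x = inV x}
  mul_mem' {a b} ha hb x := by rw [mat_mul, ← mulVec_mulVec, hb x, ha x]
  one_mem' x := by rw [mat_one, one_mulVec]
  inv_mem' {a} ha x := mat_inv_mulVec (ha x)

/-- The unipotent radical of the opposite parabolic subgroup `Stab_G(V^*)`, likewise. -/
def Nbar : Subgroup (G F d) where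
  carrier := {u | ∀ x : Fin d → F, mat u *ᵥ inVdual x = inVdual x}
  mul_mem' {a b} ha hb x := by rw [mat_mul, ← mulVec_mulVec, hb x, ha x]
  one_mem' x := by rw [mat_one, one_mulVec]
  inv_mem' {a} ha x := mat_inv_mulVec (ha x)

variable {F d}

/-- The embedding `M = GL(V) ⊂ G`: `m` acts by `m` on `V`, contragrediently on `V^*`, and
trivially on `L`. -/
def levi (m : GL (Fin d) F) : G F d :=
  ⟨⟨fromBlocks (fromBlocks m.1 0 0 (m⁻¹).1ᵀ) 0 0 1, by
      rw [det_fromBlocks_zero₂₁, det_fromBlocks_zero₂₁, det_transpose, ← det_mul,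
        ← Units.val_mul]
      simp⟩, by
    change (fromBlocks (fromBlocks m.1 0 0 (m⁻¹).1ᵀ) 0 0 1)ᵀ * gramQ F d *
      fromBlocks (fromBlocks m.1 0 0 (m⁻¹).1ᵀ) 0 0 1 = gramQ F d
    have h1 : m.1ᵀ * (m⁻¹).1ᵀ = 1 := by
      rw [← transpose_mul, ← Units.val_mul]; simp
    have h2 : (m⁻¹).1 * m.1 = 1 := by
      rw [← Units.val_mul]; simp
    simp only [gramQ, fromBlocks_transpose, fromBlocks_multiply, transpose_zero, transpose_one,
      transpose_transpose, Matrix.mul_zero, Matrix.zero_mul, Matrix.mul_one,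
      add_zero, zero_add, h1, h2]⟩

/-- The embedding in `G` of the space of nondegenerate bilinear forms, onto the nonneutral
component `Norm_G(M) ∖ M`: a form `B` goes to the element `g` of that component such that
`Q(g x, y) = B(x, y)` for `x, y ∈ V`. Thus `g` maps `V` to `V^*` by `x ↦ B(x, ·)`, it maps `V^*`
to `V` by the inverse contragredient map, and (having determinant one) it is `(-1)^d` on `L`. -/
def embB (b : GL (Fin d) F) : G F d :=
  ⟨⟨fromBlocks (fromBlocks 0 (b⁻¹).1 b.1ᵀ 0) 0 0 ((-1 : F) ^ d • 1), by
      have h0 : fromBlocks 0 (b⁻¹).1 b.1ᵀ 0 =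
          fromBlocks (b⁻¹).1 0 0 b.1ᵀ * fromBlocks 0 1 1 0 := by
        simp [fromBlocks_multiply]
      have h1 : (fromBlocks 0 1 1 0 : Matrix (Fin d ⊕ Fin d) (Fin d ⊕ Fin d) F).det
          = (-1) ^ d := by
        have h2 : (fromBlocks 1 1 0 1 : Matrix (Fin d ⊕ Fin d) (Fin d ⊕ Fin d) F) *
            fromBlocks 0 1 1 0 = fromBlocks 1 1 1 0 := by
          simp [fromBlocks_multiply]
        have h3 := congrArg Matrix.det h2
        rw [det_mul, det_fromBlocks_zero₂₁, det_fromBlocks_one₁₁] at h3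
        simpa [det_neg] using h3
      rw [det_fromBlocks_zero₂₁, h0, det_mul, h1, det_fromBlocks_zero₂₁, det_transpose, ← det_mul,
        ← Units.val_mul]
      simp [← mul_pow]⟩, by
    change (fromBlocks (fromBlocks 0 (b⁻¹).1 b.1ᵀ 0) 0 0 ((-1 : F) ^ d • 1))ᵀ * gramQ F d *
      fromBlocks (fromBlocks 0 (b⁻¹).1 b.1ᵀ 0) 0 0 ((-1 : F) ^ d • 1) = gramQ F d
    have h1 : b.1 * (b⁻¹).1 = 1 := by
      rw [← Units.val_mul]; simp
    have h2 : (b⁻¹).1ᵀ * b.1ᵀ = 1 := by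
      rw [← transpose_mul, ← Units.val_mul]; simp
    simp only [gramQ, fromBlocks_transpose, fromBlocks_multiply, transpose_zero,
      transpose_transpose, Matrix.mul_zero, Matrix.zero_mul, Matrix.mul_one,
      add_zero, zero_add, h1, h2]
    simp [smul_smul, ← mul_pow]⟩

/-- The open subset `G' = N M̃ N` of `G`. -/
def Gprime : Set (G F d) := {g | ∃ u₁ ∈ N F d, ∃ b : GL (Fin d) F, ∃ u₂ ∈ N F d,
  g = u₁ * embB b * u₂}

theorem levi_conj (m : GL (Fin d) F) (u : G F d) :
    u ∈ N F d ↔ levi m * u * (levi m)⁻¹ ∈ N F d := by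
  have key : ∀ (k : GL (Fin d) F) (x : Fin d → F),
      mat (levi k) *ᵥ inV x = inV (k.1 *ᵥ x) := by
    intro k x
    simp [mat, levi, inV, fromBlocks_mulVec, Sum.elim_comp_inl]
  have hsurj : ∀ x : Fin d → F, m.1 *ᵥ ((m⁻¹).1 *ᵥ x) = x := by
    intro x; rw [mulVec_mulVec, ← Units.val_mul]; simp
  have hinv : ∀ x : Fin d → F, mat (levi m)⁻¹ *ᵥ inV (m.1 *ᵥ x) = inV x :=
    fun x => mat_inv_mulVec (key m x)
  constructor
  · intro hu x
    rw [← hsurj x, mat_mul, mat_mul, ← mulVec_mulVec, hinv, ← mulVec_mulVec, hu, key]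
  · intro hu x
    have h := hu (m.1 *ᵥ x)
    rw [mat_mul, mat_mul, ← mulVec_mulVec, hinv, ← mulVec_mulVec] at h
    rw [← mat_inv_mulVec h, hinv]

theorem embB_conj (b : GL (Fin d) F) (u : G F d) :
    u ∈ N F d ↔ embB b * u * (embB b)⁻¹ ∈ Nbar F d := by
  have key : ∀ x : Fin d → F, mat (embB b) *ᵥ inV x = inVdual (b.1ᵀ *ᵥ x) := by
    intro x
    simp [mat, embB, inV, inVdual, fromBlocks_mulVec, Sum.elim_comp_inl]
  have hsurj : ∀ x : Fin d → F, b.1ᵀ *ᵥ ((b⁻¹).1ᵀ *ᵥ x) = x := by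
    intro x; rw [mulVec_mulVec, ← transpose_mul, ← Units.val_mul]; simp
  have hinv : ∀ x : Fin d → F, mat (embB b)⁻¹ *ᵥ inVdual (b.1ᵀ *ᵥ x) = inV x :=
    fun x => mat_inv_mulVec (key x)
  constructor
  · intro hu x
    rw [← hsurj x, mat_mul, mat_mul, ← mulVec_mulVec, hinv, ← mulVec_mulVec, hu, key]
  · intro hu x
    have h := hu (b.1ᵀ *ᵥ x)
    rw [mat_mul, mat_mul, ← mulVec_mulVec, hinv, ← mulVec_mulVec] at h
    rw [← mat_inv_mulVec h, hinv]

end Group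

/-! ## Modular characters and convenient sections -/

section Sections

variable {F : Type*} [NontriviallyNormedField F] {d : ℕ}

/-- The modular character of `P` on `M`: the Jacobian of `Ad(m) : N ≃ N`. -/
def modP [MeasurableSpace (G F d)] [BorelSpace (G F d)] (μN : Measure (N F d)) [μN.IsHaarMeasure]
    (m : GL (Fin d) F) : ℝ :=
  jacobian (conjIso (levi m) (N F d) (N F d) (levi_conj m)) μN μN

/-- `δ̃(B)`: the Jacobian of `Ad(B) : N ≃ N̄`, for a nondegenerate bilinear form `B`. -/
def modTilde [MeasurableSpace (G F d)] [BorelSpace (G F d)] (μN : Measure (N F d))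
    [μN.IsHaarMeasure] (μNbar : Measure (Nbar F d)) [μNbar.IsHaarMeasure]
    (b : GL (Fin d) F) : ℝ :=
  jacobian (conjIso (embB b) (N F d) (Nbar F d) (embB_conj b)) μN μNbar

/-- `Φ ∈ C_c^∞(N \ G')`: `Φ` is a left `N`-invariant function on `G`, right invariant by a compact
open subgroup, with support contained in `G'` and of compact image in `N \ G`. -/
structure IsTestFunG (Φ : G F d → ℂ) : Prop where
  left_invariant : ∀ u ∈ N F d, ∀ g, Φ (u * g) = Φ g
  right_invariant : ∃ K : Subgroup (G F d), IsOpen (K : Set (G F d)) ∧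
    IsCompact (K : Set (G F d)) ∧ ∀ k ∈ K, ∀ g, Φ (g * k) = Φ g
  support_subset : tsupport Φ ⊆ Gprime
  compact_image : IsCompact
    ((fun g : G F d => (Quotient.mk (QuotientGroup.rightRel (N F d)) g)) '' tsupport Φ)

/-- The convenient section attached to `Φ`:
`Φ_s(g) = ∫_A Φ(a g) χ(a) δ(a)^{-1/2} |det a|^{-s} da`, with `A = F^×` the center of `M`. -/
def convSection [MeasurableSpace Fˣ] [MeasurableSpace (G F d)] [BorelSpace (G F d)]
    (μA : Measure Fˣ) (μN : Measure (N F d)) [μN.IsHaarMeasure] (χ : Fˣ →* ℤˣ)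
    (Φ : G F d → ℂ) (s : ℂ) (g : G F d) : ℂ :=
  ∫ a : Fˣ, Φ (levi (GeneralLinearGroup.scalar (Fin d) a) * g) * ((χ a : ℤ) : ℂ) *
    ((modP μN (GeneralLinearGroup.scalar (Fin d) a) ^ (-(1 / 2) : ℝ) : ℝ) : ℂ) *
    (‖(GeneralLinearGroup.scalar (Fin d) a : Matrix (Fin d) (Fin d) F).det‖ : ℂ) ^ (-s) ∂μA

end Sections

end OddSO

end

/-!
The integral of `Φ_s` over `N̄` is unfolded into a double integral over `N̄ × A` and the order of
integration is exchanged: it becomes the integral over `a ∈ F^×` of `E(a) χ(a) |a|^{-ds}`, where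
`E(a) = δ(a)^{-1/2} ∫_{N̄} Φ(a u) du`. The pole at `s = 0` that cancels the zero of the gamma
factor comes from the behaviour of `E` at infinity.

*The form attached to `u`.* An element `u` of `N̄` is given by a linear form `l` on `V` and a
bilinear form `Y` with `Y + Yᵀ = -l ⊗ l`. If `Y` is nondegenerate, then `u` lies in the open cell,
and its right-hand factor in `N` has coordinates `Y⁻¹ l` and `Y⁻¹` up to signs and transposition
(`mul_nElt_mul_embB_mem`). The form attached to `a u` is `a⁻¹ Y`, so on the support of
`u ↦ Φ(a u)` it stays in a compact set, which forces `Y` to be of size `|a|` and `l` of size at most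
`|a|^{1/2}`. Hence for `a` near infinity the right-hand factor is close to the identity and
`Φ(a u)` equals the value of `Φ` at the inverse of the form `a⁻¹ Y` (`IsTestFunG.exists_eq_far`), which
is a multiple of `f(a⁻¹ Y)` by hypothesis.

*The invariant measure.* The image of the Haar measure of `N̄`, weighted by `δ̃(Y)^{-1/2}`, under
`u ↦ Y` is a measure `formMeasure` on nondegenerate forms. It is `Ad(M)`-invariant, because
`δ̃(Ad(m) B) = δ̃(B) δ(m)⁻²` and `Ad(m)` has Jacobian `δ(m)⁻¹` on `N̄`; this last point rests on
the fact that characters of `GL(V)` are invariant under transposition. It is carried by the class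
of `γ_{-1}`: for a fixed `t`, the forms with symmetric part `t l ⊗ l`, `l ≠ 0`, are all conjugate,
by splitting off hyperbolic planes (`mem_orbit_of_hasSymPart`), and `l = 0` only occurs on a null
set. Invariant measures carried by a single orbit are proportional, by a Fubini argument
(`exists_eq_smul_of_invariant`), so `d_{-1} = c · formMeasure` with a constant `c` that depends on
neither `χ`, `f` nor `Φ` (`exists_orbitMeasure_eq_smul`). Since `d_t` only depends on the square
class of `t`, it follows that `E(a) = c⁻¹ O(γ_{-a}, f)` for `a` near infinity. No closedness of
the orbit is needed for the convergence of the orbital integrals, as `formMeasure` is finite on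
all compact sets of nondegenerate forms.

*The pole.* The function `E` is bounded, because it is dominated by the volume of a translate of a
compact set for `formMeasure`, which only depends on the square class of `a`; it vanishes for
small `a`, because `a u` has the matrix entry `a⁻¹`. This gives absolute convergence of the double
integral for `Re s > 0` (`IsTestFunG.integrable_doubleIntegrand`). A function `φ` of the square
class is locally constant, and summing over the translates of an annulus by powers of an element
of absolute value `q²` shows that `(1 - q^{-s}) ∫_{|a| > R} φ(a) |a|^{-ds} da` tends to
`(2d)⁻¹ vol ∑ φ`, the sum being over `F^× / F^{×,2}` and `vol` being the volume of the squares of absolute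
value one (`tendsto_setIntegral_pole`). With `φ(a) = c⁻¹ χ(a) O(γ_{-a}, f)` the sum is
`c⁻¹ I_χ(f)`.
-/

noncomputable section

namespace OddSO

/-! ### The multiplicative group of the local field -/

section MultiplicativeGroup

variable {F : Type*} [NontriviallyNormedField F]

theorem one_lt_residueCard [IsUltrametricDist F] (hF : IsNormalizedAbs F) : 1 < residueCard F := by
  obtain ⟨x, hx⟩ := NormedField.exists_one_lt_norm F
  have hx0 : x ≠ 0 := by
    rintro rfl
    simp at hx
    linarith
  have h1 : ‖x‖ ∈ Set.range (fun n : ℤ => (residueCard F : ℝ) ^ n) := by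
    rw [← hF]
    exact ⟨Units.mk0 x hx0, rfl⟩
  obtain ⟨n, hn⟩ := h1
  by_contra! hq
  have hq' : residueCard F = 0 ∨ residueCard F = 1 := by omega
  rcases hq' with h | h
  · simp only [h, Nat.cast_zero] at hn
    rcases eq_or_ne n 0 with rfl | hn0
    · simp at hn; linarith
    · rw [_root_.zero_zpow n hn0] at hn; linarith
  · simp only [h, Nat.cast_one, _root_.one_zpow] at hn
    linarith

theorem exists_norm_eq [IsUltrametricDist F] (hF : IsNormalizedAbs F) (n : ℤ) :
    ∃ a : Fˣ, ‖(a : F)‖ = (residueCard F : ℝ) ^ n := by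
  have : (residueCard F : ℝ) ^ n ∈ Set.range (fun x : Fˣ => ‖(x : F)‖) := by
    rw [hF]; exact ⟨n, rfl⟩
  exact this

theorem exists_zpow_eq_norm [IsUltrametricDist F] (hF : IsNormalizedAbs F) (a : Fˣ) :
    ∃ n : ℤ, ‖(a : F)‖ = (residueCard F : ℝ) ^ n := by
  have : ‖(a : F)‖ ∈ Set.range (fun n : ℤ => (residueCard F : ℝ) ^ n) := by
    rw [← hF]; exact ⟨a, rfl⟩
  obtain ⟨n, hn⟩ := this
  exact ⟨n, hn.symm⟩

theorem secondCountableTopology_field [LocallyCompactSpace F] : SecondCountableTopology F :=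
  have := ProperSpace.of_nontriviallyNormedField_of_weaklyLocallyCompactSpace F
  inferInstance

theorem secondCountableTopology_units {R : Type*} [Monoid R] [TopologicalSpace R]
    [SecondCountableTopology R] : SecondCountableTopology Rˣ := by
  have : SecondCountableTopology Rᵐᵒᵖ :=
    MulOpposite.opHomeomorph.symm.secondCountableTopology
  exact Units.isEmbedding_embedProduct.secondCountableTopology

theorem locallyCompactSpace_units {R : Type*} [Monoid R] [TopologicalSpace R] [T1Space R]
    [ContinuousMul R] [LocallyCompactSpace R] : LocallyCompactSpace Rˣ := by
  have : LocallyCompactSpace Rᵐᵒᵖ :=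
    MulOpposite.opHomeomorph.symm.isClosedEmbedding.locallyCompactSpace
  exact Units.isClosedEmbedding_embedProduct.locallyCompactSpace

/-- Closed annuli in `F^×` are compact. -/
theorem isCompact_annulus [LocallyCompactSpace F] {r R : ℝ} (hr : 0 < r) :
    IsCompact {a : Fˣ | r ≤ ‖(a : F)‖ ∧ ‖(a : F)‖ ≤ R} := by
  have := ProperSpace.of_nontriviallyNormedField_of_weaklyLocallyCompactSpace F
  have hK : IsCompact ((Metric.closedBall (0 : F) R) ×ˢ
      (MulOpposite.op '' (Metric.closedBall (0 : F) r⁻¹))) :=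
    (isCompact_closedBall _ _).prod ((isCompact_closedBall _ _).image MulOpposite.continuous_op)
  refine (Units.isClosedEmbedding_embedProduct.isCompact_preimage hK).of_isClosed_subset ?_ ?_
  · have hc : Continuous fun a : Fˣ => ‖(a : F)‖ := Units.continuous_val.norm
    exact (isClosed_le continuous_const hc).inter (isClosed_le hc continuous_const)
  · rintro a ⟨h1, h2⟩
    refine ⟨by simpa using h2, ⟨((a⁻¹ : Fˣ) : F), ?_, rfl⟩⟩
    simp only [Units.val_inv_eq_inv_val, mem_closedBall_zero_iff, norm_inv]
    exact inv_anti₀ hr h1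

/-- A function on a topological group that is right invariant by a neighbourhood of the identity is
locally constant. -/
theorem isLocallyConstant_of_eventually_one {α : Type*} {H : Type*} [Group H] [TopologicalSpace H]
    [IsTopologicalGroup H] {φ : H → α} (h : ∀ᶠ x in 𝓝 (1 : H), ∀ a, φ (a * x) = φ a) :
    IsLocallyConstant φ := by
  rw [IsLocallyConstant.iff_eventually_eq]
  intro a
  have : Tendsto (fun y => a⁻¹ * y) (𝓝 a) (𝓝 1) := by
    have h2 : Continuous fun y => a⁻¹ * y := by fun_prop
    simpa using h2.tendsto a
  filter_upwards [this.eventually h] with y hy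
  simpa using hy a

theorem isLocallyConstant_norm_units [IsUltrametricDist F] :
    IsLocallyConstant fun a : Fˣ => ‖(a : F)‖ := by
  apply isLocallyConstant_of_eventually_one
  have : ∀ᶠ x : Fˣ in 𝓝 1, ‖(x : F) - 1‖ < 1 := by
    have h : Continuous fun x : Fˣ => ‖(x : F) - 1‖ := by fun_prop
    have := h.tendsto 1
    simp only [Units.val_one, sub_self, norm_zero] at this
    exact this.eventually (gt_mem_nhds one_pos)
  filter_upwards [this] with x hx a
  have h1 : ‖(x : F)‖ = 1 := by
    have := IsUltrametricDist.norm_add_eq_max_of_norm_ne_norm (x := (x : F) - 1) (y := 1)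
      (by rw [norm_one]; exact hx.ne)
    rw [sub_add_cancel, norm_one, max_eq_right hx.le] at this
    exact this
  simp [h1]

/-- Elements near `1` are squares: squaring has the invertible derivative `2` at `1`. -/
theorem eventually_isSquare [LocallyCompactSpace F] [CharZero F] :
    ∀ᶠ x : Fˣ in 𝓝 1, IsSquare x := by
  have := ProperSpace.of_nontriviallyNormedField_of_weaklyLocallyCompactSpace F
  have h : HasStrictDerivAt (fun x : F => x ^ 2) 2 1 := by
    simpa using hasStrictDerivAt_pow (𝕜 := F) 2 1
  have h2 := h.map_nhds_eq two_ne_zero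
  simp only [one_pow] at h2
  have h3 : ∀ᶠ y in 𝓝 (1 : F), ∃ x, x ^ 2 = y := by
    rw [← h2]
    exact eventually_map.2 (Eventually.of_forall fun x => ⟨x, rfl⟩)
  have h4 : Tendsto (fun x : Fˣ => (x : F)) (𝓝 1) (𝓝 1) := Units.continuous_val.tendsto 1
  filter_upwards [h4.eventually h3] with x ⟨y, hy⟩
  have hy0 : y ≠ 0 := by
    rintro rfl
    exact x.ne_zero (by rw [← hy]; simp)
  exact ⟨Units.mk0 y hy0, by ext; simp [← hy, sq]⟩

/-- In characteristic zero the squares are open in `F^×`, so a function of the square class is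
locally constant. -/
theorem isLocallyConstant_of_square_invariant [LocallyCompactSpace F] [CharZero F] {α : Type*}
    {φ : Fˣ → α} (hφ : ∀ a b, φ (a * b ^ 2) = φ a) : IsLocallyConstant φ := by
  apply isLocallyConstant_of_eventually_one
  filter_upwards [eventually_isSquare] with x ⟨y, hy⟩ a
  rw [hy, ← sq, hφ]

theorem isOpen_square [LocallyCompactSpace F] [CharZero F] :
    IsOpen (Subgroup.square Fˣ : Set Fˣ) := by
  refine Subgroup.isOpen_of_mem_nhds _ (g := 1) ?_
  filter_upwards [eventually_isSquare (F := F)] with x hx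
  exact hx

/-- There are finitely many square classes: the quotient by the squares is discrete, and it is the
image of a compact annulus. -/
theorem finite_squareClasses [IsUltrametricDist F] [LocallyCompactSpace F] [CharZero F]
    (hF : IsNormalizedAbs F) : Finite (Fˣ ⧸ Subgroup.square Fˣ) := by
  have hq := one_lt_residueCard hF
  have : DiscreteTopology (Fˣ ⧸ Subgroup.square Fˣ) :=
    QuotientGroup.discreteTopology isOpen_square
  have hK : IsCompact ((QuotientGroup.mk : Fˣ → Fˣ ⧸ Subgroup.square Fˣ) ''
      {a : Fˣ | 1 ≤ ‖(a : F)‖ ∧ ‖(a : F)‖ ≤ (residueCard F : ℝ)}) :=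
    (isCompact_annulus one_pos).image continuous_quot_mk
  rw [isCompact_iff_finite] at hK
  refine Set.finite_univ_iff.1 (hK.subset ?_)
  intro c _
  obtain ⟨t, rfl⟩ := QuotientGroup.mk_surjective c
  obtain ⟨n, hn⟩ := exists_zpow_eq_norm hF t
  obtain ⟨p, hp⟩ := exists_norm_eq hF (-(n / 2))
  refine ⟨t * p ^ 2, ?_, ?_⟩
  · have hq0 : (residueCard F : ℝ) ≠ 0 := by positivity
    have hnorm : ‖((t * p ^ 2 : Fˣ) : F)‖ = (residueCard F : ℝ) ^ (n % 2) := by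
      rw [Units.val_mul, Units.val_pow_eq_pow_val, norm_mul, norm_pow, hn, hp, ← zpow_natCast,
        ← _root_.zpow_mul, ← zpow_add₀ hq0]
      congr 1
      push_cast
      omega
    have hq1 : (1 : ℝ) ≤ residueCard F := by exact_mod_cast hq.le
    simp only [Set.mem_ofPred_eq, hnorm]
    rcases Int.emod_two_eq_zero_or_one n with h | h <;> simp [h, hq1]
  · rw [QuotientGroup.eq]
    exact ⟨p⁻¹, by simp [sq, mul_comm]⟩

/-- The value of a function of the square class can be computed at the chosen representative. -/
theorem apply_out_of_square_invariant {α : Type*} {φ : Fˣ → α} (hφ : ∀ a b, φ (a * b ^ 2) = φ a)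
    (a : Fˣ) : φ (QuotientGroup.mk (s := Subgroup.square Fˣ) a).out = φ a := by
  obtain ⟨r, hr⟩ := QuotientGroup.eq.1
    (Quotient.out_eq' (QuotientGroup.mk (s := Subgroup.square Fˣ) a))
  have h : a = (QuotientGroup.mk (s := Subgroup.square Fˣ) a).out * r ^ 2 := by
    rw [sq, ← hr, mul_inv_cancel_left]
  conv_rhs => rw [h]
  rw [hφ]

/-- The half-open annulus `R < |a| ≤ q² R`, a fundamental domain for multiplication by an element
of absolute value `q²`. -/
def shell (F : Type*) [NontriviallyNormedField F] [IsUltrametricDist F] (R : ℝ) : Set Fˣ :=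
  {a | R < ‖(a : F)‖ ∧ ‖(a : F)‖ ≤ (residueCard F : ℝ) ^ 2 * R}

theorem isOpen_norm_preimage [IsUltrametricDist F] (s : Set ℝ) :
    IsOpen {a : Fˣ | ‖(a : F)‖ ∈ s} :=
  isLocallyConstant_norm_units s

theorem isCompact_shell [IsUltrametricDist F] [LocallyCompactSpace F] {R : ℝ} (hR : 0 < R) :
    IsCompact (shell F R) := by
  refine (isCompact_annulus (R := (residueCard F : ℝ) ^ 2 * R) hR).of_isClosed_subset ?_ ?_
  · rw [← isOpen_compl_iff]
    exact isOpen_norm_preimage (Set.Ioc R ((residueCard F : ℝ) ^ 2 * R))ᶜ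
  · exact fun a ha => ⟨ha.1.le, ha.2⟩

/-- The squares of absolute value one: an open subset of finite positive measure. -/
def unitSquares (F : Type*) [NontriviallyNormedField F] : Set Fˣ := {a | IsSquare a ∧ ‖(a : F)‖ = 1}

theorem measure_unitSquares_pos [IsUltrametricDist F] [LocallyCompactSpace F] [CharZero F]
    [MeasurableSpace Fˣ] (μA : Measure Fˣ) [μA.IsHaarMeasure] : 0 < μA (unitSquares F) := by
  refine IsOpen.measure_pos μA (U := unitSquares F)
    (isOpen_square.inter (isOpen_norm_preimage {1})) ⟨1, IsSquare.one, by simp⟩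

theorem measure_unitSquares_lt_top [LocallyCompactSpace F] [MeasurableSpace Fˣ] (μA : Measure Fˣ)
    [μA.IsHaarMeasure] : μA (unitSquares F) < ⊤ :=
  lt_of_le_of_lt (measure_mono (t := {a : Fˣ | 1 ≤ ‖(a : F)‖ ∧ ‖(a : F)‖ ≤ 1})
    fun _ ha => ⟨ha.2.ge, ha.2.le⟩) (isCompact_annulus one_pos).measure_lt_top

variable [MeasurableSpace Fˣ] [BorelSpace Fˣ] (μA : Measure Fˣ)

theorem measurableSet_shell [IsUltrametricDist F] (R : ℝ) : MeasurableSet (shell F R) :=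
  (isOpen_norm_preimage (Set.Ioc R ((residueCard F : ℝ) ^ 2 * R))).measurableSet

theorem measurableSet_norm_gt [IsUltrametricDist F] (R : ℝ) :
    MeasurableSet {a : Fˣ | R < ‖(a : F)‖} :=
  (isOpen_norm_preimage (Set.Ioi R)).measurableSet

/-- Each square class meets the annulus `R < |a| ≤ q² R` in a set of the same measure: the absolute
values in a square class make up one coset of `q^{2ℤ}`, so exactly one of them is in the annulus. -/
theorem measure_shell_inter_squareClass [IsUltrametricDist F] [μA.IsHaarMeasure]
    (hF : IsNormalizedAbs F) {R : ℝ} (hR : 0 < R) (t : Fˣ) :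
    μA (shell F R ∩ {a | QuotientGroup.mk (s := Subgroup.square Fˣ) a = QuotientGroup.mk t}) =
      μA (unitSquares F) := by
  have hq : (1 : ℝ) < residueCard F := by exact_mod_cast one_lt_residueCard hF
  have hq0 : (residueCard F : ℝ) ≠ 0 := by positivity
  have hq2 : (1 : ℝ) < (residueCard F : ℝ) ^ 2 := one_lt_pow₀ hq two_ne_zero
  have ht : 0 < ‖(t : F)‖ := norm_pos_iff.2 t.ne_zero
  obtain ⟨n, hn1, hn2⟩ := exists_mem_Ico_zpow (div_pos hR ht) hq2
  obtain ⟨p, hp⟩ := exists_norm_eq hF (n + 1)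
  rw [← measure_preimage_mul μA (t * p ^ 2)]
  congr 1
  have hnp : ‖(p : F)‖ ^ 2 = ((residueCard F : ℝ) ^ 2) ^ (n + 1) := by
    rw [hp, ← zpow_natCast, ← zpow_natCast, ← _root_.zpow_mul, ← _root_.zpow_mul, mul_comm]
  have hp1 : R < ‖(t : F)‖ * ‖(p : F)‖ ^ 2 := by
    rw [hnp]
    rwa [div_lt_iff₀' ht] at hn2
  have hp2 : ‖(t : F)‖ * ‖(p : F)‖ ^ 2 ≤ (residueCard F : ℝ) ^ 2 * R := by
    rw [hnp, zpow_add_one₀ (by positivity)]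
    rw [le_div_iff₀' ht] at hn1
    nlinarith
  ext a
  simp only [Set.mem_preimage, Set.mem_inter_iff, Set.mem_ofPred_eq, shell, unitSquares,
    Units.val_mul, Units.val_pow_eq_pow_val, norm_mul, norm_pow]
  have hcl : QuotientGroup.mk (s := Subgroup.square Fˣ) (t * p ^ 2 * a) = QuotientGroup.mk t ↔
      IsSquare a := by
    rw [eq_comm, QuotientGroup.eq, mul_assoc, inv_mul_cancel_left, Subgroup.mem_square]
    constructor
    · rintro ⟨r, hr⟩
      refine ⟨p⁻¹ * r, ?_⟩
      rw [show p⁻¹ * r * (p⁻¹ * r) = (p ^ 2)⁻¹ * (r * r) by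
        rw [sq, mul_inv]; exact mul_mul_mul_comm _ _ _ _, ← hr, inv_mul_cancel_left]
    · rintro ⟨r, rfl⟩
      exact ⟨p * r, by rw [sq]; exact mul_mul_mul_comm _ _ _ _⟩
  rw [hcl, and_comm]
  refine and_congr_right fun ha => ?_
  obtain ⟨r, rfl⟩ := ha
  obtain ⟨m, hm⟩ := exists_zpow_eq_norm hF r
  have hr : ‖((r * r : Fˣ) : F)‖ = ((residueCard F : ℝ) ^ 2) ^ m := by
    rw [Units.val_mul, norm_mul, hm, ← sq, ← zpow_natCast, ← zpow_natCast, ← _root_.zpow_mul,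
      ← _root_.zpow_mul, mul_comm]
  rw [hr]
  constructor
  · rintro ⟨h1, h2⟩
    have hm0 : m = 0 := by
      have hA : ‖(t : F)‖ * ‖(p : F)‖ ^ 2 > 0 := lt_trans hR hp1
      have h3 : ((residueCard F : ℝ) ^ 2) ^ m < ((residueCard F : ℝ) ^ 2) ^ (1 : ℤ) := by
        rw [zpow_one]
        by_contra! h
        nlinarith
      have h4 : ((residueCard F : ℝ) ^ 2) ^ (-1 : ℤ) < ((residueCard F : ℝ) ^ 2) ^ m := by
        rw [_root_.zpow_neg_one, inv_lt_iff_one_lt_mul₀ (by positivity)]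
        by_contra! h
        nlinarith
      have h5 := (zpow_lt_zpow_iff_right₀ hq2).1 h3
      have h6 := (zpow_lt_zpow_iff_right₀ hq2).1 h4
      omega
    simp [hm0]
  · intro h
    rw [h, mul_one]
    exact ⟨hp1, hp2⟩

/-- The integral over the annulus of a function of the square class is, up to a constant, the sum
over all square classes. -/
theorem setIntegral_shell_eq [LocallyCompactSpace F] [IsUltrametricDist F] [CharZero F]
    [μA.IsHaarMeasure] (hF : IsNormalizedAbs F) {R : ℝ} (hR : 0 < R) {φ : Fˣ → ℂ}
    (hφ : ∀ a b, φ (a * b ^ 2) = φ a) :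
    ∫ a in shell F R, φ a ∂μA =
      (μA.real (unitSquares F) : ℂ) * ∑ᶠ c : Fˣ ⧸ Subgroup.square Fˣ, φ c.out := by
  have := finite_squareClasses hF
  have := Fintype.ofFinite (Fˣ ⧸ Subgroup.square Fˣ)
  have hcont : Continuous φ := (isLocallyConstant_of_square_invariant hφ).continuous
  set p : Fˣ ⧸ Subgroup.square Fˣ → Set Fˣ := fun c =>
    shell F R ∩ {a | QuotientGroup.mk (s := Subgroup.square Fˣ) a = c} with hp
  have hlc : IsLocallyConstant (fun a : Fˣ => QuotientGroup.mk (s := Subgroup.square Fˣ) a) :=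
    isLocallyConstant_of_square_invariant fun a b => by
      rw [eq_comm, QuotientGroup.eq]
      exact ⟨b, by simp [sq]⟩
  have hpm : ∀ c, MeasurableSet (p c) := fun c =>
    (measurableSet_shell R).inter (hlc {c}).measurableSet
  have hU : shell F R = ⋃ c, p c := by
    ext a
    simp [hp]
  have hint : IntegrableOn φ (shell F R) μA := hcont.continuousOn.integrableOn_compact
    (isCompact_shell hR)
  rw [finsum_eq_sum_of_fintype, Finset.mul_sum]
  conv_lhs => rw [hU]
  rw [integral_iUnion_fintype hpm ?_ ?_]
  · refine Finset.sum_congr rfl fun c _ => ?_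
    have h1 : ∫ a in p c, φ a ∂μA = ∫ a in p c, φ c.out ∂μA :=
      setIntegral_congr_fun (hpm c) fun a ha => by
        rw [← ha.2, apply_out_of_square_invariant hφ]
    rw [h1, setIntegral_const]
    have h2 := measure_shell_inter_squareClass μA hF hR c.out
    rw [show (QuotientGroup.mk c.out : Fˣ ⧸ Subgroup.square Fˣ) = c from Quotient.out_eq' c] at h2
    rw [Measure.real, h2, ← Measure.real, Complex.real_smul]
  · intro c c' hcc
    exact Set.disjoint_left.2 fun a ha ha' => hcc (ha.2.symm.trans ha'.2)
  · exact fun c => hint.mono_set Set.inter_subset_left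

end MultiplicativeGroup

/-! ### The pole at `s = 0` of integrals over `F^×` -/

section Pole

variable {F : Type*} [NontriviallyNormedField F]

/-- The gamma factor has a simple zero at `s = 0`, with a positive leading coefficient. -/
theorem tendsto_gammaF [IsUltrametricDist F] (hF : IsNormalizedAbs F) (ψ : AddChar F ℂ) :
    ∃ c : ℝ, 0 < c ∧ ∃ A : ℝ → ℂ, Tendsto A (𝓝[>] 0) (𝓝 (c : ℂ)) ∧
      ∀ᶠ s : ℝ in 𝓝[>] 0, gammaF ψ (s : ℂ) = A s * ((1 - (residueCard F : ℝ) ^ (-s) : ℝ) : ℂ) := by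
  have hq : (1 : ℝ) < residueCard F := by exact_mod_cast one_lt_residueCard hF
  have hqc : (residueCard F : ℂ) ≠ 0 := by
    have := one_lt_residueCard hF
    exact_mod_cast (by omega : residueCard F ≠ 0)
  refine ⟨(residueCard F : ℝ) ^ ((level ψ : ℝ) * (1 / 2)) * (1 - (residueCard F : ℝ)⁻¹)⁻¹, ?_,
    fun s => (residueCard F : ℂ) ^ ((level ψ : ℂ) * (1 / 2 - s)) * zetaF F (1 - s), ?_, ?_⟩
  · have : (residueCard F : ℝ)⁻¹ < 1 := inv_lt_one_of_one_lt₀ hq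
    have h2 : 0 < 1 - (residueCard F : ℝ)⁻¹ := by linarith
    positivity
  · have hc : ContinuousAt (fun s : ℂ =>
        (residueCard F : ℂ) ^ ((level ψ : ℂ) * (1 / 2 - s)) * zetaF F (1 - s)) 0 := by
      have hne : (1 : ℂ) - (residueCard F : ℂ) ^ (-(1 - (0 : ℂ))) ≠ 0 := by
        rw [sub_zero, Complex.cpow_neg_one]
        have : (residueCard F : ℝ)⁻¹ < 1 := inv_lt_one_of_one_lt₀ hq
        have h2 : ((1 - (residueCard F : ℝ)⁻¹ : ℝ) : ℂ) ≠ 0 :=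
          Complex.ofReal_ne_zero.2 (by linarith)
        push_cast at h2
        exact h2
      unfold zetaF
      refine ContinuousAt.mul ?_ (ContinuousAt.inv₀ ?_ hne)
      · exact ContinuousAt.const_cpow (by fun_prop) (Or.inl hqc)
      · exact continuousAt_const.sub (ContinuousAt.const_cpow (by fun_prop) (Or.inl hqc))
    have h0 : Tendsto (fun s : ℝ => (s : ℂ)) (𝓝[>] 0) (𝓝 0) :=
      (Complex.continuous_ofReal.tendsto' 0 0 (by simp)).mono_left nhdsWithin_le_nhds
    have hval : (((residueCard F : ℝ) ^ ((level ψ : ℝ) * (1 / 2)) *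
        (1 - (residueCard F : ℝ)⁻¹)⁻¹ : ℝ) : ℂ) =
        (residueCard F : ℂ) ^ ((level ψ : ℂ) * (1 / 2 - 0)) * zetaF F (1 - 0) := by
      simp only [zetaF, sub_zero, Complex.cpow_neg_one]
      rw [Complex.ofReal_mul, Complex.ofReal_cpow (by positivity)]
      push_cast
      rfl
    rw [hval]
    exact hc.tendsto.comp h0
  · refine Eventually.of_forall fun s => ?_
    simp only [gammaF, zetaF, div_inv_eq_mul]
    rw [Complex.ofReal_sub, Complex.ofReal_cpow (by positivity)]
    push_cast
    ring

theorem norm_pow_ofReal_cpow (a : Fˣ) (d : ℕ) (s : ℂ) :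
    ‖((‖(a : F)‖ ^ d : ℝ) : ℂ) ^ (-s)‖ = (‖(a : F)‖ ^ d) ^ (-s.re) := by
  have ha : 0 < ‖(a : F)‖ ^ d := pow_pos (norm_pos_iff.2 a.ne_zero) d
  rw [Complex.norm_cpow_eq_rpow_re_of_pos ha]
  simp

theorem continuous_norm_cpow (d : ℕ) :
    Continuous fun p : ℂ × Fˣ => ((‖(p.2 : F)‖ ^ d : ℝ) : ℂ) ^ (-p.1) := by
  rw [continuous_iff_continuousAt]
  rintro ⟨s, a⟩
  have ha : 0 < ‖(a : F)‖ ^ d := pow_pos (norm_pos_iff.2 a.ne_zero) d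
  refine ContinuousAt.cpow ?_ (by fun_prop) (Complex.ofReal_mem_slitPlane.2 ha)
  exact (Complex.continuous_ofReal.comp
    ((Units.continuous_val.comp continuous_snd).norm.pow d)).continuousAt

variable [IsUltrametricDist F] [LocallyCompactSpace F]

theorem bounded_of_square_invariant [CharZero F] (hF : IsNormalizedAbs F) {φ : Fˣ → ℂ}
    (hφ : ∀ a b, φ (a * b ^ 2) = φ a) : ∃ C, ∀ a, ‖φ a‖ ≤ C := by
  have := finite_squareClasses hF
  obtain ⟨C, hC⟩ := (Set.finite_range fun c : Fˣ ⧸ Subgroup.square Fˣ => ‖φ c.out‖).bddAbove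
  exact ⟨C, fun a => by rw [← apply_out_of_square_invariant hφ]; exact hC ⟨_, rfl⟩⟩

variable [MeasurableSpace Fˣ] [BorelSpace Fˣ] (μA : Measure Fˣ) [μA.IsHaarMeasure]

/-- The function `|a|^{-d σ}` is integrable at infinity on `F^×` for `σ > 0`: it decays
geometrically along the translates of an annulus. -/
theorem integrableOn_norm_rpow (hF : IsNormalizedAbs F) {d : ℕ} (hd : 1 ≤ d) {σ : ℝ} (hσ : 0 < σ)
    {R : ℝ} (hR : 0 < R) :
    IntegrableOn (fun a : Fˣ => (‖(a : F)‖ ^ d) ^ (-σ)) {a | R < ‖(a : F)‖} μA := by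
  have hq : (1 : ℝ) < residueCard F := by exact_mod_cast one_lt_residueCard hF
  have hq0 : (0 : ℝ) < residueCard F := by positivity
  obtain ⟨p, hp⟩ := exists_norm_eq hF 2
  have hp' : ‖(p : F)‖ = (residueCard F : ℝ) ^ 2 := by rw [hp]; norm_cast
  have hp1 : 1 < ‖(p : F)‖ := by rw [hp']; exact one_lt_pow₀ hq two_ne_zero
  -- the translates of the annulus `R < |a| ≤ q² R` by the powers of `p`, with `|p| = q²`
  set S : ℕ → Set Fˣ := fun n => (fun a => (p ^ n)⁻¹ * a) ⁻¹' shell F R with hS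
  have hmem : ∀ n a, a ∈ S n ↔ ‖(p : F)‖ ^ n * R < ‖(a : F)‖ ∧
      ‖(a : F)‖ ≤ ‖(p : F)‖ ^ (n + 1) * R := by
    intro n a
    have h0 : 0 < ‖(p : F)‖ ^ n := by positivity
    simp only [hS, shell, Set.mem_preimage, Set.mem_ofPred_eq, Units.val_mul, norm_mul,
      Units.val_inv_eq_inv_val, Units.val_pow_eq_pow_val, norm_inv, norm_pow, ← hp']
    rw [lt_inv_mul_iff₀ h0, inv_mul_le_iff₀ h0, ← mul_assoc, pow_succ]
  have hU : {a : Fˣ | R < ‖(a : F)‖} ⊆ ⋃ n, S n := by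
    intro a ha
    obtain ⟨n, hn1, hn2⟩ := exists_mem_Ioc_zpow (x := ‖(a : F)‖ / R)
      (div_pos (norm_pos_iff.2 a.ne_zero) hR) hp1
    have hn0 : 0 ≤ n := by
      have h1 : 1 < ‖(p : F)‖ ^ (n + 1) := lt_of_lt_of_le ((one_lt_div hR).2 ha) hn2
      have h2 : ‖(p : F)‖ ^ (0 : ℤ) < ‖(p : F)‖ ^ (n + 1) := by simpa using h1
      have := (zpow_lt_zpow_iff_right₀ hp1).1 h2
      omega
    lift n to ℕ using hn0
    rw [Set.mem_iUnion]
    refine ⟨n, (hmem n a).2 ⟨?_, ?_⟩⟩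
    · rw [lt_div_iff₀ hR] at hn1; exact_mod_cast hn1
    · rw [div_le_iff₀ hR] at hn2; exact_mod_cast hn2
  have hcont : Continuous fun a : Fˣ => (‖(a : F)‖ ^ d) ^ (-σ) :=
    (Units.continuous_val.norm.pow d).rpow_const
      fun a => Or.inl (pow_pos (norm_pos_iff.2 a.ne_zero) d).ne'
  refine IntegrableOn.mono_set ⟨hcont.aestronglyMeasurable, ?_⟩ hU
  rw [hasFiniteIntegral_iff_enorm]
  refine lt_of_le_of_lt (lintegral_iUnion_le S _) ?_
  set ρ : ℝ := (‖(p : F)‖ ^ d) ^ (-σ) with hρ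
  have hρ0 : 0 ≤ ρ := by positivity
  have hρ1 : ρ < 1 := Real.rpow_lt_one_of_one_lt_of_neg (one_lt_pow₀ hp1 (by omega)) (by linarith)
  have hbound : ∀ n, ∫⁻ a in S n, ‖(‖(a : F)‖ ^ d) ^ (-σ)‖ₑ ∂μA ≤
      ENNReal.ofReal ((R ^ d) ^ (-σ)) * μA (shell F R) * ENNReal.ofReal ρ ^ n := by
    intro n
    have hb : ∀ a ∈ S n, ‖(‖(a : F)‖ ^ d) ^ (-σ)‖ₑ ≤ ENNReal.ofReal ((R ^ d) ^ (-σ) * ρ ^ n) := by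
      intro a ha
      have h0 : 0 < ‖(p : F)‖ ^ n * R := by positivity
      rw [Real.enorm_of_nonneg (by positivity)]
      refine ENNReal.ofReal_le_ofReal ?_
      have h1 : (‖(a : F)‖ ^ d) ^ (-σ) ≤ ((‖(p : F)‖ ^ n * R) ^ d) ^ (-σ) :=
        Real.rpow_le_rpow_of_nonpos (by positivity)
          (pow_le_pow_left₀ h0.le ((hmem n a).1 ha).1.le d) (by linarith)
      refine h1.trans (le_of_eq ?_)
      rw [mul_pow, mul_comm, Real.mul_rpow (by positivity) (by positivity), hρ, ← pow_mul,
        mul_comm n d, pow_mul, ← Real.rpow_natCast _ n, ← Real.rpow_natCast _ n,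
        ← Real.rpow_mul (by positivity), ← Real.rpow_mul (by positivity), mul_comm (n : ℝ)]
    calc ∫⁻ a in S n, ‖(‖(a : F)‖ ^ d) ^ (-σ)‖ₑ ∂μA
        ≤ ∫⁻ _ in S n, ENNReal.ofReal ((R ^ d) ^ (-σ) * ρ ^ n) ∂μA :=
          setLIntegral_mono measurable_const hb
      _ = ENNReal.ofReal ((R ^ d) ^ (-σ) * ρ ^ n) * μA (shell F R) := by
          rw [setLIntegral_const, hS, measure_preimage_mul]
      _ = _ := by
          rw [ENNReal.ofReal_mul (by positivity), ENNReal.ofReal_pow hρ0]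
          ring
  refine lt_of_le_of_lt (ENNReal.tsum_le_tsum hbound) ?_
  rw [ENNReal.tsum_mul_left, ENNReal.tsum_geometric]
  refine ENNReal.mul_lt_top (ENNReal.mul_lt_top ENNReal.ofReal_lt_top
    (isCompact_shell hR).measure_lt_top) ?_
  rw [ENNReal.inv_lt_top, tsub_pos_iff_lt]
  exact ENNReal.ofReal_lt_one.2 hρ1

theorem integrableOn_square_invariant [CharZero F] (hF : IsNormalizedAbs F) {d : ℕ} (hd : 1 ≤ d)
    {φ : Fˣ → ℂ} (hφ : ∀ a b, φ (a * b ^ 2) = φ a) {s : ℂ} (hs : 0 < s.re) {R : ℝ} (hR : 0 < R) :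
    IntegrableOn (fun a : Fˣ => φ a * ((‖(a : F)‖ ^ d : ℝ) : ℂ) ^ (-s)) {a | R < ‖(a : F)‖} μA := by
  obtain ⟨C, hC⟩ := bounded_of_square_invariant hF hφ
  refine Integrable.mono' ((integrableOn_norm_rpow μA hF hd hs hR).const_mul C) ?_ ?_
  · refine Continuous.aestronglyMeasurable ?_
    exact (isLocallyConstant_of_square_invariant hφ).continuous.mul
      ((continuous_norm_cpow d).comp (Continuous.prodMk_right s))
  · refine Eventually.of_forall fun a => ?_
    rw [norm_mul, norm_pow_ofReal_cpow]
    exact mul_le_mul_of_nonneg_right (hC a) (by positivity)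

/-- The integral of a function of the square class against `|a|^{-ds}` over a neighbourhood of
infinity is, by translation by an element of absolute value `q²`, a geometric series times the
integral over an annulus. -/
theorem setIntegral_mul_one_sub [CharZero F] (hF : IsNormalizedAbs F) {d : ℕ} (hd : 1 ≤ d)
    {φ : Fˣ → ℂ} (hφ : ∀ a b, φ (a * b ^ 2) = φ a) {s : ℂ} (hs : 0 < s.re) {R : ℝ} (hR : 0 < R) :
    (∫ a in {a : Fˣ | R < ‖(a : F)‖}, φ a * ((‖(a : F)‖ ^ d : ℝ) : ℂ) ^ (-s) ∂μA) *
        (1 - ((((residueCard F : ℝ) ^ 2) ^ d : ℝ) : ℂ) ^ (-s)) =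
      ∫ a in shell F R, φ a * ((‖(a : F)‖ ^ d : ℝ) : ℂ) ^ (-s) ∂μA := by
  have hq : (1 : ℝ) < residueCard F := by exact_mod_cast one_lt_residueCard hF
  obtain ⟨p, hp⟩ := exists_norm_eq hF 1
  rw [zpow_one] at hp
  set g : Fˣ → ℂ := fun a => φ a * ((‖(a : F)‖ ^ d : ℝ) : ℂ) ^ (-s) with hg
  have hint := integrableOn_square_invariant μA hF hd hφ hs hR
  have hsplit : {a : Fˣ | R < ‖(a : F)‖} =
      shell F R ∪ {a : Fˣ | (residueCard F : ℝ) ^ 2 * R < ‖(a : F)‖} := by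
    ext a
    have h2 : (1 : ℝ) < (residueCard F : ℝ) ^ 2 := one_lt_pow₀ hq two_ne_zero
    simp only [shell, Set.mem_ofPred_eq, Set.mem_union]
    constructor
    · intro h
      rcases le_or_gt ‖(a : F)‖ ((residueCard F : ℝ) ^ 2 * R) with h3 | h3
      · exact Or.inl ⟨h, h3⟩
      · exact Or.inr h3
    · rintro (h | h)
      · exact h.1
      · nlinarith
  have hdisj : Disjoint (shell F R) {a : Fˣ | (residueCard F : ℝ) ^ 2 * R < ‖(a : F)‖} :=
    Set.disjoint_left.2 fun a h1 h2 => not_lt.2 h1.2 h2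
  have htrans : ∫ a in {a : Fˣ | (residueCard F : ℝ) ^ 2 * R < ‖(a : F)‖}, g a ∂μA =
      ((((residueCard F : ℝ) ^ 2) ^ d : ℝ) : ℂ) ^ (-s) *
        ∫ a in {a : Fˣ | R < ‖(a : F)‖}, g a ∂μA := by
    have hpre : (fun a => p ^ 2 * a) ⁻¹' {a : Fˣ | (residueCard F : ℝ) ^ 2 * R < ‖(a : F)‖} =
        {a : Fˣ | R < ‖(a : F)‖} := by
      ext a
      have : (0 : ℝ) < (residueCard F : ℝ) ^ 2 := by positivity
      simp [hp, this]
    have h1 := (measurePreserving_mul_left μA (p ^ 2)).setIntegral_preimage_emb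
      (MeasurableEquiv.mulLeft (p ^ 2)).measurableEmbedding g
      {a : Fˣ | (residueCard F : ℝ) ^ 2 * R < ‖(a : F)‖}
    rw [hpre] at h1
    rw [← h1, ← integral_const_mul]
    refine integral_congr_ae (Eventually.of_forall fun a => ?_)
    simp only [hg]
    rw [mul_comm (p ^ 2) a, hφ, Units.val_mul, norm_mul, Units.val_pow_eq_pow_val, norm_pow, hp,
      mul_comm (‖(a : F)‖), mul_pow, Complex.ofReal_mul,
      Complex.mul_cpow_ofReal_nonneg (by positivity) (by positivity)]
    ring
  have h1 : ∫ a in {a : Fˣ | R < ‖(a : F)‖}, g a ∂μA = (∫ a in shell F R, g a ∂μA) +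
      ∫ a in {a : Fˣ | (residueCard F : ℝ) ^ 2 * R < ‖(a : F)‖}, g a ∂μA := by
    rw [hsplit]
    refine setIntegral_union hdisj (measurableSet_norm_gt _) ?_ ?_
    · exact hint.mono_set (by rw [hsplit]; exact Set.subset_union_left)
    · exact hint.mono_set (by rw [hsplit]; exact Set.subset_union_right)
  rw [htrans] at h1
  linear_combination h1

theorem tendsto_one_sub_rpow_ratio {x y : ℝ} (hx : 0 < x) (hy : 1 < y) :
    Tendsto (fun s : ℝ => (1 - x ^ (-s)) / (1 - y ^ (-s))) (𝓝[>] 0)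
      (𝓝 (Real.log x / Real.log y)) := by
  have key : ∀ z : ℝ, 0 < z →
      Tendsto (fun s : ℝ => s⁻¹ * (1 - z ^ (-s))) (𝓝[>] 0) (𝓝 (Real.log z)) := by
    intro z hz
    have h1 : HasDerivAt (fun s : ℝ => 1 - z ^ (-s)) (Real.log z) 0 := by
      have := ((hasDerivAt_neg (0 : ℝ)).const_rpow hz).const_sub 1
      simpa using this
    have h2 := h1.tendsto_slope_zero_right
    simpa using h2
  have hly : Real.log y ≠ 0 := (Real.log_pos hy).ne'
  refine ((key x hx).div (key y (by linarith)) hly).congr' ?_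
  filter_upwards [self_mem_nhdsWithin] with s hs
  have hs0 : s⁻¹ ≠ 0 := inv_ne_zero (ne_of_gt hs)
  exact mul_div_mul_left _ _ hs0

/-- A function `φ` of the square class, integrated against `|a|^{-ds}` near infinity, has a simple
pole at `s = 0`, with residue proportional to the sum of `φ` over all square classes. -/
theorem tendsto_setIntegral_pole [CharZero F] (hF : IsNormalizedAbs F) {d : ℕ} (hd : 1 ≤ d)
    {φ : Fˣ → ℂ} (hφ : ∀ a b, φ (a * b ^ 2) = φ a) {R : ℝ} (hR : 0 < R) :
    Tendsto (fun s : ℝ => ((1 - (residueCard F : ℝ) ^ (-s) : ℝ) : ℂ) *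
        ∫ a in {a : Fˣ | R < ‖(a : F)‖}, φ a * ((‖(a : F)‖ ^ d : ℝ) : ℂ) ^ (-(s : ℂ)) ∂μA)
      (𝓝[>] 0) (𝓝 (((2 * d : ℝ)⁻¹ * μA.real (unitSquares F) : ℝ) *
        ∑ᶠ c : Fˣ ⧸ Subgroup.square Fˣ, φ c.out)) := by
  have hq : (1 : ℝ) < residueCard F := by exact_mod_cast one_lt_residueCard hF
  have hy : 1 < ((residueCard F : ℝ) ^ 2) ^ d :=
    one_lt_pow₀ (one_lt_pow₀ hq two_ne_zero) (by omega)
  have hlog := (Real.log_pos hq).ne'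
  have h1 := tendsto_one_sub_rpow_ratio (x := residueCard F) (by linarith) hy
  have h1' : Real.log (residueCard F) / Real.log (((residueCard F : ℝ) ^ 2) ^ d) =
      (2 * d : ℝ)⁻¹ := by
    have hd0 : (d : ℝ) ≠ 0 := by positivity
    rw [Real.log_pow, Real.log_pow]
    push_cast
    field_simp
  rw [h1'] at h1
  have hcont : Continuous fun s : ℂ =>
      ∫ a in shell F R, φ a * ((‖(a : F)‖ ^ d : ℝ) : ℂ) ^ (-s) ∂μA := by
    refine continuous_parametric_integral_of_continuous
      (f := fun (s : ℂ) (a : Fˣ) => φ a * ((‖(a : F)‖ ^ d : ℝ) : ℂ) ^ (-s)) ?_ (isCompact_shell hR)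
    exact ((isLocallyConstant_of_square_invariant hφ).continuous.comp continuous_snd).mul
      (continuous_norm_cpow d)
  have h2 : Tendsto (fun s : ℝ =>
      ∫ a in shell F R, φ a * ((‖(a : F)‖ ^ d : ℝ) : ℂ) ^ (-(s : ℂ)) ∂μA) (𝓝[>] 0)
      (𝓝 ((μA.real (unitSquares F) : ℂ) * ∑ᶠ c : Fˣ ⧸ Subgroup.square Fˣ, φ c.out)) := by
    rw [← setIntegral_shell_eq μA hF hR hφ]
    have := (hcont.comp Complex.continuous_ofReal).tendsto 0
    simp only [Function.comp_def, Complex.ofReal_zero, neg_zero, Complex.cpow_zero, mul_one] at this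
    exact this.mono_left nhdsWithin_le_nhds
  have h3 := ((Complex.continuous_ofReal.tendsto _).comp h1).mul h2
  rw [← mul_assoc, ← Complex.ofReal_mul] at h3
  refine h3.congr' ?_
  filter_upwards [self_mem_nhdsWithin] with s hs
  have hs' : 0 < (s : ℂ).re := by simpa using hs
  rw [← setIntegral_mul_one_sub μA hF hd hφ hs' hR]
  have h4 : ((((residueCard F : ℝ) ^ 2) ^ d : ℝ) : ℂ) ^ (-(s : ℂ)) =
      (((((residueCard F : ℝ) ^ 2) ^ d) ^ (-s) : ℝ) : ℂ) := by
    rw [Complex.ofReal_cpow (by positivity)]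
    push_cast
    rfl
  have h5 : (1 : ℝ) - ((((residueCard F : ℝ) ^ 2) ^ d) ^ (-s)) ≠ 0 := by
    have := Real.rpow_lt_one_of_one_lt_of_neg hy (neg_lt_zero.2 hs)
    linarith
  rw [h4]
  simp only [Function.comp_apply, Complex.ofReal_div]
  rw [← Complex.ofReal_one, ← Complex.ofReal_sub]
  have h6 : (((1 : ℝ) - ((((residueCard F : ℝ) ^ 2) ^ d) ^ (-s)) : ℝ) : ℂ) ≠ 0 := by
    exact_mod_cast h5
  field_simp

end Pole

/-! ### Uniqueness of invariant measures on an orbit -/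

section Uniqueness

variable {H X : Type*} [Group H] [TopologicalSpace H] [IsTopologicalGroup H]
  [LocallyCompactSpace H] [SecondCountableTopology H] [MeasurableSpace H] [BorelSpace H]
  [MeasurableSpace X]

/-- A function that is almost everywhere invariant under each element of a group acting
transitively (up to a null set) is almost everywhere constant: by Fubini almost every orbit map
pulls it back to a function constant almost everywhere for Haar measure. -/
theorem ae_const_of_invariant {act : H → X → X}
    (hact : Measurable (Function.uncurry act)) (hmul : ∀ g h x, act (g * h) x = act g (act h x))
    (ρ : Measure X) [SigmaFinite ρ] (hρ : ∀ g, ρ.map (act g) = ρ) (x₀ : X)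
    (horb : ∀ᵐ x ∂ρ, x ∈ Set.range fun g => act g x₀) {D : X → ENNReal} (hD : Measurable D)
    (hinv : ∀ g, ∀ᵐ x ∂ρ, D (act g x) = D x) : ∃ c, ∀ᵐ x ∂ρ, D x = c := by
  rcases eq_or_ne ρ 0 with h0 | h0
  · exact ⟨0, by rw [h0]; simp⟩
  let ν : Measure H := Measure.haar
  have hactg : ∀ g, Measurable (act g) := fun g => hact.comp measurable_prodMk_left
  have h1 : ∀ᵐ x ∂ρ, ∀ᵐ g ∂ν, D (act g x) = D x :=
    (Measure.ae_ae_comm (by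
      exact measurableSet_eq_fun (hD.comp (hact.comp measurable_swap)) (hD.comp measurable_fst))).2
      (Eventually.of_forall hinv)
  have := ae_neBot.2 h0
  obtain ⟨x₁, hx₁, hx₁o⟩ := (h1.and horb).exists
  obtain ⟨g₁, hg₁⟩ := hx₁o
  refine ⟨D x₁, ?_⟩
  set E : Set X := {y | D y ≠ D x₁} with hE
  have hEm : MeasurableSet E := (measurableSet_eq_fun hD measurable_const).compl
  -- every point of the orbit is sent into `E` by a null set of group elements only
  have h2 : ∀ᵐ x ∂ρ, ∀ᵐ g ∂ν, act g x ∉ E := by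
    filter_upwards [horb] with x hx
    obtain ⟨g₂, rfl⟩ := hx
    have hx : act g₂ x₀ = act (g₂ * g₁⁻¹) x₁ := by
      rw [← hg₁]
      simp only
      rw [← hmul]
      simp
    have h3 : ν {g | act g x₁ ∈ E} = 0 := by
      have : {g | act g x₁ ∈ E} = {g | ¬ D (act g x₁) = D x₁} := rfl
      rw [this]
      exact hx₁
    have h4 := (measure_mul_right_null ν (g₂ * g₁⁻¹)).2 h3
    change ν {g | ¬ (act g (act g₂ x₀) ∉ E)} = 0
    convert h4 using 2
    ext g
    simp only [not_not, Set.mem_preimage, Set.mem_ofPred_eq, hmul, hx]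
  have h5 : ∀ᵐ g ∂ν, ∀ᵐ x ∂ρ, act g x ∉ E := by
    refine (Measure.ae_ae_comm (p := fun x g => act g x ∉ E) ?_).1 h2
    exact (hact.comp measurable_swap) hEm.compl
  obtain ⟨g, hg⟩ := h5.exists
  have h6 : ρ E = 0 := by
    rw [← hρ g, Measure.map_apply (hactg g) hEm]
    exact measure_mono_null (fun x hx => not_not.2 hx) hg
  exact measure_mono_null (fun x hx => hx) h6

/-- Two nonzero σ-finite invariant measures carried by one orbit are proportional. -/
theorem exists_eq_smul_of_invariant {act : H → X → X}
    (hact : Measurable (Function.uncurry act)) (hmul : ∀ g h x, act (g * h) x = act g (act h x))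
    (hone : ∀ x, act 1 x = x) (μ ν : Measure X) [SigmaFinite (μ + ν)]
    (hμ : ∀ g, μ.map (act g) = μ) (hν : ∀ g, ν.map (act g) = ν) (x₀ : X)
    (hμo : ∀ᵐ x ∂μ, x ∈ Set.range fun g => act g x₀)
    (hνo : ∀ᵐ x ∂ν, x ∈ Set.range fun g => act g x₀) (hμ0 : μ ≠ 0) (hν0 : ν ≠ 0) :
    ∃ c : ENNReal, c ≠ 0 ∧ c ≠ ⊤ ∧ μ = c • ν := by
  have hactg : ∀ g, Measurable (act g) := fun g => hact.comp measurable_prodMk_left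
  set ρ := μ + ν with hρdef
  have hρ : ∀ g, ρ.map (act g) = ρ := fun g => by
    rw [hρdef, Measure.map_add _ _ (hactg g), hμ, hν]
  have horb : ∀ᵐ x ∂ρ, x ∈ Set.range fun g => act g x₀ := by
    rw [hρdef, ae_add_measure_iff]
    exact ⟨hμo, hνo⟩
  -- the density of an invariant measure with respect to `μ + ν` is invariant, hence constant
  have key : ∀ κ : Measure X, κ ≤ ρ → (∀ g, κ.map (act g) = κ) → ∃ c : ENNReal, κ = c • ρ := by
    intro κ hκ hκi
    have : SigmaFinite κ := ⟨⟨{ set := spanningSets ρ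
                                set_mem := fun _ => trivial
                                finite := fun n => lt_of_le_of_lt (hκ _)
                                  (measure_spanningSets_lt_top ρ n)
                                spanning := iUnion_spanningSets ρ }⟩⟩
    have hac : κ ≪ ρ := Measure.absolutelyContinuous_of_le hκ
    have hD : ρ.withDensity (κ.rnDeriv ρ) = κ := Measure.withDensity_rnDeriv_eq κ ρ hac
    have hmeas := Measure.measurable_rnDeriv κ ρ
    obtain ⟨c, hc⟩ := ae_const_of_invariant hact hmul ρ hρ x₀ horb hmeas (fun g => by
      have h1 : ρ.withDensity (fun x => κ.rnDeriv ρ (act g x)) = κ := by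
        have h2 : (ρ.withDensity (fun x => κ.rnDeriv ρ (act g x))).map (act g) = κ := by
          ext s hs
          rw [Measure.map_apply (hactg g) hs, withDensity_apply _ (hactg g hs),
            ← setLIntegral_map hs hmeas (hactg g), hρ, ← withDensity_apply _ hs, hD]
        have h3 := congrArg (Measure.map (act g⁻¹)) h2
        rw [hκi, Measure.map_map (hactg _) (hactg _)] at h3
        have h4 : act g⁻¹ ∘ act g = id := by
          ext x
          simp [← hmul, hone]
        rwa [h4, Measure.map_id] at h3
      have h5 := (withDensity_eq_iff_of_sigmaFinite (μ := ρ)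
        (hmeas.comp (hactg g)).aemeasurable hmeas.aemeasurable).1 (h1.trans hD.symm)
      exact h5)
    refine ⟨c, ?_⟩
    rw [← hD, withDensity_congr_ae hc, withDensity_const]
  obtain ⟨a, ha⟩ := key μ (Measure.le_add_right le_rfl) hμ
  obtain ⟨b, hb⟩ := key ν (Measure.le_add_left le_rfl) hν
  have hρ0 : ρ ≠ 0 := by
    intro h
    apply hμ0
    rw [ha, h, smul_zero]
  have ha0 : a ≠ 0 := by rintro rfl; exact hμ0 (by rw [ha, zero_smul])
  have hb0 : b ≠ 0 := by rintro rfl; exact hν0 (by rw [hb, zero_smul])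
  -- a set of finite positive measure shows that the two constants are finite
  obtain ⟨n, hn⟩ : ∃ n, ρ (spanningSets ρ n) ≠ 0 := by
    by_contra! h
    apply hρ0
    rw [← Measure.measure_univ_eq_zero, ← iUnion_spanningSets ρ, measure_iUnion_null_iff]
    exact h
  have hfin := (measure_spanningSets_lt_top ρ n).ne
  have hlt : ∀ (κ : Measure X) (c : ENNReal), κ ≤ ρ → κ = c • ρ → c ≠ ⊤ := by
    rintro κ c hκ rfl rfl
    have := hκ (spanningSets ρ n)
    rw [Measure.smul_apply, smul_eq_mul, ENNReal.top_mul hn] at this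
    exact hfin (top_le_iff.1 this)
  have hat := hlt μ a (Measure.le_add_right le_rfl) ha
  have hbt := hlt ν b (Measure.le_add_left le_rfl) hb
  refine ⟨a * b⁻¹, mul_ne_zero ha0 (ENNReal.inv_ne_zero.2 hbt),
    ENNReal.mul_ne_top hat (ENNReal.inv_ne_top.2 hb0), ?_⟩
  rw [hb, smul_smul, mul_assoc, ENNReal.inv_mul_cancel hb0 hbt, mul_one]
  exact ha

end Uniqueness

/-! ### Classification of bilinear forms with symmetric part of rank one -/

section Classification

variable {K : Type*} [Field K]

theorem exists_apply_eq_one {V : Type*} [AddCommGroup V] [Module K V] {ℓ : V →ₗ[K] K}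
    (hℓ : ℓ ≠ 0) : ∃ v, ℓ v = 1 := by
  obtain ⟨v, hv⟩ : ∃ v, ℓ v ≠ 0 := by
    by_contra! h
    exact hℓ (LinearMap.ext h)
  exact ⟨(ℓ v)⁻¹ • v, by simp [hv]⟩

/-- In dimension at least three the kernel of `ℓ`, on which the form is alternating, contains a
hyperbolic pair. -/
theorem exists_hyperbolic_pair {V : Type*} [AddCommGroup V] [Module K V] [FiniteDimensional K V]
    {B : V →ₗ[K] V →ₗ[K] K} {ℓ : V →ₗ[K] K} (hB : ∀ x, (∀ y, B x y = 0) → x = 0) (hℓ : ℓ ≠ 0)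
    (hn : 3 ≤ Module.finrank K V) : ∃ e f, ℓ e = 0 ∧ ℓ f = 0 ∧ B e f = 1 := by
  by_contra! h
  have h0 : ∀ x y, ℓ x = 0 → ℓ y = 0 → B x y = 0 := by
    intro x y hx hy
    by_contra hne
    exact h x ((B x y)⁻¹ • y) hx (by simp [hy]) (by simp [hne])
  obtain ⟨v, hv⟩ := exists_apply_eq_one hℓ
  have hinj : Function.Injective ((B.flip v).comp (LinearMap.ker ℓ).subtype) := by
    rw [← LinearMap.ker_eq_bot, LinearMap.ker_eq_bot']
    rintro ⟨x, hx⟩ hxv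
    have hx' : ℓ x = 0 := hx
    have hxv' : B x v = 0 := hxv
    have : x = 0 := hB x fun y => by
      have h1 : B x (y - ℓ y • v) = 0 := h0 x _ hx' (by simp [hv])
      simpa [hxv'] using h1
    exact Subtype.ext this
  have h1 := LinearMap.finrank_le_finrank_of_injective hinj
  have h2 := LinearMap.finrank_range_add_finrank_ker ℓ
  have h3 : Module.finrank K (LinearMap.range ℓ) ≤ Module.finrank K K := Submodule.finrank_le _
  rw [Module.finrank_self] at h1 h3
  omega

theorem finrank_ker_add_one {V : Type*} [AddCommGroup V] [Module K V] [FiniteDimensional K V]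
    {ℓ : V →ₗ[K] K} (hℓ : ℓ ≠ 0) :
    Module.finrank K (LinearMap.ker ℓ) + 1 = Module.finrank K V := by
  have h2 := LinearMap.finrank_range_add_finrank_ker ℓ
  rw [LinearMap.range_eq_top.2 (LinearMap.surjective_of_ne_zero hℓ), finrank_top,
    Module.finrank_self] at h2
  omega

/-- The left orthogonal complement for `B` of the plane spanned by `e` and `f`. -/
def planeCompl {V : Type*} [AddCommGroup V] [Module K V] (B : V →ₗ[K] V →ₗ[K] K) (e f : V) :
    Submodule K V :=
  LinearMap.ker ((B.flip e).prod (B.flip f))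

theorem mem_planeCompl {V : Type*} [AddCommGroup V] [Module K V] {B : V →ₗ[K] V →ₗ[K] K}
    {e f w : V} : w ∈ planeCompl B e f ↔ B w e = 0 ∧ B w f = 0 := by
  simp [planeCompl]

theorem apply_self_of_ker [NeZero (2 : K)] {t : K} {V : Type*} [AddCommGroup V]
    [Module K V] {B : V →ₗ[K] V →ₗ[K] K} {ℓ : V →ₗ[K] K}
    (hs : ∀ x y, B x y + B y x = t * (ℓ x * ℓ y)) {x : V} (hx : ℓ x = 0) : B x x = 0 := by
  have h20 : (2 : K) ≠ 0 := NeZero.ne 2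
  have h := hs x x
  rw [hx, mul_zero, mul_zero, ← two_mul] at h
  exact (mul_eq_zero.1 h).resolve_left h20

theorem apply_comm_of_ker {t : K} {V : Type*} [AddCommGroup V]
    [Module K V] {B : V →ₗ[K] V →ₗ[K] K} {ℓ : V →ₗ[K] K}
    (hs : ∀ x y, B x y + B y x = t * (ℓ x * ℓ y)) {x : V} (hx : ℓ x = 0) (y : V) :
    B x y = -B y x := by
  have h := hs x y
  rw [hx, zero_mul, mul_zero] at h
  exact eq_neg_of_add_eq_zero_left h

theorem sub_mem_planeCompl [NeZero (2 : K)] {t : K} {V : Type*} [AddCommGroup V]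
    [Module K V] {B : V →ₗ[K] V →ₗ[K] K} {ℓ : V →ₗ[K] K}
    (hs : ∀ x y, B x y + B y x = t * (ℓ x * ℓ y)) {e f : V} (he : ℓ e = 0) (hf : ℓ f = 0)
    (hef : B e f = 1) (v : V) : v - B v f • e + B v e • f ∈ planeCompl B e f := by
  have hee := apply_self_of_ker hs he
  have hff := apply_self_of_ker hs hf
  have hfe : B f e = -1 := by rw [apply_comm_of_ker hs hf, hef]
  rw [mem_planeCompl]
  simp [hee, hff, hfe, hef]

theorem finrank_planeCompl [NeZero (2 : K)] {t : K} {V : Type*} [AddCommGroup V]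
    [Module K V] [FiniteDimensional K V] {B : V →ₗ[K] V →ₗ[K] K} {ℓ : V →ₗ[K] K}
    (hs : ∀ x y, B x y + B y x = t * (ℓ x * ℓ y)) {e f : V} (he : ℓ e = 0) (hf : ℓ f = 0)
    (hef : B e f = 1) :
    Module.finrank K (planeCompl B e f) + 2 = Module.finrank K V := by
  have hee := apply_self_of_ker hs he
  have hff := apply_self_of_ker hs hf
  have hfe : B f e = -1 := by rw [apply_comm_of_ker hs hf, hef]
  have h2 := LinearMap.finrank_range_add_finrank_ker ((B.flip e).prod (B.flip f))
  have hsurj : Function.Surjective ((B.flip e).prod (B.flip f)) := fun p =>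
    ⟨p.2 • e - p.1 • f, by simp [hee, hff, hfe, hef]⟩
  rw [LinearMap.range_eq_top.2 hsurj, finrank_top, Module.finrank_prod, Module.finrank_self] at h2
  have : Module.finrank K (planeCompl B e f) =
    Module.finrank K (LinearMap.ker ((B.flip e).prod (B.flip f))) := rfl
  omega

theorem planeCompl_nondegenerate [NeZero (2 : K)] {t : K} {V : Type*} [AddCommGroup V]
    [Module K V] {B : V →ₗ[K] V →ₗ[K] K} {ℓ : V →ₗ[K] K}
    (hs : ∀ x y, B x y + B y x = t * (ℓ x * ℓ y)) {e f : V} (he : ℓ e = 0) (hf : ℓ f = 0)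
    (hef : B e f = 1)
    (hB : ∀ x, (∀ y, B x y = 0) → x = 0) (x : planeCompl B e f)
    (hx : ∀ y : planeCompl B e f, B x y = 0) : x = 0 := by
  refine Subtype.ext (hB x fun y => ?_)
  have h1 := hx ⟨_, sub_mem_planeCompl hs he hf hef y⟩
  have h2 := mem_planeCompl.1 x.2
  simpa [h2.1, h2.2] using h1

theorem restrict_planeCompl_ne_zero [NeZero (2 : K)] {t : K} {V : Type*} [AddCommGroup V]
    [Module K V] {B : V →ₗ[K] V →ₗ[K] K} {ℓ : V →ₗ[K] K}
    (hs : ∀ x y, B x y + B y x = t * (ℓ x * ℓ y)) {e f : V} (he : ℓ e = 0) (hf : ℓ f = 0)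
    (hef : B e f = 1)
    (hℓ : ℓ ≠ 0) : ℓ.comp (planeCompl B e f).subtype ≠ 0 := by
  intro h
  refine hℓ (LinearMap.ext fun y => ?_)
  have h1 := LinearMap.congr_fun h ⟨_, sub_mem_planeCompl hs he hf hef y⟩
  simpa [he, hf] using h1

theorem exists_isometry_of_finrank_eq_one {t : K} {V V' : Type*} [AddCommGroup V]
    [Module K V] [FiniteDimensional K V] [AddCommGroup V'] [Module K V']
    {B : V →ₗ[K] V →ₗ[K] K} {ℓ : V →ₗ[K] K} {B' : V' →ₗ[K] V' →ₗ[K] K} {v : V} {v' : V'}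
    (hv : ℓ v = 1) (hvv : B v v = t) (hvv' : B' v' v' = t) (hn : Module.finrank K V = 1) :
    ∃ T : V →ₗ[K] V', ∀ x y, B' (T x) (T y) = B x y := by
  have hℓ : ℓ ≠ 0 := by rintro rfl; simp at hv
  have hker : LinearMap.ker ℓ = ⊥ := by
    rw [← Submodule.finrank_eq_zero (R := K)]
    have := finrank_ker_add_one hℓ
    omega
  have hx : ∀ x, x = ℓ x • v := fun x => by
    rw [LinearMap.ker_eq_bot] at hker
    apply hker
    simp [hv]
  refine ⟨ℓ.smulRight v', fun x y => ?_⟩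
  conv_rhs => rw [hx x, hx y]
  simp [hvv, hvv']

/-- A plane contains an isotropic vector `e` in the kernel of `ℓ`, and the form is determined on
the basis `(e, v)`. -/
theorem exists_adapted_basis_of_finrank_eq_two [NeZero (2 : K)] {t : K} {V : Type*}
    [AddCommGroup V] [Module K V] [FiniteDimensional K V] {B : V →ₗ[K] V →ₗ[K] K} {ℓ : V →ₗ[K] K}
    (hs : ∀ x y, B x y + B y x = t * (ℓ x * ℓ y)) (hB : ∀ x, (∀ y, B x y = 0) → x = 0) {v : V}
    (hv : ℓ v = 1) (hn : Module.finrank K V = 2) :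
    ∃ e, ℓ e = 0 ∧ B e e = 0 ∧ B e v = 1 ∧ B v e = -1 ∧
      ∀ x, x = (B x v - ℓ x * B v v) • e + ℓ x • v := by
  have hℓ : ℓ ≠ 0 := by rintro rfl; simp at hv
  have h1 : Module.finrank K (LinearMap.ker ℓ) = 1 := by
    have := finrank_ker_add_one hℓ
    omega
  obtain ⟨⟨e₀, he₀⟩, hne, hspan⟩ := finrank_eq_one_iff'.1 h1
  have he₀' : ℓ e₀ = 0 := he₀
  have hspan' : ∀ x, ℓ x = 0 → ∃ c : K, c • e₀ = x := fun x hx => by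
    obtain ⟨c, hc⟩ := hspan ⟨x, hx⟩
    exact ⟨c, congrArg Subtype.val hc⟩
  have hee := apply_self_of_ker hs he₀'
  have hev : B e₀ v ≠ 0 := by
    intro h
    refine hne (Subtype.ext (hB e₀ fun y => ?_))
    obtain ⟨c, hc⟩ := hspan' (y - ℓ y • v) (by simp [hv])
    have hy : y = c • e₀ + ℓ y • v := by rw [hc]; simp
    rw [hy]
    simp [hee, h]
  have he : ℓ ((B e₀ v)⁻¹ • e₀) = 0 := by simp [he₀']
  have hev' : B ((B e₀ v)⁻¹ • e₀) v = 1 := by simp [hev]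
  refine ⟨(B e₀ v)⁻¹ • e₀, he, apply_self_of_ker hs he, hev', ?_, fun x => ?_⟩
  · rw [apply_comm_of_ker hs he] at hev'
    exact neg_eq_iff_eq_neg.1 hev'
  · obtain ⟨c, hc⟩ := hspan' (x - ℓ x • v) (by simp [hv])
    have hx : x = c • e₀ + ℓ x • v := by rw [hc]; simp
    have hc2 : B x v = c * B e₀ v + ℓ x * B v v := by
      conv_lhs => rw [hx]
      simp
    have hc3 : (B x v - ℓ x * B v v) * (B e₀ v)⁻¹ = c := by
      rw [hc2]
      field_simp
      ring
    rw [smul_smul, hc3]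
    exact hx

/-- Nondegenerate bilinear forms of the same dimension whose symmetric parts are `t ℓ ⊗ ℓ` and
`t ℓ' ⊗ ℓ'`, with `ℓ, ℓ' ≠ 0`, are isometric: split off hyperbolic planes in the kernel of the
linear form until the dimension is one or two. -/
theorem exists_isometry [NeZero (2 : K)] (t : K) (n : ℕ) :
    ∀ {V V' : Type*} [AddCommGroup V] [Module K V] [FiniteDimensional K V]
      [AddCommGroup V'] [Module K V'] [FiniteDimensional K V']
      (B : V →ₗ[K] V →ₗ[K] K) (ℓ : V →ₗ[K] K) (B' : V' →ₗ[K] V' →ₗ[K] K) (ℓ' : V' →ₗ[K] K),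
      (∀ x y, B x y + B y x = t * (ℓ x * ℓ y)) → (∀ x y, B' x y + B' y x = t * (ℓ' x * ℓ' y)) →
      ℓ ≠ 0 → ℓ' ≠ 0 → (∀ x, (∀ y, B x y = 0) → x = 0) → (∀ x, (∀ y, B' x y = 0) → x = 0) →
      Module.finrank K V = n → Module.finrank K V' = n →
      ∃ T : V →ₗ[K] V', ∀ x y, B' (T x) (T y) = B x y := by
  have h20 : (2 : K) ≠ 0 := NeZero.ne 2
  induction n using Nat.strong_induction_on with
  | _ n ih =>
  intro V V' _ _ _ _ _ _ B ℓ B' ℓ' hs hs' hℓ hℓ' hB hB' hn hn'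
  obtain ⟨v, hv⟩ := exists_apply_eq_one hℓ
  obtain ⟨v', hv'⟩ := exists_apply_eq_one hℓ'
  have hvv : B v v = t / 2 := by
    rw [eq_div_iff h20]
    linear_combination hs v v + t * (ℓ v + 1) * hv
  have hvv' : B' v' v' = t / 2 := by
    rw [eq_div_iff h20]
    linear_combination hs' v' v' + t * (ℓ' v' + 1) * hv'
  have hpos := finrank_ker_add_one hℓ
  rcases (by omega : n = 1 ∨ n = 2 ∨ 3 ≤ n) with rfl | rfl | h3
  · exact exists_isometry_of_finrank_eq_one hv hvv hvv' hn
  · obtain ⟨e, he, hee, hev, hve, hx⟩ := exists_adapted_basis_of_finrank_eq_two hs hB hv hn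
    obtain ⟨e', he', hee', hev', hve', -⟩ :=
      exists_adapted_basis_of_finrank_eq_two hs' hB' hv' hn'
    refine ⟨(B.flip v - B v v • ℓ).smulRight e' + ℓ.smulRight v', fun x y => ?_⟩
    conv_rhs => rw [hx x, hx y]
    simp [hee, hev, hve, hee', hev', hve', hvv, hvv']
    ring
  · obtain ⟨e, f, he, hf, hef⟩ := exists_hyperbolic_pair hB hℓ (by omega)
    obtain ⟨e', f', he', hf', hef'⟩ := exists_hyperbolic_pair hB' hℓ' (by omega)
    have hW := finrank_planeCompl hs he hf hef
    have hW' := finrank_planeCompl hs' he' hf' hef'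
    obtain ⟨T, hT⟩ := ih (n - 2) (by omega)
      (B.domRestrict₁₂ (planeCompl B e f) (planeCompl B e f))
      (ℓ.comp (planeCompl B e f).subtype)
      (B'.domRestrict₁₂ (planeCompl B' e' f') (planeCompl B' e' f'))
      (ℓ'.comp (planeCompl B' e' f').subtype)
      (fun x y => hs x y) (fun x y => hs' x y)
      (restrict_planeCompl_ne_zero hs he hf hef hℓ)
      (restrict_planeCompl_ne_zero hs' he' hf' hef' hℓ')
      (planeCompl_nondegenerate hs he hf hef hB)
      (planeCompl_nondegenerate hs' he' hf' hef' hB') (by omega) (by omega)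
    let P : V →ₗ[K] planeCompl B e f := LinearMap.codRestrict (planeCompl B e f)
      (LinearMap.id - (B.flip f).smulRight e + (B.flip e).smulRight f)
      (fun v => by simpa using sub_mem_planeCompl hs he hf hef v)
    have hP : ∀ x, x = B x f • e - B x e • f + P x := fun x => by
      simp only [P, LinearMap.codRestrict_apply]
      simp
    have hff := apply_self_of_ker hs hf
    have hfe : B f e = -1 := by rw [apply_comm_of_ker hs hf, hef]
    have hee := apply_self_of_ker hs he
    have hff' := apply_self_of_ker hs' hf'
    have hfe' : B' f' e' = -1 := by rw [apply_comm_of_ker hs' hf', hef']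
    have hee' := apply_self_of_ker hs' he'
    refine ⟨(B.flip f).smulRight e' - (B.flip e).smulRight f' +
      (planeCompl B' e' f').subtype.comp (T.comp P), fun x y => ?_⟩
    have hT' : B' (T (P x)) (T (P y)) = B (P x) (P y) := hT (P x) (P y)
    have hw : ∀ w : planeCompl B e f, B w e = 0 ∧ B w f = 0 ∧ B e w = 0 ∧ B f w = 0 := fun w => by
      obtain ⟨h1, h2⟩ := mem_planeCompl.1 w.2
      exact ⟨h1, h2, by rw [apply_comm_of_ker hs he, h1, neg_zero],
        by rw [apply_comm_of_ker hs hf, h2, neg_zero]⟩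
    have hw' : ∀ w : planeCompl B' e' f', B' w e' = 0 ∧ B' w f' = 0 ∧ B' e' w = 0 ∧ B' f' w = 0 :=
      fun w => by
        obtain ⟨h1, h2⟩ := mem_planeCompl.1 w.2
        exact ⟨h1, h2, by rw [apply_comm_of_ker hs' he', h1, neg_zero],
          by rw [apply_comm_of_ker hs' hf', h2, neg_zero]⟩
    obtain ⟨p1, p2, -, -⟩ := hw (P x)
    obtain ⟨-, -, q3, q4⟩ := hw (P y)
    obtain ⟨r1, r2, -, -⟩ := hw' (T (P x))
    obtain ⟨-, -, s3, s4⟩ := hw' (T (P y))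
    have hR : B x y = B (B x f • e - B x e • f + P x) (B y f • e - B y e • f + P y) := by
      rw [← hP x, ← hP y]
    rw [hR]
    simp only [map_add, map_sub, map_smul, LinearMap.add_apply, LinearMap.sub_apply,
      LinearMap.smul_apply, smul_eq_mul, LinearMap.smulRight_apply, LinearMap.flip_apply,
      LinearMap.comp_apply, Submodule.subtype_apply, hee, hff, hfe, hef, hee', hff', hfe', hef',
      p1, p2, q3, q4, r1, r2, s3, s4, hT']

theorem adM_mul {d : ℕ} (m m' b : GL (Fin d) K) : adM (m * m') b = adM m (adM m' b) := by
  ext1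
  simp [adM, biact, transposeGL, Matrix.mul_assoc, transpose_mul]

theorem adM_one {d : ℕ} (b : GL (Fin d) K) : adM 1 b = b := by
  ext1
  simp [adM, biact, transposeGL]

/-- The forms with symmetric part `t ℓ ⊗ ℓ`, `ℓ ≠ 0`, make up a single conjugacy class. -/
theorem mem_orbit_of_hasSymPart [NeZero (2 : K)] {d : ℕ} {t : Kˣ} {b b' : GL (Fin d) K}
    (h : HasSymPart t b) (h' : HasSymPart t b') : b' ∈ orbit b := by
  have form : ∀ (c : GL (Fin d) K) (l : Fin d → K),
      (c : Matrix (Fin d) (Fin d) K) + (c : Matrix (Fin d) (Fin d) K)ᵀ = (t : K) • vecMulVec l l →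
      ∀ x y, Matrix.toLinearMap₂' K c.1 x y + Matrix.toLinearMap₂' K c.1 y x =
        t * ((dotProductBilin K K l) x * (dotProductBilin K K l) y) := by
    intro c l hl x y
    have h1 : Matrix.toLinearMap₂' K c.1 y x = x ⬝ᵥ (c.1ᵀ *ᵥ y) := by
      rw [Matrix.toLinearMap₂'_apply', dotProduct_mulVec, mulVec_transpose, dotProduct_comm]
    rw [h1, Matrix.toLinearMap₂'_apply', ← dotProduct_add, ← add_mulVec, hl, smul_mulVec,
      vecMulVec_mulVec]
    simp [dotProductBilin, dotProduct_comm x l]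
    ring
  have nondeg : ∀ (c : GL (Fin d) K) x, (∀ y, Matrix.toLinearMap₂' K c.1 x y = 0) → x = 0 :=
    fun c => LinearMap.separatingLeft_toLinearMap₂'_of_det_ne_zero' c.det.ne_zero
  have lin : ∀ l : Fin d → K, l ≠ 0 → dotProductBilin K K l ≠ 0 := by
    intro l hl h0
    refine hl (funext fun i => ?_)
    simpa [dotProductBilin] using LinearMap.congr_fun h0 (Pi.single i 1)
  obtain ⟨l, hl, hl'⟩ := h
  obtain ⟨k, hk, hk'⟩ := h'
  obtain ⟨T, hT⟩ := exists_isometry (t : K) d _ _ _ _ (form b' k hk') (form b l hl') (lin k hk)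
    (lin l hl) (nondeg b') (nondeg b) (by simp) (by simp)
  have hmat : (LinearMap.toMatrix' T)ᵀ * b.1 * LinearMap.toMatrix' T = b'.1 := by
    have h1 := Matrix.toLinearMap₂'_comp b.1 (LinearMap.toMatrix' T) (LinearMap.toMatrix' T)
    rw [Matrix.toLin'_toMatrix', LinearMap.ext₂ (f := (Matrix.toLinearMap₂' K b.1).compl₁₂ T T)
      (g := Matrix.toLinearMap₂' K b'.1) hT] at h1
    exact ((Matrix.toLinearMap₂' K).injective h1).symm
  have hdet : (LinearMap.toMatrix' T).det ≠ 0 := by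
    intro h0
    have h1 := congrArg Matrix.det hmat
    rw [det_mul, h0, mul_zero] at h1
    exact b'.det.ne_zero h1.symm
  refine ⟨(GeneralLinearGroup.mkOfDetNeZero _ hdet)⁻¹, ?_⟩
  ext1
  simp only [adM, biact, transposeGL, inv_inv, Units.val_mul]
  exact hmat

end Classification

/-! ### Elements of the odd orthogonal group in block coordinates -/

section Blocks

variable {F : Type*} [Field F] {d : ℕ}

/-- The vector of `U` with components in `V`, `V^*` and `L`. -/
def vecU (x y : Fin d → F) (c : F) : Idx d → F := Sum.elim (Sum.elim x y) fun _ => c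

theorem inV_eq (x : Fin d → F) : inV x = vecU x 0 0 := rfl

theorem inVdual_eq (x : Fin d → F) : inVdual x = vecU 0 x 0 := rfl

/-- The block of `g` that maps `V` to `V^*`, i.e. the Gram matrix of the form
`(x, y) ↦ Q(x, g y)` on `V`. -/
def lowerLeft (g : G F d) : Matrix (Fin d) (Fin d) F :=
  of fun i j => mat g (.inl (.inr i)) (.inl (.inl j))

/-- The block of `g` that maps `V` to `L`, as a linear form on `V`. -/
def lineForm (g : G F d) : Fin d → F := fun j => mat g (.inr ()) (.inl (.inl j))

theorem gram_entry (M : Matrix (Idx d) (Idx d) F) (a b : Idx d) :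
    (Mᵀ * gramQ F d * M) a b = (∑ i, M (.inl (.inl i)) a * M (.inl (.inr i)) b) +
      (∑ i, M (.inl (.inr i)) a * M (.inl (.inl i)) b) + M (.inr ()) a * M (.inr ()) b := by
  simp only [gramQ, mul_apply, Fintype.sum_sum_type, transpose_apply,
    fromBlocks_apply₁₁, fromBlocks_apply₁₂, fromBlocks_apply₂₁, fromBlocks_apply₂₂,
    Matrix.zero_apply, one_apply, mul_ite, mul_one, mul_zero, Finset.sum_const_zero, zero_add,
    add_zero, Finset.sum_ite_eq', Finset.mem_univ, if_true, Finset.univ_unique,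
    Finset.sum_singleton]
  rw [add_comm (∑ x, _)]

theorem mat_injective : Function.Injective (mat : G F d → Matrix (Idx d) (Idx d) F) :=
  fun _ _ h => Subtype.ext (Subtype.ext h)

/-- The columns of an element of `G` have the inner products of the standard basis. -/
theorem gram_columns (g : G F d) (a b : Idx d) :
    (∑ i, mat g (.inl (.inl i)) a * mat g (.inl (.inr i)) b) +
      (∑ i, mat g (.inl (.inr i)) a * mat g (.inl (.inl i)) b) +
      mat g (.inr ()) a * mat g (.inr ()) b = gramQ F d a b := by
  rw [← gram_entry]
  exact congrFun (congrFun g.2 a) b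

theorem apply_eq_of_mem_N {u : G F d} (hu : u ∈ N F d) (i : Idx d) (j : Fin d) :
    mat u i (.inl (.inl j)) = if i = .inl (.inl j) then 1 else 0 := by
  have h := congrFun (hu (Pi.single j 1)) i
  have h2 : (inV (Pi.single j 1) : Idx d → F) = Pi.single (.inl (.inl j)) 1 := by
    ext k
    rcases k with (k | k) | k <;> simp [inV, Pi.single_apply]
  rw [h2, mulVec_single_one] at h
  simpa [Pi.single_apply] using h

theorem apply_eq_of_mem_Nbar {u : G F d} (hu : u ∈ Nbar F d) (i : Idx d) (j : Fin d) :
    mat u i (.inl (.inr j)) = if i = .inl (.inr j) then 1 else 0 := by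
  have h := congrFun (hu (Pi.single j 1)) i
  have h2 : (inVdual (Pi.single j 1) : Idx d → F) = Pi.single (.inl (.inr j)) 1 := by
    ext k
    rcases k with (k | k) | k <;> simp [inVdual, Pi.single_apply]
  rw [h2, mulVec_single_one] at h
  simpa [Pi.single_apply] using h

/-- An element of `N` acts trivially on `U / V^⊥ = V^*`. -/
theorem row_eq_of_mem_N {u : G F d} (hu : u ∈ N F d) (i : Fin d) (b : Idx d) :
    mat u (.inl (.inr i)) b = if b = .inl (.inr i) then 1 else 0 := by
  have h := gram_columns u (.inl (.inl i)) b
  simp only [apply_eq_of_mem_N hu] at h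
  simp only [Sum.inl.injEq, ite_mul, one_mul, zero_mul, Finset.sum_ite_eq', Finset.mem_univ,
    if_true, reduceCtorEq, if_false, Finset.sum_const_zero, add_zero] at h
  rw [h]
  rcases b with (b | b) | b <;> simp [gramQ, one_apply, eq_comm]

theorem row_eq_of_mem_Nbar {u : G F d} (hu : u ∈ Nbar F d) (i : Fin d) (b : Idx d) :
    mat u (.inl (.inl i)) b = if b = .inl (.inl i) then 1 else 0 := by
  have h := gram_columns u (.inl (.inr i)) b
  simp only [apply_eq_of_mem_Nbar hu] at h
  simp only [Sum.inl.injEq, Sum.inr.injEq, ite_mul, one_mul, zero_mul, Finset.sum_ite_eq',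
    Finset.mem_univ, if_true, reduceCtorEq, if_false, Finset.sum_const_zero, add_zero,
    zero_add] at h
  rw [h]
  rcases b with (b | b) | b <;> simp [gramQ, one_apply, eq_comm]

/-- The matrix of the element of the opposite unipotent radical with coordinates `l` (the linear
form `V → L`) and `Y` (the map `V → V^*`). -/
def nbarMat (l : Fin d → F) (Y : Matrix (Fin d) (Fin d) F) : Matrix (Idx d) (Idx d) F :=
  fromBlocks (fromBlocks 1 0 Y 1) (of fun i _ => Sum.elim 0 (-l) i) (of fun _ j => Sum.elim l 0 j) 1

/-- The matrix of the element of `N` with coordinates `l` (the linear form `V^* → L`) and `Z`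
(the map `V^* → V`). -/
def nMat (l : Fin d → F) (Z : Matrix (Fin d) (Fin d) F) : Matrix (Idx d) (Idx d) F :=
  fromBlocks (fromBlocks 1 Z 0 1) (of fun i _ => Sum.elim (-l) 0 i) (of fun _ j => Sum.elim 0 l j) 1

theorem det_nbarMat (l : Fin d → F) (Y : Matrix (Fin d) (Fin d) F) : (nbarMat l Y).det = 1 := by
  rw [nbarMat, det_fromBlocks_one₂₂]
  have : (fromBlocks 1 0 Y 1 : Matrix (Fin d ⊕ Fin d) (Fin d ⊕ Fin d) F) -
      (of fun i (_ : Unit) => (Sum.elim 0 (-l) i : F)) *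
      (of fun (_ : Unit) j => (Sum.elim l 0 j : F)) = fromBlocks 1 0 (Y + vecMulVec l l) 1 := by
    ext a b
    rcases a with a | a <;> rcases b with b | b <;> simp [mul_apply, vecMulVec_apply]
  rw [this, det_fromBlocks_zero₁₂]
  simp

/-- The determinant-one condition forces the action on the line `L` to be trivial. -/
theorem mat_eq_of_mem_Nbar {u : G F d} (hu : u ∈ Nbar F d) :
    mat u = nbarMat (lineForm u) (lowerLeft u) := by
  set z := mat u (.inr ()) (.inr ()) with hz
  have hcol : ∀ k, mat u (.inl (.inr k)) (.inr ()) = -(lineForm u k * z) := by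
    intro k
    have h := gram_columns u (.inl (.inl k)) (.inr ())
    simp only [row_eq_of_mem_Nbar hu] at h
    simp only [Sum.inl.injEq, ite_mul, one_mul, zero_mul, mul_zero,
      Finset.sum_ite_eq, Finset.mem_univ, if_true, reduceCtorEq, if_false,
      Finset.sum_const_zero, add_zero] at h
    have h0 : gramQ F d (.inl (.inl k)) (.inr ()) = 0 := by simp [gramQ]
    rw [h0] at h
    exact eq_neg_of_add_eq_zero_left h
  have hblock : mat u = fromBlocks (fromBlocks 1 0 (lowerLeft u) 1)
      (of fun i _ => Sum.elim 0 (-(z • lineForm u)) i) (of fun _ j => Sum.elim (lineForm u) 0 j)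
      (z • 1) := by
    ext a b
    rcases a with (a | a) | a <;> rcases b with (b | b) | b <;>
      simp [row_eq_of_mem_Nbar hu, apply_eq_of_mem_Nbar hu, hcol, lowerLeft, lineForm, one_apply,
        hz, eq_comm, mul_comm]
  have hz1 : z = 1 := by
    have hdet : (mat u).det = 1 := u.1.2
    have hmul : mat u = nbarMat (lineForm u) (lowerLeft u) * fromBlocks 1 0 0 (z • 1) := by
      rw [hblock, nbarMat, fromBlocks_multiply]
      congr 1
      all_goals
        ext a b
        rcases a with a | a <;> simp
    rw [hmul, det_mul, det_nbarMat, det_fromBlocks_zero₂₁] at hdet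
    simpa using hdet
  rw [hblock, hz1]
  simp [nbarMat]

theorem nbarMat_mulVec (l : Fin d → F) (Y : Matrix (Fin d) (Fin d) F) (x y : Fin d → F) (c : F) :
    nbarMat l Y *ᵥ vecU x y c = vecU x (Y *ᵥ x + y - c • l) (l ⬝ᵥ x + c) := by
  ext a
  rcases a with (a | a) | a
  · simp [nbarMat, vecU, mulVec, dotProduct, Fintype.sum_sum_type, one_apply]
  · simp [nbarMat, vecU, mulVec, dotProduct, Fintype.sum_sum_type, one_apply]
    ring
  · simp [nbarMat, vecU, mulVec, dotProduct, Fintype.sum_sum_type, one_apply]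

theorem nMat_mulVec (l : Fin d → F) (Z : Matrix (Fin d) (Fin d) F) (x y : Fin d → F) (c : F) :
    nMat l Z *ᵥ vecU x y c = vecU (x + Z *ᵥ y - c • l) y (l ⬝ᵥ y + c) := by
  ext a
  rcases a with (a | a) | a
  · simp [nMat, vecU, mulVec, dotProduct, Fintype.sum_sum_type, one_apply]
    ring
  · simp [nMat, vecU, mulVec, dotProduct, Fintype.sum_sum_type, one_apply]
  · simp [nMat, vecU, mulVec, dotProduct, Fintype.sum_sum_type, one_apply]

theorem det_nMat (l : Fin d → F) (Z : Matrix (Fin d) (Fin d) F) : (nMat l Z).det = 1 := by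
  rw [nMat, det_fromBlocks_one₂₂]
  have : (fromBlocks 1 Z 0 1 : Matrix (Fin d ⊕ Fin d) (Fin d ⊕ Fin d) F) -
      (of fun i (_ : Unit) => (Sum.elim (-l) 0 i : F)) *
      (of fun (_ : Unit) j => (Sum.elim 0 l j : F)) = fromBlocks 1 (Z + vecMulVec l l) 0 1 := by
    ext a b
    rcases a with a | a <;> rcases b with b | b <;> simp [mul_apply, vecMulVec_apply]
  rw [this, det_fromBlocks_zero₂₁]
  simp

/-- The element of the opposite unipotent radical with coordinates `l` and `Y`; preserving `Q` means
that `Y + Yᵀ = -l ⊗ l`. -/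
def nbarElt (l : Fin d → F) (Y : Matrix (Fin d) (Fin d) F) (h : Y + Yᵀ = -vecMulVec l l) : G F d :=
  ⟨⟨nbarMat l Y, det_nbarMat l Y⟩, by
    change (nbarMat l Y)ᵀ * gramQ F d * nbarMat l Y = gramQ F d
    ext a b
    rw [gram_entry]
    rcases a with (a | a) | a <;> rcases b with (b | b) | b <;>
      simp [nbarMat, gramQ, one_apply, eq_comm]
    have h2 := congrFun (congrFun h a) b
    simp [vecMulVec_apply] at h2
    linear_combination h2⟩

/-- The element of `N` with coordinates `l` and `Z`; preserving `Q` means that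
`Z + Zᵀ = -l ⊗ l`. -/
def nElt (l : Fin d → F) (Z : Matrix (Fin d) (Fin d) F) (h : Z + Zᵀ = -vecMulVec l l) : G F d :=
  ⟨⟨nMat l Z, det_nMat l Z⟩, by
    change (nMat l Z)ᵀ * gramQ F d * nMat l Z = gramQ F d
    ext a b
    rw [gram_entry]
    rcases a with (a | a) | a <;> rcases b with (b | b) | b <;>
      simp [nMat, gramQ, one_apply, eq_comm]
    have h2 := congrFun (congrFun h a) b
    simp [vecMulVec_apply] at h2
    linear_combination h2⟩

theorem nbarElt_mem (l : Fin d → F) (Y : Matrix (Fin d) (Fin d) F) (h : Y + Yᵀ = -vecMulVec l l) :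
    nbarElt l Y h ∈ Nbar F d := by
  intro x
  change nbarMat l Y *ᵥ inVdual x = inVdual x
  rw [inVdual_eq, nbarMat_mulVec]
  simp

theorem lowerLeft_nbarElt (l : Fin d → F) (Y : Matrix (Fin d) (Fin d) F)
    (h : Y + Yᵀ = -vecMulVec l l) : lowerLeft (nbarElt l Y h) = Y := rfl

/-- The form attached to an element of the opposite unipotent radical has symmetric part
`-l ⊗ l`. -/
theorem lowerLeft_add_transpose {u : G F d} (hu : u ∈ Nbar F d) :
    lowerLeft u + (lowerLeft u)ᵀ = -vecMulVec (lineForm u) (lineForm u) := by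
  ext a b
  have h := gram_columns u (.inl (.inl a)) (.inl (.inl b))
  simp only [row_eq_of_mem_Nbar hu] at h
  simp [gramQ] at h
  simp only [lowerLeft, lineForm, vecMulVec_apply, Matrix.add_apply, transpose_apply, of_apply,
    Matrix.neg_apply]
  linear_combination h

/-- The rows of `g` indexed by `V^*` depend only on the coset `N g`. -/
theorem row_mul_of_mem_N {u : G F d} (hu : u ∈ N F d) (g : G F d) (i : Fin d) (b : Idx d) :
    mat (u * g) (.inl (.inr i)) b = mat g (.inl (.inr i)) b := by
  rw [mat_mul, mul_apply]
  simp [row_eq_of_mem_N hu]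

theorem lowerLeft_mul_left {u : G F d} (hu : u ∈ N F d) (g : G F d) :
    lowerLeft (u * g) = lowerLeft g := by
  ext i j
  exact row_mul_of_mem_N hu g i _

theorem lowerLeft_mul_right {u : G F d} (hu : u ∈ N F d) (g : G F d) :
    lowerLeft (g * u) = lowerLeft g := by
  ext i j
  simp only [lowerLeft, of_apply]
  rw [mat_mul, mul_apply]
  simp [apply_eq_of_mem_N hu]

theorem lowerLeft_embB (b : GL (Fin d) F) : lowerLeft (embB b) = b.1ᵀ := by
  ext i j
  simp [lowerLeft, mat, embB]

theorem lowerLeft_levi_mul (m : GL (Fin d) F) (g : G F d) :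
    lowerLeft (levi m * g) = (m⁻¹).1ᵀ * lowerLeft g := by
  ext i j
  simp only [lowerLeft, of_apply]
  rw [mat_mul, mul_apply, mul_apply]
  simp [mat, levi]

theorem levi_mul (m m' : GL (Fin d) F) : levi (m * m') = levi m * levi m' := by
  apply mat_injective
  rw [mat_mul]
  simp [mat, levi, fromBlocks_multiply, transpose_mul]

theorem levi_one : levi (1 : GL (Fin d) F) = 1 := by
  apply mat_injective
  simp [mat, levi]

theorem levi_inv (m : GL (Fin d) F) : levi m⁻¹ = (levi m)⁻¹ := by
  rw [eq_inv_iff_mul_eq_one, ← levi_mul, inv_mul_cancel, levi_one]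

theorem embB_mul_levi (b m : GL (Fin d) F) :
    embB b * levi m = embB (transposeGL m * b) := by
  apply mat_injective
  rw [mat_mul]
  simp [mat, levi, embB, transposeGL, fromBlocks_multiply, transpose_mul]

theorem levi_mul_embB (b m : GL (Fin d) F) :
    levi m * embB b = embB (b * m⁻¹) := by
  apply mat_injective
  rw [mat_mul]
  simp [mat, levi, embB, fromBlocks_multiply, transpose_mul]

theorem embB_transpose (b : GL (Fin d) F) : embB (transposeGL b) = (embB b)⁻¹ := by
  rw [eq_inv_iff_mul_eq_one]
  apply mat_injective
  rw [mat_mul, mat_one]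
  simp [mat, embB, transposeGL, fromBlocks_multiply, smul_smul, ← mul_pow]
  have h : (b.1⁻¹)ᵀ * b.1ᵀ = 1 := by
    rw [← transpose_mul, Matrix.mul_nonsing_inv _ ((Matrix.isUnit_iff_isUnit_det _).1 b.isUnit),
      transpose_one]
  rw [h]
  simp

/-- The Bruhat decomposition of `u` in the opposite unipotent radical, when its form is
nondegenerate: the component in the right-hand factor `N` is explicit. -/
theorem mul_nElt_mul_embB_mem {u : G F d} (hu : u ∈ Nbar F d) {y : GL (Fin d) F}
    (hy : y.1 = lowerLeft u) :
    ∃ h, u * nElt (-((y⁻¹).1 *ᵥ lineForm u)) (y⁻¹).1ᵀ h * embB y ∈ N F d := by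
  have hs := lowerLeft_add_transpose hu
  rw [← hy] at hs
  have h1 : (y⁻¹).1 * y.1 = 1 := by rw [← Units.val_mul]; simp
  have h2 : y.1 * (y⁻¹).1 = 1 := by rw [← Units.val_mul]; simp
  have h3 : y.1ᵀ * (y⁻¹).1ᵀ = 1 := by rw [← transpose_mul, h1, transpose_one]
  have h4 : (y⁻¹).1ᵀ * y.1ᵀ = 1 := by rw [← transpose_mul, h2, transpose_one]
  refine ⟨?_, ?_⟩
  · have h5 : (y⁻¹).1 * (y.1 + y.1ᵀ) * (y⁻¹).1ᵀ = (y⁻¹).1ᵀ + (y⁻¹).1 := by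
      rw [Matrix.mul_add, Matrix.add_mul, h1, Matrix.one_mul, Matrix.mul_assoc, h3, Matrix.mul_one]
    rw [transpose_transpose, ← h5, hs, Matrix.mul_neg, Matrix.neg_mul, mul_vecMulVec,
      vecMulVec_mul, vecMul_transpose]
    simp [vecMulVec_neg, neg_vecMulVec]
  · intro x
    have key : mat (embB y) *ᵥ inV x = inVdual (y.1ᵀ *ᵥ x) := by
      simp [mat, embB, inV, inVdual, fromBlocks_mulVec, Sum.elim_comp_inl]
    rw [mat_mul, mat_mul, ← mulVec_mulVec, key, ← mulVec_mulVec, inVdual_eq]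
    change mat u *ᵥ (nMat _ _ *ᵥ _) = _
    rw [nMat_mulVec, mat_eq_of_mem_Nbar hu, nbarMat_mulVec, inV_eq]
    have h6 : (y⁻¹).1 *ᵥ lineForm u ⬝ᵥ y.1ᵀ *ᵥ x = lineForm u ⬝ᵥ x := by
      rw [mulVec_transpose, ← dotProduct_comm, ← dotProduct_mulVec, mulVec_mulVec, h2, one_mulVec,
        dotProduct_comm]
    have h7 : lowerLeft u *ᵥ x + y.1ᵀ *ᵥ x = -(lineForm u ⬝ᵥ x) • lineForm u := by
      rw [← hy, ← add_mulVec, hs, neg_mulVec, vecMulVec_mulVec]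
      simp
    simp only [mulVec_mulVec, h4, one_mulVec, zero_add, zero_smul, sub_zero, add_zero,
      neg_dotProduct, h6, h7]
    simp

end Blocks

/-! ### Topology of the groups -/

section Topology

variable {F : Type*} [NontriviallyNormedField F] {d : ℕ}

theorem isClosedEmbedding_mat :
    IsClosedEmbedding (mat : G F d → Matrix (Idx d) (Idx d) F) := by
  have h1 : IsClosed (SO F d : Set (SpecialLinearGroup (Idx d) F)) := by
    have hc : Continuous fun g : SpecialLinearGroup (Idx d) F => (g : Matrix (Idx d) (Idx d) F) :=
      continuous_subtype_val
    exact isClosed_eq ((hc.matrix_transpose.matrix_mul continuous_const).matrix_mul hc)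
      continuous_const
  exact SpecialLinearGroup.isClosedEmbedding_val.comp h1.isClosedEmbedding_subtypeVal

theorem continuous_mat : Continuous (mat : G F d → Matrix (Idx d) (Idx d) F) :=
  isClosedEmbedding_mat.continuous

theorem continuous_mat_apply (i j : Idx d) : Continuous fun g : G F d => mat g i j :=
  continuous_mat.matrix_elem i j

theorem isClosed_N : IsClosed (N F d : Set (G F d)) := by
  have : (N F d : Set (G F d)) = ⋂ x : Fin d → F, {u | mat u *ᵥ inV x = inV x} := by
    ext u; simp [N]
  rw [this]
  exact isClosed_iInter fun x =>
    isClosed_eq (continuous_mat.matrix_mulVec continuous_const) continuous_const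

theorem isClosed_Nbar : IsClosed (Nbar F d : Set (G F d)) := by
  have : (Nbar F d : Set (G F d)) = ⋂ x : Fin d → F, {u | mat u *ᵥ inVdual x = inVdual x} := by
    ext u; simp [Nbar]
  rw [this]
  exact isClosed_iInter fun x =>
    isClosed_eq (continuous_mat.matrix_mulVec continuous_const) continuous_const

theorem continuous_lowerLeft :
    Continuous (lowerLeft : G F d → Matrix (Fin d) (Fin d) F) :=
  continuous_matrix fun _ _ => continuous_mat_apply _ _

theorem continuous_lineForm : Continuous (lineForm : G F d → Fin d → F) :=
  continuous_pi fun _ => continuous_mat_apply _ _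

theorem continuous_val_inv : Continuous fun m : GL (Fin d) F => (m⁻¹).1 :=
  Units.continuous_val.comp continuous_inv

theorem continuous_levi : Continuous (levi : GL (Fin d) F → G F d) := by
  rw [isClosedEmbedding_mat.isInducing.continuous_iff]
  exact ((Units.continuous_val.matrix_fromBlocks continuous_const continuous_const
    continuous_val_inv.matrix_transpose).matrix_fromBlocks continuous_const continuous_const
    continuous_const)

theorem continuous_transposeGL : Continuous (transposeGL : GL (Fin d) F → GL (Fin d) F) := by
  rw [Units.continuous_iff]
  exact ⟨Units.continuous_val.matrix_transpose, continuous_val_inv.matrix_transpose⟩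

theorem continuous_mkOfDetNeZero :
    Continuous fun A : {A : Matrix (Fin d) (Fin d) F // A.det ≠ 0} =>
      GeneralLinearGroup.mkOfDetNeZero A.1 A.2 := by
  rw [Units.continuous_iff]
  refine ⟨continuous_subtype_val, ?_⟩
  have h : (fun A : {A : Matrix (Fin d) (Fin d) F // A.det ≠ 0} =>
      ((GeneralLinearGroup.mkOfDetNeZero A.1 A.2)⁻¹).1) = fun A => (A.1.det)⁻¹ • A.1.adjugate := by
    ext1 A
    rw [GeneralLinearGroup.coe_inv, Matrix.inv_def, Ring.inverse_eq_inv']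
    rfl
  rw [show (fun A : {A : Matrix (Fin d) (Fin d) F // A.det ≠ 0} =>
      ((GeneralLinearGroup.mkOfDetNeZero A.1 A.2)⁻¹).1) = _ from h]
  exact (continuous_subtype_val.matrix_det.inv₀ fun A => A.2).smul
    continuous_subtype_val.matrix_adjugate

/-- A compact set of matrices with nonzero determinant is compact in `GL`. -/
theorem isCompact_GL {C : Set (Matrix (Fin d) (Fin d) F)} (hC : IsCompact C)
    (h0 : ∀ A ∈ C, A.det ≠ 0) : IsCompact {b : GL (Fin d) F | b.1 ∈ C} := by
  have h1 : IsCompact (Subtype.val ⁻¹' C : Set {A : Matrix (Fin d) (Fin d) F // A.det ≠ 0}) := by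
    have h2 : (Subtype.val '' (Subtype.val ⁻¹' C : Set {A : Matrix (Fin d) (Fin d) F // A.det ≠ 0}))
        = C := by
      ext A
      exact ⟨by rintro ⟨B, hB, rfl⟩; exact hB, fun h => ⟨⟨A, h0 A h⟩, h, rfl⟩⟩
    rw [Topology.IsEmbedding.subtypeVal.isCompact_iff]
    exact (congrArg IsCompact h2).mpr hC
  convert h1.image continuous_mkOfDetNeZero using 1
  ext b
  constructor
  · intro hb
    exact ⟨⟨b.1, h0 _ hb⟩, hb, Units.ext rfl⟩
  · rintro ⟨A, hA, rfl⟩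
    exact hA

theorem exists_forall_norm_lt_mem {K : Set (G F d)} (hK : K ∈ 𝓝 1) :
    ∃ ε > 0, ∀ g : G F d, (∀ i j, ‖mat g i j - (1 : Matrix (Idx d) (Idx d) F) i j‖ < ε) →
      g ∈ K := by
  rw [isClosedEmbedding_mat.isInducing.nhds_eq_comap, mat_one] at hK
  obtain ⟨S, hS, hSK⟩ := hK
  obtain ⟨ε, hε, hball⟩ := (Metric.mem_nhds_iff (α := Idx d → Idx d → F)
    (x := (1 : Matrix (Idx d) (Idx d) F)) (s := S)).1 hS
  refine ⟨ε, hε, fun g hg => hSK (hball ?_)⟩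
  refine Metric.mem_ball.2 ((dist_pi_lt_iff hε).2 fun i => ?_)
  rw [dist_pi_lt_iff hε]
  intro j
  rw [dist_eq_norm]
  exact hg i j

variable [LocallyCompactSpace F]

instance : LocallyCompactSpace (G F d) := by
  have : LocallyCompactSpace (Matrix (Idx d) (Idx d) F) :=
    inferInstanceAs (LocallyCompactSpace (Idx d → Idx d → F))
  exact isClosedEmbedding_mat.locallyCompactSpace

instance : SecondCountableTopology (G F d) := by
  have := secondCountableTopology_field (F := F)
  have : SecondCountableTopology (Matrix (Idx d) (Idx d) F) :=
    inferInstanceAs (SecondCountableTopology (Idx d → Idx d → F))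
  exact isClosedEmbedding_mat.isEmbedding.secondCountableTopology

instance (H : Subgroup (G F d)) : SecondCountableTopology H :=
  IsEmbedding.subtypeVal.secondCountableTopology

instance : LocallyCompactSpace (N F d) :=
  isClosed_N.isClosedEmbedding_subtypeVal.locallyCompactSpace

instance : LocallyCompactSpace (Nbar F d) :=
  isClosed_Nbar.isClosedEmbedding_subtypeVal.locallyCompactSpace

instance : LocallyCompactSpace (GL (Fin d) F) := by
  have : LocallyCompactSpace (Matrix (Fin d) (Fin d) F) :=
    inferInstanceAs (LocallyCompactSpace (Fin d → Fin d → F))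
  exact locallyCompactSpace_units

instance : SecondCountableTopology (GL (Fin d) F) := by
  have := secondCountableTopology_field (F := F)
  have : SecondCountableTopology (Matrix (Fin d) (Fin d) F) :=
    inferInstanceAs (SecondCountableTopology (Fin d → Fin d → F))
  exact secondCountableTopology_units

/-- The elements of a closed subgroup with bounded matrix entries form a compact set. -/
theorem isCompact_bounded {H : Subgroup (G F d)} (hH : IsClosed (H : Set (G F d))) (R : ℝ) :
    IsCompact {u : H | ∀ i j, ‖mat (u : G F d) i j‖ ≤ R} := by
  have := ProperSpace.of_nontriviallyNormedField_of_weaklyLocallyCompactSpace F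
  have h1 : IsCompact (Set.univ.pi fun _ => Set.univ.pi fun _ => Metric.closedBall (0 : F) R :
      Set (Idx d → Idx d → F)) :=
    isCompact_univ_pi fun _ => isCompact_univ_pi fun _ => isCompact_closedBall _ _
  have h2 := (isClosedEmbedding_mat.comp hH.isClosedEmbedding_subtypeVal).isCompact_preimage
    (K := (Set.univ.pi fun _ => Set.univ.pi fun _ => Metric.closedBall (0 : F) R :
      Set (Idx d → Idx d → F))) h1
  have h3 : {u : H | ∀ i j, ‖mat (u : G F d) i j‖ ≤ R} = (mat ∘ Subtype.val) ⁻¹'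
      (Set.univ.pi fun _ => Set.univ.pi fun _ => Metric.closedBall (0 : F) R :
        Set (Idx d → Idx d → F)) := by
    ext u
    exact ⟨fun h i _ j _ => mem_closedBall_zero_iff.2 (h i j),
      fun h i j => mem_closedBall_zero_iff.1 (h i trivial j trivial)⟩
  rw [h3]
  exact h2

end Topology

/-! ### Jacobians of conjugations -/

section Jacobian

variable {H H' H'' : Type*} [Group H] [TopologicalSpace H] [IsTopologicalGroup H]
  [MeasurableSpace H] [BorelSpace H]
  [Group H'] [TopologicalSpace H'] [IsTopologicalGroup H']
  [MeasurableSpace H'] [BorelSpace H']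
  [Group H''] [TopologicalSpace H''] [IsTopologicalGroup H'']
  [MeasurableSpace H''] [BorelSpace H'']

theorem jacobian_pos (φ : H ≃ₜ* H') (μ : Measure H) (μ' : Measure H')
    [μ.IsHaarMeasure] [μ'.IsHaarMeasure] : 0 < jacobian φ μ μ' := by
  have : (μ.map φ).IsHaarMeasure := φ.isHaarMeasure_map μ
  exact NNReal.coe_pos.2 (Measure.haarScalarFactor_pos_of_isHaarMeasure μ' (μ.map φ))

theorem jacobian_eq_of_eq_smul [LocallyCompactSpace H'] (φ : H ≃ₜ* H') (μ : Measure H)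
    (μ' : Measure H') [μ.IsHaarMeasure] [μ'.IsHaarMeasure] {c : ℝ} (hc : 0 ≤ c)
    (h : μ' = ENNReal.ofReal c • μ.map φ) : jacobian φ μ μ' = c := by
  have : (μ.map φ).IsHaarMeasure := φ.isHaarMeasure_map μ
  lift c to NNReal using hc
  rw [ENNReal.ofReal_coe_nnreal] at h
  have h' : μ' = c • μ.map φ := h
  subst h'
  simp only [jacobian]
  rw [Measure.haarScalarFactor_smul, Measure.haarScalarFactor_self]
  simp

variable [LocallyCompactSpace H'] [SecondCountableTopology H'] [LocallyCompactSpace H'']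
  [SecondCountableTopology H'']

theorem eq_jacobian_smul_map (φ : H ≃ₜ* H') (μ : Measure H) (μ' : Measure H')
    [μ.IsHaarMeasure] [μ'.IsHaarMeasure] :
    μ' = ENNReal.ofReal (jacobian φ μ μ') • μ.map φ := by
  have : (μ.map φ).IsHaarMeasure := φ.isHaarMeasure_map μ
  have h := Measure.isMulLeftInvariant_eq_smul μ' (μ.map φ)
  rw [jacobian, ENNReal.ofReal_coe_nnreal]
  exact h

theorem jacobian_comp (φ : H ≃ₜ* H') (ψ : H' ≃ₜ* H'') (χ : H ≃ₜ* H'')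
    (hχ : ∀ x, χ x = ψ (φ x)) (μ : Measure H) (μ' : Measure H') (μ'' : Measure H'')
    [μ.IsHaarMeasure] [μ'.IsHaarMeasure] [μ''.IsHaarMeasure] :
    jacobian χ μ μ'' = jacobian ψ μ' μ'' * jacobian φ μ μ' := by
  have hψ := (jacobian_pos ψ μ' μ'').le
  refine jacobian_eq_of_eq_smul χ μ μ'' (mul_nonneg hψ (jacobian_pos φ μ μ').le) ?_
  have hcomp : (χ : H → H'') = ψ ∘ φ := funext hχ
  calc μ'' = ENNReal.ofReal (jacobian ψ μ' μ'') • μ'.map ψ := eq_jacobian_smul_map ψ μ' μ''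
    _ = ENNReal.ofReal (jacobian ψ μ' μ'') •
        Measure.map ψ (ENNReal.ofReal (jacobian φ μ μ') • μ.map φ) :=
      congrArg (fun κ => ENNReal.ofReal (jacobian ψ μ' μ'') • Measure.map ψ κ)
        (eq_jacobian_smul_map φ μ μ')
    _ = _ := by
      rw [Measure.map_smul, smul_smul, ← ENNReal.ofReal_mul hψ, hcomp,
        Measure.map_map (g := (ψ : H' → H'')) (f := (φ : H → H'))
          ψ.continuous_toFun.measurable φ.continuous_toFun.measurable]

/-- An isomorphism that preserves a set of finite positive measure has Jacobian one. -/
theorem jacobian_eq_one (φ : H' ≃ₜ* H') (μ : Measure H') [μ.IsHaarMeasure] {U : Set H'}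
    (hU : MeasurableSet U) (hφ : φ ⁻¹' U = U) (h0 : μ U ≠ 0) (htop : μ U ≠ ⊤) :
    jacobian φ μ μ = 1 := by
  have h1 : μ U = ENNReal.ofReal (jacobian φ μ μ) * μ U := by
    conv_lhs => rw [eq_jacobian_smul_map φ μ μ]
    rw [Measure.smul_apply, smul_eq_mul,
      Measure.map_apply (f := (φ : H' → H')) φ.continuous_toFun.measurable hU, hφ]
  have h2 : ENNReal.ofReal (jacobian φ μ μ) = 1 := by
    rw [← ENNReal.mul_left_inj h0 htop, one_mul, ← h1]
  rwa [ENNReal.ofReal_eq_one] at h2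

end Jacobian

/-! ### Modular functions on the Levi subgroup and on forms -/

section ModularFunctions

variable {F : Type*} [NontriviallyNormedField F] {d : ℕ}

/-- The chain rule for the Jacobians of conjugations. -/
theorem jacobian_conj_mul [LocallyCompactSpace F] [MeasurableSpace (G F d)] [BorelSpace (G F d)]
    {H₁ H₂ H₃ : Subgroup (G F d)} [LocallyCompactSpace H₂] [LocallyCompactSpace H₃]
    {g g' e : G F d} (he : e = g * g')
    (h' : ∀ x, x ∈ H₁ ↔ g' * x * g'⁻¹ ∈ H₂) (h : ∀ x, x ∈ H₂ ↔ g * x * g⁻¹ ∈ H₃)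
    (h'' : ∀ x, x ∈ H₁ ↔ e * x * e⁻¹ ∈ H₃) (μ₁ : Measure H₁) (μ₂ : Measure H₂) (μ₃ : Measure H₃)
    [μ₁.IsHaarMeasure] [μ₂.IsHaarMeasure] [μ₃.IsHaarMeasure] :
    jacobian (conjIso e H₁ H₃ h'') μ₁ μ₃ =
      jacobian (conjIso g H₂ H₃ h) μ₂ μ₃ * jacobian (conjIso g' H₁ H₂ h') μ₁ μ₂ := by
  refine jacobian_comp _ _ _ (fun x => ?_) μ₁ μ₂ μ₃
  subst he
  ext1
  change g * g' * x * (g * g')⁻¹ = g * (g' * x * g'⁻¹) * g⁻¹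
  group

theorem levi_conj_Nbar (m : GL (Fin d) F) (u : G F d) :
    u ∈ Nbar F d ↔ levi m * u * (levi m)⁻¹ ∈ Nbar F d := by
  have h1 := embB_conj 1 ((embB 1)⁻¹ * u * embB 1)
  have h2 := embB_conj (m⁻¹) ((embB 1)⁻¹ * u * embB 1)
  have h3 : embB (m⁻¹ : GL (Fin d) F) = levi m * embB 1 := by rw [levi_mul_embB, one_mul]
  rw [h3] at h2
  have e1 : embB 1 * ((embB 1)⁻¹ * u * embB 1) * (embB 1 : G F d)⁻¹ = u := by group
  have e2 : levi m * embB 1 * ((embB 1)⁻¹ * u * embB 1) * (levi m * embB 1)⁻¹ =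
    levi m * u * (levi m)⁻¹ := by group
  rw [e1] at h1
  rw [e2] at h2
  exact h1.symm.trans h2

variable [MeasurableSpace (G F d)] [BorelSpace (G F d)]
  (μN : Measure (N F d)) [μN.IsHaarMeasure] (μNbar : Measure (Nbar F d)) [μNbar.IsHaarMeasure]

/-- The Jacobian of `Ad(m)` on the opposite unipotent radical. -/
def modNbar (m : GL (Fin d) F) : ℝ :=
  jacobian (conjIso (levi m) (Nbar F d) (Nbar F d) (levi_conj_Nbar m)) μNbar μNbar

theorem modP_pos (m : GL (Fin d) F) : 0 < modP μN m := jacobian_pos _ _ _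

theorem modTilde_pos (b : GL (Fin d) F) : 0 < modTilde μN μNbar b := jacobian_pos _ _ _

variable [LocallyCompactSpace F]

theorem modP_mul (m m' : GL (Fin d) F) : modP μN (m * m') = modP μN m * modP μN m' :=
  jacobian_conj_mul (levi_mul m m') _ _ _ μN μN μN

/-- This is the relation `δ̃(B m) = δ̃(B) δ(m)`, as `B m` has the Gram matrix `mᵀ B`. -/
theorem modTilde_transpose_mul (m b : GL (Fin d) F) :
    modTilde μN μNbar (transposeGL m * b) = modTilde μN μNbar b * modP μN m :=
  jacobian_conj_mul (embB_mul_levi b m).symm _ _ _ μN μN μNbar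

/-- The relation for the left action: `m B` has the Gram matrix `B m⁻¹`. -/
theorem modTilde_mul_inv (m b : GL (Fin d) F) :
    modTilde μN μNbar (b * m⁻¹) = modNbar μNbar m * modTilde μN μNbar b :=
  jacobian_conj_mul (levi_mul_embB b m).symm _ _ _ μN μNbar μNbar

end ModularFunctions

section Characters

variable {K : Type*} [Field K] {n : Type*} [Fintype n] [DecidableEq n]

/-- Transvections are commutators with diagonal matrices, as soon as the field has an element other
than `0` and `1`; hence characters of `GL` are trivial on them. -/
theorem map_transvection_eq_one {A : Type*} [CommGroup A] (f : GL n K →* A) {a : K} (ha0 : a ≠ 0)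
    (ha1 : a ≠ 1) {i j : n} (hij : i ≠ j) (c : K) {m : GL n K} (hm : m.1 = transvection i j c) :
    f m = 1 := by
  have ha1' : a - 1 ≠ 0 := sub_ne_zero.2 ha1
  have hdet : ∀ c : K, (transvection i j c).det ≠ 0 := fun c => by
    rw [det_transvection_of_ne _ _ hij]; exact one_ne_zero
  let t : K → GL n K := fun c => GeneralLinearGroup.mkOfDetNeZero _ (hdet c)
  have hD : (diagonal (Function.update (1 : n → K) i a)).det ≠ 0 := by
    rw [det_diagonal, Finset.prod_ne_zero_iff]
    intro k _
    rcases eq_or_ne k i with rfl | hk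
    · simpa using ha0
    · simp [hk]
  let D : GL n K := GeneralLinearGroup.mkOfDetNeZero _ hD
  have ht : ∀ c c', t (c + c') = t c * t c' := fun c c' =>
    Units.ext (transvection_mul_transvection_same i j hij c c').symm
  have hconj : ∀ c, D * t c = t (a * c) * D := fun c => by
    refine Units.ext ?_
    change diagonal (Function.update (1 : n → K) i a) * transvection i j c =
      transvection i j (a * c) * diagonal (Function.update (1 : n → K) i a)
    ext k l
    rw [diagonal_mul, mul_diagonal]
    simp only [transvection, Matrix.add_apply, one_apply, single_apply, Function.update_apply,
      Pi.one_apply]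
    by_cases h1 : k = i <;> by_cases h2 : l = j <;> by_cases h3 : k = l <;> simp_all
    all_goals grind
  have key : ∀ c, f (t (a * c)) = f (t c) := fun c => by
    have h := congrArg f (hconj c)
    rw [map_mul, map_mul, mul_comm] at h
    exact (mul_right_cancel h).symm
  have hone : ∀ c, f (t ((a - 1) * c)) = 1 := fun c => by
    have h := key c
    rw [show a * c = (a - 1) * c + c by ring, ht, map_mul] at h
    exact mul_eq_right.1 h
  have hmt : m = t ((a - 1) * ((a - 1)⁻¹ * c)) := by
    refine Units.ext ?_
    rw [hm, mul_inv_cancel_left₀ ha1']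
    rfl
  rw [hmt, hone]

end Characters

/-- Characters of `GL` are invariant under transposition. -/
theorem map_transposeGL {K : Type*} [Field K] {d : ℕ} {A : Type*} [CommGroup A]
    (f : GL (Fin d) K →* A) {a : K} (ha0 : a ≠ 0) (ha1 : a ≠ 1) (m : GL (Fin d) K) :
    f (transposeGL m) = f m := by
  have key : ∀ m' : GL (Fin d) K, m'.1 = m.1 → f (transposeGL m') = f m' := by
    refine diagonal_transvection_induction_of_det_ne_zero
      (fun M => ∀ m' : GL (Fin d) K, m'.1 = M → f (transposeGL m') = f m') m.1 m.det.ne_zero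
      ?_ ?_ ?_
    · intro D _ m' hm'
      congr 1
      refine Units.ext ?_
      change m'.1ᵀ = m'.1
      rw [hm', diagonal_transpose]
    · intro t m' hm'
      have h1 : (transposeGL m').1 = transvection t.j t.i t.c := by
        change m'.1ᵀ = _
        rw [hm', TransvectionStruct.toMatrix, transvection, transvection, transpose_add,
          transpose_one, transpose_single]
      rw [map_transvection_eq_one f ha0 ha1 t.hij t.c hm',
        map_transvection_eq_one f ha0 ha1 t.hij.symm t.c h1]
    · intro A B hA hB hPA hPB m' hm'
      have hm2 : m' = GeneralLinearGroup.mkOfDetNeZero A hA *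
          GeneralLinearGroup.mkOfDetNeZero B hB := Units.ext hm'
      have ht : transposeGL m' = transposeGL (GeneralLinearGroup.mkOfDetNeZero B hB) *
          transposeGL (GeneralLinearGroup.mkOfDetNeZero A hA) := by
        rw [hm2]
        exact Units.ext (transpose_mul _ _)
      rw [ht, map_mul, hPA (GeneralLinearGroup.mkOfDetNeZero A hA) rfl,
        hPB (GeneralLinearGroup.mkOfDetNeZero B hB) rfl, mul_comm, ← map_mul, hm2]
  exact key m rfl

section Conjugation

variable {F : Type*} [NontriviallyNormedField F] {d : ℕ}

theorem transposeGL_scalar (a : Fˣ) :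
    transposeGL (GeneralLinearGroup.scalar (Fin d) a) = GeneralLinearGroup.scalar (Fin d) a := by
  refine Units.ext ?_
  change (Matrix.scalar (Fin d) (a : F))ᵀ = Matrix.scalar (Fin d) (a : F)
  rw [scalar_apply, diagonal_transpose]

theorem rightA_eq (a : Fˣ) (b : GL (Fin d) F) :
    rightA a b = GeneralLinearGroup.scalar (Fin d) a * b := by
  rw [rightA, biact, transposeGL_scalar, inv_one, mul_one]

theorem continuous_adM : Continuous fun p : GL (Fin d) F × GL (Fin d) F => adM p.1 p.2 := by
  unfold adM biact
  exact ((continuous_transposeGL.comp continuous_fst.inv).mul continuous_snd).mul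
    continuous_fst.inv

theorem continuous_adM_left (b : GL (Fin d) F) :
    Continuous fun m : GL (Fin d) F => adM m b := by
  unfold adM biact
  exact ((continuous_transposeGL.comp continuous_inv).mul continuous_const).mul continuous_inv

theorem norm_mul_apply_le_one [IsUltrametricDist F] {n : Type*} [Fintype n] {A B : Matrix n n F}
    (hA : ∀ i j, ‖A i j‖ ≤ 1) (hB : ∀ i j, ‖B i j‖ ≤ 1) (i j : n) : ‖(A * B) i j‖ ≤ 1 := by
  rw [mul_apply]
  refine IsUltrametricDist.norm_sum_le_of_forall_le_of_nonneg zero_le_one fun k _ => ?_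
  rw [norm_mul]
  exact mul_le_one₀ (hA i k) (norm_nonneg _) (hB k j)

theorem isOpen_integral_G [IsUltrametricDist F] :
    IsOpen {g : G F d | ∀ i j, ‖mat g i j‖ ≤ 1} := by
  have : {g : G F d | ∀ i j, ‖mat g i j‖ ≤ 1} =
      ⋂ i, ⋂ j, (fun g => mat g i j) ⁻¹' Metric.closedBall 0 1 := by
    ext g; simp
  rw [this]
  exact isOpen_iInter_of_finite fun i => isOpen_iInter_of_finite fun j =>
    (IsUltrametricDist.isOpen_closedBall 0 one_ne_zero).preimage (continuous_mat_apply i j)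

end Conjugation

section ModularRelations

variable {F : Type*} [NontriviallyNormedField F] [LocallyCompactSpace F] {d : ℕ}
  [MeasurableSpace (G F d)] [BorelSpace (G F d)]
  (μN : Measure (N F d)) [μN.IsHaarMeasure] (μNbar : Measure (Nbar F d)) [μNbar.IsHaarMeasure]

theorem modP_one : modP μN 1 = 1 := by
  have h := modP_mul μN 1 1
  rw [one_mul] at h
  exact (mul_eq_left₀ (modP_pos μN 1).ne').1 h.symm

theorem modP_inv (m : GL (Fin d) F) : modP μN m⁻¹ = (modP μN m)⁻¹ := by
  refine eq_inv_of_mul_eq_one_left ?_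
  rw [← modP_mul, inv_mul_cancel, modP_one]

/-- Every character of `GL` with values in a commutative group is invariant under transposition. -/
theorem modP_transposeGL (m : GL (Fin d) F) : modP μN (transposeGL m) = modP μN m := by
  obtain ⟨a, ha⟩ := NormedField.exists_one_lt_norm F
  have ha0 : a ≠ 0 := by rintro rfl; simp at ha; linarith
  have ha1 : a ≠ 1 := by rintro rfl; simp at ha
  let f : GL (Fin d) F →* ℝ :=
    { toFun := modP μN, map_one' := modP_one μN, map_mul' := modP_mul μN }
  exact congrArg Units.val (map_transposeGL f.toHomUnits ha0 ha1 m)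

/-- Conjugation by `embB 1` exchanges `N` and the opposite radical and induces the inverse transpose
on `GL`; as `δ` is invariant under transposition, the two modular functions are inverse to each
other. -/
theorem modNbar_eq (m : GL (Fin d) F) : modNbar μNbar m = (modP μN m)⁻¹ := by
  have h1 := modTilde_mul_inv μN μNbar m 1
  have h2 := modTilde_transpose_mul μN μNbar (transposeGL m⁻¹) 1
  have h3 : transposeGL (transposeGL m⁻¹) * 1 = 1 * m⁻¹ := by
    rw [mul_one, one_mul]
    exact Units.ext (transpose_transpose _)
  rw [h3, h1, modP_transposeGL, modP_inv, mul_comm] at h2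
  exact mul_left_cancel₀ (modTilde_pos μN μNbar 1).ne' h2

theorem modTilde_adM (m b : GL (Fin d) F) :
    modTilde μN μNbar (adM m b) = modTilde μN μNbar b * (modP μN m)⁻¹ * (modP μN m)⁻¹ := by
  rw [adM, biact, modTilde_mul_inv, modTilde_transpose_mul, modNbar_eq μN, modP_inv]
  ring

theorem modTilde_rightA (a : Fˣ) (b : GL (Fin d) F) :
    modTilde μN μNbar (rightA a b) =
      modTilde μN μNbar b * modP μN (GeneralLinearGroup.scalar (Fin d) a) := by
  rw [rightA_eq, ← transposeGL_scalar, modTilde_transpose_mul, transposeGL_scalar]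

/-- The modular character is trivial near the identity: elements of `GL` with integral entries and
integral inverse preserve the integral points of `N`. -/
theorem eventually_modP_eq_one [IsUltrametricDist F] :
    ∀ᶠ m : GL (Fin d) F in 𝓝 1, modP μN m = 1 := by
  have hone : (1 : G F d) ∈ {g : G F d | ∀ i j, ‖mat g i j‖ ≤ 1} := by
    intro i j
    rw [mat_one, one_apply]
    split_ifs <;> simp
  have hnhds : {g : G F d | ∀ i j, ‖mat g i j‖ ≤ 1} ∈ 𝓝 1 := isOpen_integral_G.mem_nhds hone
  have h1 : Tendsto (fun m : GL (Fin d) F => levi m) (𝓝 1) (𝓝 1) := by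
    have := continuous_levi.tendsto (1 : GL (Fin d) F)
    rwa [levi_one] at this
  have h2 : Tendsto (fun m : GL (Fin d) F => (levi m)⁻¹) (𝓝 1) (𝓝 1) := by simpa using h1.inv
  filter_upwards [h1.eventually hnhds, h2.eventually hnhds] with m hm hm'
  have hconj : ∀ (k u : G F d), (∀ i j, ‖mat k i j‖ ≤ 1) → (∀ i j, ‖mat k⁻¹ i j‖ ≤ 1) →
      (∀ i j, ‖mat u i j‖ ≤ 1) → ∀ i j, ‖mat (k * u * k⁻¹) i j‖ ≤ 1 := by
    intro k u hk hk' hu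
    rw [mat_mul, mat_mul]
    exact norm_mul_apply_le_one (norm_mul_apply_le_one hk hu) hk'
  have hopen : IsOpen {u : N F d | ∀ i j, ‖mat (u : G F d) i j‖ ≤ 1} :=
    isOpen_integral_G.preimage continuous_subtype_val
  refine jacobian_eq_one _ μN (U := {u : N F d | ∀ i j, ‖mat (u : G F d) i j‖ ≤ 1})
    hopen.measurableSet ?_ ?_ ?_
  · ext u
    constructor
    · intro hu
      have h3 := hconj (levi m)⁻¹ (levi m * u * (levi m)⁻¹) hm' (by simpa using hm) hu
      have h4 : (levi m)⁻¹ * (levi m * u * (levi m)⁻¹) * (levi m)⁻¹⁻¹ = (u : G F d) := by group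
      rwa [h4] at h3
    · intro hu
      exact hconj (levi m) u hm hm' hu
  · exact (hopen.measure_pos μN ⟨1, hone⟩).ne'
  · exact (isCompact_bounded isClosed_N 1).measure_lt_top.ne

theorem isLocallyConstant_modP [IsUltrametricDist F] :
    IsLocallyConstant (modP μN : GL (Fin d) F → ℝ) := by
  apply isLocallyConstant_of_eventually_one
  filter_upwards [eventually_modP_eq_one μN] with m hm b
  rw [modP_mul, hm, mul_one]

theorem isLocallyConstant_modTilde [IsUltrametricDist F] :
    IsLocallyConstant (modTilde μN μNbar : GL (Fin d) F → ℝ) := by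
  apply isLocallyConstant_of_eventually_one
  filter_upwards [eventually_modP_eq_one μN] with m hm b
  have h := modTilde_mul_inv μN μNbar m⁻¹ b
  rwa [inv_inv, modNbar_eq μN, modP_inv, hm, inv_one, inv_one, one_mul] at h

theorem continuous_modTilde_rpow [IsUltrametricDist F] (r : ℝ) :
    Continuous fun b : GL (Fin d) F => modTilde μN μNbar b ^ r :=
  (isLocallyConstant_modTilde μN μNbar).continuous.rpow_const
    fun b => Or.inl (modTilde_pos μN μNbar b).ne'

end ModularRelations

/-! ### The invariant measure on forms coming from the opposite unipotent radical -/

section FormMeasure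

variable {F : Type*} [NontriviallyNormedField F] {d : ℕ}

open Classical in
/-- The nondegenerate form `(x, y) ↦ Q(x, u y)` on `V` attached to `u` in the opposite unipotent
radical; junk value `1` if this form is degenerate. -/
def formGL (u : G F d) : GL (Fin d) F :=
  if h : (lowerLeft u).det ≠ 0 then GeneralLinearGroup.mkOfDetNeZero _ h else 1

theorem formGL_val {u : G F d} (h : (lowerLeft u).det ≠ 0) : (formGL u).1 = lowerLeft u := by
  rw [formGL, dif_pos h]
  rfl

theorem isOpen_regular : IsOpen {u : Nbar F d | (lowerLeft (u : G F d)).det ≠ 0} :=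
  isOpen_ne.preimage (continuous_lowerLeft.comp continuous_subtype_val).matrix_det

theorem measurable_formGL [MeasurableSpace (G F d)] [BorelSpace (G F d)]
    [MeasurableSpace (GL (Fin d) F)] [BorelSpace (GL (Fin d) F)] :
    Measurable fun u : Nbar F d => formGL (u : G F d) := by
  refine measurable_of_restrict_of_restrict_compl
    (isOpen_regular (F := F) (d := d)).measurableSet ?_ ?_
  · have h0 : Continuous fun u : {u : Nbar F d | (lowerLeft (u : G F d)).det ≠ 0} =>
        lowerLeft ((u : Nbar F d) : G F d) :=
      continuous_lowerLeft.comp (continuous_subtype_val.comp continuous_subtype_val)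
    have h : Continuous fun u : {u : Nbar F d | (lowerLeft (u : G F d)).det ≠ 0} =>
        GeneralLinearGroup.mkOfDetNeZero (lowerLeft ((u : Nbar F d) : G F d)) u.2 :=
      continuous_mkOfDetNeZero.comp (h0.subtype_mk fun u => u.2)
    convert h.measurable using 1
    ext1 u
    exact dif_pos u.2
  · convert measurable_const (a := (1 : GL (Fin d) F)) using 1
    ext1 u
    exact dif_neg u.2

theorem lowerLeft_mul_levi (m : GL (Fin d) F) (g : G F d) :
    lowerLeft (g * levi m) = lowerLeft g * m.1 := by
  ext i j
  simp only [lowerLeft, of_apply]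
  rw [mat_mul, mul_apply, mul_apply]
  simp [mat, levi]

theorem lowerLeft_conj (m : GL (Fin d) F) (g : G F d) :
    lowerLeft (levi m * g * (levi m)⁻¹) = (m⁻¹).1ᵀ * lowerLeft g * (m⁻¹).1 := by
  rw [← levi_inv, lowerLeft_mul_levi, lowerLeft_levi_mul]

theorem det_lowerLeft_conj_ne_zero_iff (m : GL (Fin d) F) (g : G F d) :
    (lowerLeft (levi m * g * (levi m)⁻¹)).det ≠ 0 ↔ (lowerLeft g).det ≠ 0 := by
  have h : (m⁻¹).1.det ≠ 0 := (m⁻¹).det.ne_zero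
  rw [lowerLeft_conj, det_mul, det_mul, det_transpose, mul_ne_zero_iff, mul_ne_zero_iff]
  exact ⟨fun h' => h'.1.2, fun h' => ⟨⟨h, h'⟩, h⟩⟩

theorem formGL_conj (m : GL (Fin d) F) {g : G F d} (h : (lowerLeft g).det ≠ 0) :
    formGL (levi m * g * (levi m)⁻¹) = adM m (formGL g) := by
  refine Units.ext ?_
  rw [formGL_val ((det_lowerLeft_conj_ne_zero_iff m g).2 h), lowerLeft_conj]
  simp [adM, biact, transposeGL, formGL_val h]

variable [MeasurableSpace (G F d)] [BorelSpace (G F d)]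
  (μN : Measure (N F d)) [μN.IsHaarMeasure] (μNbar : Measure (Nbar F d)) [μNbar.IsHaarMeasure]

/-- The density `δ̃(B)^{-1/2}` at the form `B` attached to `u`. -/
def density (u : Nbar F d) : ℝ := modTilde μN μNbar (formGL (u : G F d)) ^ (-(1 / 2) : ℝ)

theorem density_pos (u : Nbar F d) : 0 < density μN μNbar u :=
  Real.rpow_pos_of_pos (modTilde_pos μN μNbar _) _

variable [LocallyCompactSpace F] [IsUltrametricDist F]
  [MeasurableSpace (GL (Fin d) F)] [BorelSpace (GL (Fin d) F)]

theorem measurable_density : Measurable (density μN μNbar) :=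
  (continuous_modTilde_rpow μN μNbar _).measurable.comp measurable_formGL

/-- The image of the Haar measure with density `δ̃^{-1/2}` under the map from the opposite
unipotent radical to forms, restricted to the locus of nondegenerate forms. -/
def formMeasure : Measure (GL (Fin d) F) :=
  ((μNbar.restrict {u | (lowerLeft (u : G F d)).det ≠ 0}).withDensity
    fun u => ENNReal.ofReal (density μN μNbar u)).map fun u : Nbar F d => formGL (u : G F d)

theorem lintegral_formMeasure {f : GL (Fin d) F → ENNReal} (hf : Measurable f) :
    ∫⁻ b, f b ∂formMeasure μN μNbar =
      ∫⁻ u in {u : Nbar F d | (lowerLeft (u : G F d)).det ≠ 0},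
        ENNReal.ofReal (density μN μNbar u) * f (formGL (u : G F d)) ∂μNbar := by
  rw [formMeasure, lintegral_map hf measurable_formGL]
  exact lintegral_withDensity_eq_lintegral_mul _ (measurable_density μN μNbar).ennreal_ofReal
    (hf.comp measurable_formGL)

theorem integral_formMeasure {f : GL (Fin d) F → ℂ} (hf : Measurable f) :
    ∫ b, f b ∂formMeasure μN μNbar =
      ∫ u in {u : Nbar F d | (lowerLeft (u : G F d)).det ≠ 0},
        (density μN μNbar u : ℂ) * f (formGL (u : G F d)) ∂μNbar := by
  rw [formMeasure, integral_map measurable_formGL.aemeasurable hf.aestronglyMeasurable,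
    integral_withDensity_eq_integral_toReal_smul
      (measurable_density μN μNbar).ennreal_ofReal
      (Eventually.of_forall fun _ => ENNReal.ofReal_lt_top)]
  refine integral_congr_ae (Eventually.of_forall fun u => ?_)
  have : 0 ≤ density μN μNbar u := Real.rpow_nonneg (modTilde_pos μN μNbar _).le _
  simp [ENNReal.toReal_ofReal this]

/-- The density compensates for the Jacobian of `Ad(m)` on the opposite unipotent radical, since
`δ̃(Ad(m) B) = δ̃(B) δ(m)⁻²` while that Jacobian is `δ(m)⁻¹`. -/
theorem map_adM_formMeasure (m : GL (Fin d) F) :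
    (formMeasure μN μNbar).map (adM m) = formMeasure μN μNbar := by
  have hm : Measurable (adM m : GL (Fin d) F → GL (Fin d) F) :=
    (continuous_adM.comp (Continuous.prodMk_right m)).measurable
  refine Measure.ext_of_lintegral _ fun f hf => ?_
  rw [lintegral_map hf hm, lintegral_formMeasure μN μNbar (f := fun b => f (adM m b)) (hf.comp hm),
    lintegral_formMeasure μN μNbar hf]
  set φ := conjIso (levi m) (Nbar F d) (Nbar F d) (levi_conj_Nbar m) with hφ
  have hmeas : MeasurableSet {u : Nbar F d | (lowerLeft (u : G F d)).det ≠ 0} :=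
    isOpen_regular.measurableSet
  rw [← lintegral_indicator hmeas, ← lintegral_indicator hmeas]
  set g : Nbar F d → ENNReal := Set.indicator {u : Nbar F d | (lowerLeft (u : G F d)).det ≠ 0}
    fun u => ENNReal.ofReal (density μN μNbar u) * f (formGL (u : G F d)) with hg
  have hgm : Measurable g := Measurable.indicator
    ((measurable_density μN μNbar).ennreal_ofReal.mul (hf.comp measurable_formGL)) hmeas
  have h1 : ∫⁻ u, g u ∂μNbar = ENNReal.ofReal (modNbar μNbar m) * ∫⁻ u, g (φ u) ∂μNbar := by
    conv_lhs => rw [eq_jacobian_smul_map φ μNbar μNbar]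
    rw [lintegral_smul_measure, lintegral_map (f := g) (g := (φ : Nbar F d → Nbar F d)) hgm
      φ.continuous_toFun.measurable]
    rfl
  have h2 : Measurable fun u => g (φ u) := hgm.comp φ.continuous_toFun.measurable
  rw [h1, ← lintegral_const_mul _ h2]
  refine lintegral_congr fun u => ?_
  have hφu : ((φ u : Nbar F d) : G F d) = levi m * u * (levi m)⁻¹ := rfl
  have hmP := modP_pos μN m
  by_cases hu : (lowerLeft (u : G F d)).det ≠ 0
  · have hu' : (lowerLeft ((φ u : Nbar F d) : G F d)).det ≠ 0 :=
      (det_lowerLeft_conj_ne_zero_iff m _).2 hu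
    have hT := modTilde_pos μN μNbar (formGL (u : G F d))
    have hd : density μN μNbar (φ u) = density μN μNbar u * modP μN m := by
      rw [density, density, hφu, formGL_conj m hu, modTilde_adM,
        Real.mul_rpow (by positivity) (by positivity),
        Real.mul_rpow (by positivity) (by positivity), mul_assoc,
        ← Real.rpow_add (by positivity)]
      norm_num
      exact Or.inl (by rw [Real.rpow_neg_one, inv_inv])
    rw [Set.indicator_of_mem hu, hg, Set.indicator_of_mem hu', hd, hφu, formGL_conj m hu,
      modNbar_eq μN, ← mul_assoc, ← ENNReal.ofReal_mul (by positivity)]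
    congr 2
    field_simp
  · have hu' : ¬ (lowerLeft ((φ u : Nbar F d) : G F d)).det ≠ 0 := fun h =>
      hu ((det_lowerLeft_conj_ne_zero_iff m _).1 h)
    rw [Set.indicator_of_notMem hu, hg, Set.indicator_of_notMem hu', mul_zero]

end FormMeasure

/-! ### Coordinates on the opposite unipotent radical -/

section Coordinates

variable {F : Type*} [NontriviallyNormedField F] {d : ℕ}

/-- Since `l ⊗ l = -(Y + Yᵀ)`, the linear form `l` attached to `u` is bounded in terms of the
bilinear form `Y`. -/
theorem norm_lineForm_sq_le {u : G F d} (hu : u ∈ Nbar F d) {M : ℝ}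
    (hM : ∀ i j, ‖lowerLeft u i j‖ ≤ M) (i : Fin d) : ‖lineForm u i‖ ^ 2 ≤ 2 * M := by
  have h := congrFun (congrFun (lowerLeft_add_transpose hu) i) i
  rw [Matrix.add_apply, transpose_apply, Matrix.neg_apply, vecMulVec_apply] at h
  calc ‖lineForm u i‖ ^ 2 = ‖-(lineForm u i * lineForm u i)‖ := by rw [norm_neg, norm_mul, sq]
    _ = ‖lowerLeft u i i + lowerLeft u i i‖ := by rw [h]
    _ ≤ 2 * M := by
      refine (norm_add_le _ _).trans ?_
      linarith [hM i i]

theorem norm_mat_le {u : G F d} (hu : u ∈ Nbar F d) {M : ℝ}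
    (hM : ∀ i j, ‖lowerLeft u i j‖ ≤ M) (i j : Idx d) : ‖mat u i j‖ ≤ max 1 (2 * M) := by
  have hl : ∀ i, ‖lineForm u i‖ ≤ max 1 (2 * M) := fun i => by
    rcases le_or_gt ‖lineForm u i‖ 1 with h | h
    · exact h.trans (le_max_left _ _)
    · refine le_trans ?_ ((norm_lineForm_sq_le hu hM i).trans (le_max_right _ _))
      nlinarith
  have h1 : ‖(1 : F)‖ ≤ max 1 (2 * M) := by rw [norm_one]; exact le_max_left _ _
  have h0 : ‖(0 : F)‖ ≤ max 1 (2 * M) := by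
    rw [norm_zero]; exact zero_le_one.trans (le_max_left _ _)
  have hY : ∀ i j, ‖lowerLeft u i j‖ ≤ max 1 (2 * M) := fun i j => by
    have := (norm_nonneg _).trans (hM i j)
    exact (hM i j).trans (by rw [le_max_iff]; right; linarith)
  have hone : ∀ i j : Fin d, ‖(1 : Matrix (Fin d) (Fin d) F) i j‖ ≤ max 1 (2 * M) := fun i j => by
    rw [one_apply]
    split_ifs
    exacts [h1, h0]
  rw [mat_eq_of_mem_Nbar hu, nbarMat]
  rcases i with (i | i) | i <;> rcases j with (j | j) | j
  · exact hone i j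
  · exact h0
  · exact h0
  · exact hY i j
  · exact hone i j
  · exact (norm_neg (lineForm u i)).trans_le (hl i)
  · exact hl j
  · exact h0
  · exact (congrArg norm (one_apply_eq ())).trans_le h1

theorem exists_norm_le_of_isCompact {K : Set (GL (Fin d) F)} (hK : IsCompact K) :
    ∃ M, ∀ b ∈ K, ∀ i j, ‖b.1 i j‖ ≤ M := by
  have h : ∀ i j, ∃ M, ∀ b ∈ K, ‖b.1 i j‖ ≤ M := fun i j => by
    obtain ⟨M, hM⟩ := hK.exists_bound_of_continuousOn (f := fun b : GL (Fin d) F => b.1 i j)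
      (Units.continuous_val.matrix_elem i j).continuousOn
    exact ⟨M, hM⟩
  choose M hM using h
  refine ⟨∑ i, ∑ j, |M i j|, fun b hb i j => ?_⟩
  calc ‖b.1 i j‖ ≤ |M i j| := (hM i j b hb).trans (le_abs_self _)
    _ ≤ ∑ j, |M i j| := Finset.single_le_sum (f := fun j => |M i j|)
      (fun _ _ => abs_nonneg _) (Finset.mem_univ j)
    _ ≤ _ := Finset.single_le_sum (f := fun i => ∑ j, |M i j|)
      (fun _ _ => Finset.sum_nonneg fun _ _ => abs_nonneg _) (Finset.mem_univ i)

theorem formGL_nbarElt {l : Fin d → F} {b : GL (Fin d) F} (h : b.1 + b.1ᵀ = -vecMulVec l l) :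
    formGL (nbarElt l b.1 h) = b := by
  refine Units.ext ?_
  rw [formGL_val, lowerLeft_nbarElt]
  rw [lowerLeft_nbarElt]
  exact b.det.ne_zero

theorem hasSymPart_formGL {u : G F d} (hu : u ∈ Nbar F d) (h : (lowerLeft u).det ≠ 0)
    (hl : lineForm u ≠ 0) : HasSymPart (-1) (formGL u) := by
  refine ⟨lineForm u, hl, ?_⟩
  rw [formGL_val h, lowerLeft_add_transpose hu]
  simp

theorem exists_formGL_eq_of_hasSymPart {b : GL (Fin d) F} (h : HasSymPart (-1) b) :
    ∃ u : Nbar F d, (lowerLeft (u : G F d)).det ≠ 0 ∧ formGL (u : G F d) = b := by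
  obtain ⟨l, -, hl'⟩ := h
  have hl : b.1 + b.1ᵀ = -vecMulVec l l := by rw [hl']; simp
  exact ⟨⟨nbarElt l b.1 hl, nbarElt_mem _ _ _⟩, by
    rw [lowerLeft_nbarElt]; exact b.det.ne_zero, formGL_nbarElt hl⟩

theorem lineForm_mul {u v : G F d} (hv : v ∈ Nbar F d) :
    lineForm (u * v) = fun j => lineForm u j + (∑ i, mat u (.inr ()) (.inl (.inr i)) *
      lowerLeft v i j) + mat u (.inr ()) (.inr ()) * lineForm v j := by
  ext j
  simp only [lineForm, lowerLeft, of_apply]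
  rw [mat_mul, mul_apply]
  simp [Fintype.sum_sum_type, row_eq_of_mem_Nbar hv]

/-- The linear form `V → L` is additive on the opposite unipotent radical. -/
theorem lineForm_mul_of_mem {u v : G F d} (hu : u ∈ Nbar F d) (hv : v ∈ Nbar F d) :
    lineForm (u * v) = lineForm u + lineForm v := by
  rw [lineForm_mul hv]
  ext j
  rw [mat_eq_of_mem_Nbar hu]
  simp [nbarMat, lineForm]

/-- The subgroup of the opposite unipotent radical on which the linear form vanishes is not a
neighbourhood of the identity: there are elements with arbitrarily small nonzero linear form. -/
theorem lineForm_eq_zero_notMem_nhds [NeZero (2 : F)] (hd : 1 ≤ d) :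
    {u : Nbar F d | lineForm (u : G F d) = 0} ∉ 𝓝 (1 : Nbar F d) := by
  have h20 : (2 : F) ≠ 0 := NeZero.ne 2
  intro hmem
  have hY : ∀ l : Fin d → F, (-(2 : F)⁻¹ • vecMulVec l l) + (-(2 : F)⁻¹ • vecMulVec l l)ᵀ =
      -vecMulVec l l := by
    intro l
    ext i j
    simp only [Matrix.add_apply, transpose_apply, Matrix.smul_apply, vecMulVec_apply, smul_eq_mul,
      Matrix.neg_apply]
    field_simp
    ring
  set e : F → Nbar F d := fun c => ⟨nbarElt (fun _ => c) _ (hY fun _ => c), nbarElt_mem _ _ _⟩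
    with he
  have hcont : Continuous e := by
    rw [IsEmbedding.subtypeVal.isInducing.continuous_iff,
      isClosedEmbedding_mat.isInducing.continuous_iff]
    refine continuous_matrix fun i j => ?_
    rcases i with (i | i) | i <;> rcases j with (j | j) | j
    · exact continuous_const
    · exact continuous_const
    · exact continuous_const
    · exact continuous_const.mul (continuous_id.mul continuous_id)
    · exact continuous_const
    · exact continuous_neg
    · exact continuous_id
    · exact continuous_const
    · exact continuous_const
  have h1 : e 0 = 1 := by
    refine Subtype.ext (mat_injective ?_)
    change nbarMat _ _ = _
    rw [OneMemClass.coe_one, mat_one]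
    ext i j
    rcases i with (i | i) | i <;> rcases j with (j | j) | j <;>
      simp [nbarMat, one_apply, vecMulVec_apply]
  have h2 : ∀ᶠ c in 𝓝 (0 : F), e c ∈ {u : Nbar F d | lineForm (u : G F d) = 0} := by
    have := hcont.tendsto 0
    rw [h1] at this
    exact this.eventually hmem
  have h3 : ∀ᶠ c in 𝓝 (0 : F), c = 0 := by
    filter_upwards [h2] with c hc
    exact congrFun hc ⟨0, hd⟩
  have h4 : ({0} : Set F) ∈ 𝓝 (0 : F) := h3
  exact (NormedField.nhdsNE_neBot (0 : F)).ne (by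
    rw [nhdsWithin, inf_principal_eq_bot, compl_compl]; exact h4)

/-- The kernel of the linear form is a null set, as a closed subgroup that is not open. -/
theorem measure_lineForm_eq_zero [LocallyCompactSpace F] [NeZero (2 : F)] (hd : 1 ≤ d)
    [MeasurableSpace (G F d)] [BorelSpace (G F d)] (μNbar : Measure (Nbar F d))
    [μNbar.IsHaarMeasure] : μNbar {u : Nbar F d | lineForm (u : G F d) = 0} = 0 := by
  by_contra h0
  have hmeas : MeasurableSet {u : Nbar F d | lineForm (u : G F d) = 0} :=
    ((isClosed_singleton (x := (0 : Fin d → F))).preimage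
      (continuous_lineForm.comp continuous_subtype_val)).measurableSet
  have h := Measure.div_mem_nhds_one_of_haar_pos μNbar _ hmeas (pos_iff_ne_zero.2 h0)
  refine lineForm_eq_zero_notMem_nhds hd (Filter.mem_of_superset h ?_)
  rintro w ⟨u, hu, v, hv, rfl⟩
  have h1 : lineForm ((u / v * v : Nbar F d) : G F d) =
      lineForm ((u / v : Nbar F d) : G F d) + lineForm (v : G F d) :=
    lineForm_mul_of_mem (u / v : Nbar F d).2 v.2
  have hu' : lineForm (u : G F d) = 0 := hu
  have hv' : lineForm (v : G F d) = 0 := hv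
  rw [div_mul_cancel, hu', hv', add_zero] at h1
  exact h1.symm

/-- The orbit is a countable union of compact sets. -/
theorem measurableSet_orbit [LocallyCompactSpace F] [MeasurableSpace (GL (Fin d) F)]
    [BorelSpace (GL (Fin d) F)] (b : GL (Fin d) F) : MeasurableSet (orbit b) := by
  have : orbit b = ⋃ n, (fun m => adM m b) '' compactCovering (GL (Fin d) F) n := by
    rw [← Set.image_iUnion, iUnion_compactCovering, Set.image_univ]
    rfl
  rw [this]
  exact MeasurableSet.iUnion fun n =>
    ((isCompact_compactCovering _ n).image (continuous_adM_left b)).measurableSet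

end Coordinates

/-! ### Comparison with the given orbit measure -/

section FormMeasureProperties

variable {F : Type*} [NontriviallyNormedField F] [LocallyCompactSpace F] [IsUltrametricDist F]
  {d : ℕ}
  [MeasurableSpace (GL (Fin d) F)] [BorelSpace (GL (Fin d) F)]
  [MeasurableSpace (G F d)] [BorelSpace (G F d)]
  (μN : Measure (N F d)) [μN.IsHaarMeasure] (μNbar : Measure (Nbar F d)) [μNbar.IsHaarMeasure]

theorem formMeasure_apply {s : Set (GL (Fin d) F)} (hs : MeasurableSet s) :
    formMeasure μN μNbar s =
      ∫⁻ u in {u : Nbar F d | (lowerLeft (u : G F d)).det ≠ 0},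
        ENNReal.ofReal (density μN μNbar u) * s.indicator 1 (formGL (u : G F d)) ∂μNbar := by
  rw [← lintegral_indicator_one hs, lintegral_formMeasure μN μNbar
    (f := s.indicator 1) (measurable_one.indicator hs)]

/-- A compact set of forms is attached to a bounded set of elements of the opposite unipotent
radical, on which the density is bounded. -/
instance : IsFiniteMeasureOnCompacts (formMeasure μN μNbar) where
  lt_top_of_isCompact := by
    intro K hK
    obtain ⟨M, hM⟩ := exists_norm_le_of_isCompact hK
    obtain ⟨C, hC⟩ := hK.exists_bound_of_continuousOn
      (continuous_modTilde_rpow μN μNbar (-(1 / 2))).continuousOn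
    have hB : IsCompact {u : Nbar F d | ∀ i j, ‖mat (u : G F d) i j‖ ≤ max 1 (2 * M)} :=
      isCompact_bounded isClosed_Nbar _
    have hmeas : MeasurableSet {u : Nbar F d | (lowerLeft (u : G F d)).det ≠ 0} :=
      isOpen_regular.measurableSet
    rw [formMeasure_apply μN μNbar hK.measurableSet]
    calc ∫⁻ u in {u : Nbar F d | (lowerLeft (u : G F d)).det ≠ 0},
          ENNReal.ofReal (density μN μNbar u) * K.indicator 1 (formGL (u : G F d)) ∂μNbar
        ≤ ∫⁻ u in {u : Nbar F d | (lowerLeft (u : G F d)).det ≠ 0},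
          Set.indicator {u : Nbar F d | ∀ i j, ‖mat (u : G F d) i j‖ ≤ max 1 (2 * M)}
            (fun _ => ENNReal.ofReal C) u ∂μNbar := by
          refine setLIntegral_mono' hmeas fun u hu => ?_
          by_cases huK : formGL (u : G F d) ∈ K
          · have h1 : u ∈ {u : Nbar F d | ∀ i j, ‖mat (u : G F d) i j‖ ≤ max 1 (2 * M)} := by
              refine norm_mat_le u.2 ?_
              rw [← formGL_val hu]
              exact hM _ huK
            rw [Set.indicator_of_mem huK, Set.indicator_of_mem h1, Pi.one_apply, mul_one]
            exact ENNReal.ofReal_le_ofReal ((le_abs_self _).trans (hC _ huK))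
          · rw [Set.indicator_of_notMem huK, mul_zero]
            exact zero_le
      _ ≤ ∫⁻ u, Set.indicator {u : Nbar F d | ∀ i j, ‖mat (u : G F d) i j‖ ≤ max 1 (2 * M)}
            (fun _ => ENNReal.ofReal C) u ∂μNbar := setLIntegral_le_lintegral _ _
      _ = ENNReal.ofReal C *
          μNbar {u : Nbar F d | ∀ i j, ‖mat (u : G F d) i j‖ ≤ max 1 (2 * M)} := by
        rw [lintegral_indicator_const hB.measurableSet]
      _ < ⊤ := ENNReal.mul_lt_top ENNReal.ofReal_lt_top hB.measure_lt_top

/-- For almost all `u` the linear form `l` is nonzero, and then the form attached to `u` has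
symmetric part `-l ⊗ l`, hence lies in the class of `b`. -/
theorem formMeasure_compl_orbit [NeZero (2 : F)] (hd : 1 ≤ d) {b : GL (Fin d) F}
    (hb : HasSymPart (-1) b) : formMeasure μN μNbar (orbit b)ᶜ = 0 := by
  rw [formMeasure_apply μN μNbar (measurableSet_orbit b).compl]
  have hmeas : MeasurableSet {u : Nbar F d | (lowerLeft (u : G F d)).det ≠ 0} :=
    isOpen_regular.measurableSet
  have hae : ∀ᵐ u : Nbar F d ∂μNbar, lineForm (u : G F d) ≠ 0 := by
    rw [ae_iff]
    simpa using measure_lineForm_eq_zero hd μNbar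
  rw [← lintegral_indicator hmeas]
  refine (lintegral_congr_ae ?_).trans lintegral_zero
  filter_upwards [hae] with u hu
  by_cases hdet : (lowerLeft (u : G F d)).det ≠ 0
  · have h1 : formGL (u : G F d) ∉ (orbit b)ᶜ :=
      not_not.2 (mem_orbit_of_hasSymPart hb (hasSymPart_formGL u.2 hdet hu))
    rw [Set.indicator_of_mem hdet, Set.indicator_of_notMem h1, mul_zero]
  · rw [Set.indicator_of_notMem hdet]

theorem formMeasure_ne_zero {b : GL (Fin d) F} (hb : HasSymPart (-1) b) :
    formMeasure μN μNbar ≠ 0 := by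
  intro h0
  have h1 : formMeasure μN μNbar Set.univ = 0 := by rw [h0]; simp
  rw [formMeasure_apply μN μNbar MeasurableSet.univ] at h1
  simp only [Set.indicator_univ, Pi.one_apply, mul_one] at h1
  rw [lintegral_eq_zero_iff (measurable_density μN μNbar).ennreal_ofReal] at h1
  obtain ⟨u, hu, -⟩ := exists_formGL_eq_of_hasSymPart hb
  have hpos := isOpen_regular.measure_pos μNbar ⟨u, hu⟩
  have h2 : ∀ᵐ u ∂(μNbar.restrict {u : Nbar F d | (lowerLeft (u : G F d)).det ≠ 0}), False := by
    filter_upwards [h1] with u hu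
    exact (ENNReal.ofReal_pos.2 (density_pos μN μNbar u)).ne' hu
  rw [ae_iff] at h2
  simp only [not_false_eq_true, Set.ofPred_true, Measure.restrict_apply_univ] at h2
  exact hpos.ne' h2

/-- The given measure on the class of `γ_{-1}` is proportional to the one coming from the opposite
unipotent radical. -/
theorem exists_orbitMeasure_eq_smul [NeZero (2 : F)] (hd : 1 ≤ d) {γ : Fˣ → GL (Fin d) F}
    (hγ : ∀ t, HasSymPart t (γ t)) {μ : Fˣ → Measure (GL (Fin d) F)} (hμ : IsOrbitMeasures γ μ) :
    ∃ c : ℝ, 0 < c ∧ μ (-1) = ENNReal.ofReal c • formMeasure μN μNbar := by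
  set b := γ (-1) with hb
  set κ := formMeasure μN μNbar with hκ
  have hκo := formMeasure_compl_orbit μN μNbar hd (hγ (-1))
  have hcov : ∀ n, IsCompact ((fun m => adM m b) '' compactCovering (GL (Fin d) F) n) := fun n =>
    (isCompact_compactCovering _ n).image (continuous_adM_left b)
  have hσ : SigmaFinite (μ (-1) + κ) := ⟨⟨{
    set := fun n => (orbit b)ᶜ ∪ (fun m => adM m b) '' compactCovering (GL (Fin d) F) n
    set_mem := fun _ => trivial
    finite := fun n => by
      refine lt_of_le_of_lt (measure_union_le _ _) ?_
      rw [Measure.add_apply, Measure.add_apply, hμ.compl_orbit, hκo, add_zero, zero_add]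
      refine ENNReal.add_lt_top.2 ⟨hμ.lt_top (-1) _ ?_ (hcov n), (hcov n).measure_lt_top⟩
      exact Set.image_subset_range _ _
    spanning := by
      rw [← Set.union_iUnion, ← Set.image_iUnion, iUnion_compactCovering, Set.image_univ]
      exact Set.compl_union_self _ }⟩⟩
  obtain ⟨c, hc0, hct, hc⟩ := exists_eq_smul_of_invariant (act := fun m b => adM m b)
    continuous_adM.measurable (fun g h x => adM_mul g h x) adM_one (μ (-1)) κ
    (hμ.invariant (-1)) (map_adM_formMeasure μN μNbar) b (hμ.compl_orbit (-1)) hκo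
    (hμ.ne_zero (-1)) (formMeasure_ne_zero μN μNbar (hγ (-1)))
  exact ⟨c.toReal, ENNReal.toReal_pos hc0 hct, by rw [ENNReal.ofReal_toReal hct]; exact hc⟩

end FormMeasureProperties

/-! ### Test functions on the open cell -/

section Scalars

variable {F : Type*} [NontriviallyNormedField F] {d : ℕ}

theorem continuous_scalar :
    Continuous (GeneralLinearGroup.scalar (Fin d) : Fˣ → GL (Fin d) F) := by
  have h : Continuous fun x : F => Matrix.scalar (Fin d) x := by
    simp only [scalar_apply]
    exact (continuous_pi fun _ => continuous_id).matrix_diagonal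
  rw [Units.continuous_iff]
  refine ⟨h.comp Units.continuous_val, ?_⟩
  have h2 : (fun a : Fˣ => ((GeneralLinearGroup.scalar (Fin d) a)⁻¹).1) =
      fun a : Fˣ => Matrix.scalar (Fin d) ((a⁻¹ : Fˣ) : F) := by
    ext1 a
    rw [← map_inv]
    rfl
  rw [show (fun a : Fˣ => ((GeneralLinearGroup.scalar (Fin d) a)⁻¹).1) = _ from h2]
  exact h.comp (Units.continuous_val.comp continuous_inv)

theorem norm_det_scalar (a : Fˣ) :
    ‖(GeneralLinearGroup.scalar (Fin d) a : Matrix (Fin d) (Fin d) F).det‖ = ‖(a : F)‖ ^ d := by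
  change ‖(Matrix.scalar (Fin d) (a : F)).det‖ = _
  simp [scalar_apply]

theorem rightA_val (a : Fˣ) (b : GL (Fin d) F) : (rightA a b).1 = (a : F) • b.1 := by
  rw [rightA_eq]
  change Matrix.scalar (Fin d) (a : F) * b.1 = _
  rw [scalar_apply, ← smul_eq_diagonal_mul]

theorem rightA_inv (a : Fˣ) (b : GL (Fin d) F) : (rightA a b)⁻¹ = rightA a⁻¹ b⁻¹ := by
  rw [inv_eq_iff_mul_eq_one]
  refine Units.ext ?_
  rw [Units.val_mul, rightA_val, rightA_val, smul_mul_smul_comm, ← Units.val_mul,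
    ← Units.val_mul, mul_inv_cancel, mul_inv_cancel, Units.val_one, Units.val_one, one_smul]

theorem rightA_mul (a a' : Fˣ) (b : GL (Fin d) F) : rightA (a * a') b = rightA a (rightA a' b) := by
  rw [rightA_eq, rightA_eq, rightA_eq, map_mul, mul_assoc]

theorem rightA_one (b : GL (Fin d) F) : rightA 1 b = b := by
  rw [rightA_eq, map_one, one_mul]

theorem continuous_rightA (a : Fˣ) : Continuous (rightA a : GL (Fin d) F → GL (Fin d) F) := by
  have : (rightA a : GL (Fin d) F → GL (Fin d) F) =
      fun b => GeneralLinearGroup.scalar (Fin d) a * b := funext (rightA_eq a)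
  rw [this]
  exact continuous_const.mul continuous_id

/-- Multiplication of forms by a square is the conjugation by a scalar. -/
theorem rightA_sq (a : Fˣ) (b : GL (Fin d) F) :
    rightA (a ^ 2) b = adM (GeneralLinearGroup.scalar (Fin d) a⁻¹) b := by
  have hcomm : ∀ x : GL (Fin d) F, x * GeneralLinearGroup.scalar (Fin d) a =
      GeneralLinearGroup.scalar (Fin d) a * x := fun x =>
    Units.ext (Matrix.scalar_commute (a : F) (fun r => Commute.all _ r) x.1).symm
  rw [rightA_eq, adM, biact, ← map_inv, inv_inv, transposeGL_scalar, hcomm, sq, map_mul, mul_assoc]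

theorem lowerLeft_scalar_mul (a : Fˣ) (g : G F d) :
    lowerLeft (levi (GeneralLinearGroup.scalar (Fin d) a) * g) =
      ((a⁻¹ : Fˣ) : F) • lowerLeft g := by
  rw [lowerLeft_levi_mul, ← map_inv]
  change (Matrix.scalar (Fin d) ((a⁻¹ : Fˣ) : F))ᵀ * _ = _
  rw [scalar_apply, diagonal_transpose, ← smul_eq_diagonal_mul]

theorem det_lowerLeft_scalar_mul_ne_zero_iff (a : Fˣ) (g : G F d) :
    (lowerLeft (levi (GeneralLinearGroup.scalar (Fin d) a) * g)).det ≠ 0 ↔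
      (lowerLeft g).det ≠ 0 := by
  rw [lowerLeft_scalar_mul, det_smul]
  simp

theorem formGL_scalar_mul (a : Fˣ) {g : G F d} (h : (lowerLeft g).det ≠ 0) :
    formGL (levi (GeneralLinearGroup.scalar (Fin d) a) * g) = rightA a⁻¹ (formGL g) := by
  refine Units.ext ?_
  rw [formGL_val ((det_lowerLeft_scalar_mul_ne_zero_iff a g).2 h), lowerLeft_scalar_mul,
    rightA_val, formGL_val h]

theorem formGL_embB_inv (b : GL (Fin d) F) : formGL (embB b)⁻¹ = b := by
  have h : lowerLeft (embB b)⁻¹ = b.1 := by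
    rw [← embB_transpose, lowerLeft_embB]
    exact transpose_transpose _
  refine Units.ext ?_
  rw [formGL_val (by rw [h]; exact b.det.ne_zero), h]

/-- The `V^*`-diagonal entry of `a u`, for `u` in the opposite unipotent radical. -/
theorem mat_scalar_mul_apply (a : Fˣ) {u : G F d} (hu : u ∈ Nbar F d) (i : Fin d) :
    mat (levi (GeneralLinearGroup.scalar (Fin d) a) * u) (.inl (.inr i)) (.inl (.inr i)) =
      ((a⁻¹ : Fˣ) : F) := by
  rw [mat_mul, mul_apply]
  simp only [apply_eq_of_mem_Nbar hu, mul_ite, mul_one, mul_zero, Finset.sum_ite_eq',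
    Finset.mem_univ, if_true]
  change ((GeneralLinearGroup.scalar (Fin d) a)⁻¹).1ᵀ i i = _
  rw [← map_inv]
  change (Matrix.scalar (Fin d) ((a⁻¹ : Fˣ) : F))ᵀ i i = _
  simp

end Scalars

section TestFunctions

variable {F : Type*} [NontriviallyNormedField F] {d : ℕ} {Φ : G F d → ℂ}

theorem IsTestFunG.isLocallyConstant (hΦ : IsTestFunG Φ) : IsLocallyConstant Φ := by
  obtain ⟨K, hK, -, hinv⟩ := hΦ.right_invariant
  apply isLocallyConstant_of_eventually_one
  filter_upwards [hK.mem_nhds K.one_mem] with k hk g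
  exact hinv k hk g

/-- A continuous left `N`-invariant function takes the support of `Φ` to a compact set. -/
theorem IsTestFunG.isCompact_image {X : Type*} [TopologicalSpace X] (hΦ : IsTestFunG Φ)
    {h : G F d → X} (hc : Continuous h) (hinv : ∀ u ∈ N F d, ∀ g, h (u * g) = h g) :
    IsCompact (h '' tsupport Φ) := by
  have hr : ∀ x y, (QuotientGroup.rightRel (N F d)).r x y → h x = h y := by
    intro x y hxy
    have h1 : y * x⁻¹ ∈ N F d := QuotientGroup.rightRel_apply.1 hxy
    rw [← hinv _ h1 x, inv_mul_cancel_right]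
  have h2 := hΦ.compact_image.image (hc.quotient_lift hr)
  rwa [Set.image_image] at h2

theorem IsTestFunG.exists_norm_le (hΦ : IsTestFunG Φ) : ∃ B, ∀ g, ‖Φ g‖ ≤ B := by
  obtain ⟨B, hB⟩ := (hΦ.isCompact_image hΦ.isLocallyConstant.continuous
    hΦ.left_invariant).isBounded.exists_norm_le
  refine ⟨max B 0, fun g => ?_⟩
  by_cases hg : Φ g = 0
  · rw [hg, norm_zero]; exact le_max_right _ _
  · exact (hB _ ⟨g, subset_tsupport _ hg, rfl⟩).trans (le_max_left _ _)

/-- The rows of `g` indexed by `V^*` are bounded on the support, as they only depend on `N g`. -/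
theorem IsTestFunG.exists_norm_row_le (hΦ : IsTestFunG Φ) (i : Fin d) (b : Idx d) :
    ∃ R, ∀ g, Φ g ≠ 0 → ‖mat g (.inl (.inr i)) b‖ ≤ R := by
  obtain ⟨B, hB⟩ := (hΦ.isCompact_image (continuous_mat_apply (.inl (.inr i)) b)
    fun u hu g => row_mul_of_mem_N hu g i b).isBounded.exists_norm_le
  exact ⟨B, fun g hg => hB _ ⟨g, subset_tsupport _ hg, rfl⟩⟩

theorem lowerLeft_det_ne_zero_of_mem_Gprime {g : G F d} (hg : g ∈ Gprime) :
    (lowerLeft g).det ≠ 0 := by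
  obtain ⟨u₁, hu₁, b, u₂, hu₂, rfl⟩ := hg
  rw [lowerLeft_mul_right hu₂, lowerLeft_mul_left hu₁, lowerLeft_embB, det_transpose]
  exact b.det.ne_zero

/-- The forms attached to the elements of the support make up a relatively compact set of
nondegenerate forms. -/
theorem IsTestFunG.exists_isCompact_forms (hΦ : IsTestFunG Φ) :
    ∃ K : Set (GL (Fin d) F), IsCompact K ∧
      ∀ g, Φ g ≠ 0 → (lowerLeft g).det ≠ 0 ∧ formGL g ∈ K := by
  have hC := hΦ.isCompact_image continuous_lowerLeft fun u hu g => lowerLeft_mul_left hu g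
  refine ⟨_, isCompact_GL hC ?_, fun g hg => ?_⟩
  · rintro A ⟨g, hg, rfl⟩
    exact lowerLeft_det_ne_zero_of_mem_Gprime (hΦ.support_subset hg)
  · have h1 := lowerLeft_det_ne_zero_of_mem_Gprime (hΦ.support_subset (subset_tsupport _ hg))
    refine ⟨h1, ?_⟩
    change (formGL g).1 ∈ lowerLeft '' tsupport Φ
    rw [formGL_val h1]
    exact ⟨g, subset_tsupport _ hg, rfl⟩

theorem norm_nElt_sub_one_lt [IsUltrametricDist F] {ε : ℝ} (hε : 0 < ε) {l : Fin d → F}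
    {Z : Matrix (Fin d) (Fin d) F} (h : Z + Zᵀ = -vecMulVec l l) (hl : ∀ i, ‖l i‖ < ε)
    (hZ : ∀ i j, ‖Z i j‖ < ε) (i j : Idx d) :
    ‖mat (nElt l Z h) i j - (1 : Matrix (Idx d) (Idx d) F) i j‖ < ε := by
  change ‖nMat l Z i j - _‖ < ε
  rcases i with (i | i) | i <;> rcases j with (j | j) | j <;>
    simp [nMat, one_apply, hε, hl, hZ]

/-- Far out along the centre, the right-hand factor in the Bruhat decomposition of `a u` is close
to the identity, as long as the form attached to `a u` stays in a compact set. -/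
theorem IsTestFunG.exists_eq_far (hΦ : IsTestFunG Φ) [IsUltrametricDist F] :
    ∃ R : ℝ, 0 < R ∧ ∀ a : Fˣ, R < ‖(a : F)‖ → ∀ u ∈ Nbar F d, (lowerLeft u).det ≠ 0 →
      Φ (levi (GeneralLinearGroup.scalar (Fin d) a) * u) =
        Φ (embB (rightA a⁻¹ (formGL u)))⁻¹ := by
  obtain ⟨K, hK, hΦK⟩ := hΦ.exists_isCompact_forms
  obtain ⟨U, hU, -, hinv⟩ := hΦ.right_invariant
  obtain ⟨ε, hε, hεU⟩ := exists_forall_norm_lt_mem (hU.mem_nhds U.one_mem)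
  obtain ⟨M₁, hM₁⟩ := exists_norm_le_of_isCompact hK
  obtain ⟨M₂, hM₂⟩ := exists_norm_le_of_isCompact (hK.image continuous_inv)
  set M := max 1 (max M₁ M₂) with hMdef
  have hM0 : 0 < M := lt_of_lt_of_le one_pos (le_max_left _ _)
  -- With `b = a⁻¹ y` in `K`, the coordinates `y⁻¹` and `y⁻¹ l` of the right-hand factor of `u` are
  -- at most `M / |a|` and `(2 M³ / |a|)^{1/2}`, since `|l|² ≤ 2 |a| M`.
  refine ⟨max (M / ε) (2 * M ^ 3 / ε ^ 2), lt_max_of_lt_left (by positivity),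
    fun a ha u hu hdet => ?_⟩
  obtain ⟨ha1, ha2⟩ := max_lt_iff.1 ha
  have ha0 : 0 < ‖(a : F)‖ := norm_pos_iff.2 a.ne_zero
  set y := formGL u with hy
  set b := rightA a⁻¹ y with hb
  by_cases hbK : b ∈ K
  swap
  · have h1 : Φ (levi (GeneralLinearGroup.scalar (Fin d) a) * u) = 0 := by
      by_contra h
      have h' := (hΦK _ h).2
      rw [formGL_scalar_mul a hdet] at h'
      exact hbK h'
    have h2 : Φ (embB b)⁻¹ = 0 := by
      by_contra h
      have h' := (hΦK _ h).2
      rw [formGL_embB_inv] at h'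
      exact hbK h'
    rw [h1, h2]
  have hyb : y = rightA a b := by rw [hb, ← rightA_mul, mul_inv_cancel, rightA_one]
  have hyinv : (y⁻¹).1 = ((a⁻¹ : Fˣ) : F) • (b⁻¹).1 := by
    rw [hyb, rightA_inv, rightA_val]
  have hbM : ∀ i j, ‖b.1 i j‖ ≤ M := fun i j =>
    (hM₁ b hbK i j).trans ((le_max_left _ _).trans (le_max_right _ _))
  have hbinvM : ∀ i j, ‖(b⁻¹).1 i j‖ ≤ M := fun i j =>
    (hM₂ b⁻¹ ⟨b, hbK, rfl⟩ i j).trans ((le_max_right _ _).trans (le_max_right _ _))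
  have hnorminv : ‖((a⁻¹ : Fˣ) : F)‖ = ‖(a : F)‖⁻¹ := by
    rw [Units.val_inv_eq_inv_val, norm_inv]
  have hyinvM : ∀ i j, ‖(y⁻¹).1 i j‖ ≤ ‖(a : F)‖⁻¹ * M := fun i j => by
    rw [hyinv, Matrix.smul_apply, norm_smul, hnorminv]
    exact mul_le_mul_of_nonneg_left (hbinvM i j) (by positivity)
  have hyM : ∀ i j, ‖lowerLeft u i j‖ ≤ ‖(a : F)‖ * M := fun i j => by
    rw [← formGL_val hdet, ← hy, hyb, rightA_val, Matrix.smul_apply, norm_smul]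
    exact mul_le_mul_of_nonneg_left (hbM i j) ha0.le
  have hl : ∀ i, ‖lineForm u i‖ ≤ Real.sqrt (2 * (‖(a : F)‖ * M)) := fun i =>
    Real.le_sqrt_of_sq_le (norm_lineForm_sq_le hu hyM i)
  obtain ⟨h, hn⟩ := mul_nElt_mul_embB_mem hu (formGL_val hdet)
  set n := nElt (-((y⁻¹).1 *ᵥ lineForm u)) (y⁻¹).1ᵀ h with hndef
  have hnU : n ∈ U := by
    refine hεU n fun i j => norm_nElt_sub_one_lt hε h (fun i => ?_) (fun i j => ?_) i j
    · rw [Pi.neg_apply, norm_neg]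
      have h1 : ‖((y⁻¹).1 *ᵥ lineForm u) i‖ ≤
          ‖(a : F)‖⁻¹ * M * Real.sqrt (2 * (‖(a : F)‖ * M)) := by
        change ‖∑ k, (y⁻¹).1 i k * lineForm u k‖ ≤ _
        refine IsUltrametricDist.norm_sum_le_of_forall_le_of_nonneg (by positivity) fun k _ => ?_
        rw [norm_mul]
        exact mul_le_mul (hyinvM i k) (hl k) (norm_nonneg _) (by positivity)
      refine h1.trans_lt (lt_of_pow_lt_pow_left₀ 2 hε.le ?_)
      rw [mul_pow, Real.sq_sqrt (by positivity)]
      rw [div_lt_iff₀ (by positivity)] at ha2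
      calc (‖(a : F)‖⁻¹ * M) ^ 2 * (2 * (‖(a : F)‖ * M)) = 2 * M ^ 3 * ‖(a : F)‖⁻¹ := by
            field_simp
        _ < ‖(a : F)‖ * ε ^ 2 * ‖(a : F)‖⁻¹ := by gcongr
        _ = ε ^ 2 := by field_simp
    · refine (hyinvM j i).trans_lt ?_
      rw [div_lt_iff₀ hε] at ha1
      rwa [inv_mul_lt_iff₀ ha0]
  set A := levi (GeneralLinearGroup.scalar (Fin d) a) with hA
  have hAy : (embB b)⁻¹ = A * (embB y)⁻¹ := by
    have h1 : embB b = embB y * A⁻¹ := by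
      rw [hA, ← levi_inv, embB_mul_levi, ← map_inv, transposeGL_scalar, hb, rightA_eq]
    rw [h1, _root_.mul_inv_rev, inv_inv]
  have hdecomp : A * u = (A * (u * n * embB y) * A⁻¹) * ((embB b)⁻¹ * n⁻¹) := by
    rw [hAy]
    group
  rw [hdecomp, hΦ.left_invariant _ ((levi_conj _ _).1 hn), hinv _ (U.inv_mem hnU)]

end TestFunctions

/-! ### Averages over square classes -/

section Average

variable {F : Type*} [NontriviallyNormedField F] [IsUltrametricDist F] [LocallyCompactSpace F]
  [CharZero F] [MeasurableSpace Fˣ] [BorelSpace Fˣ] (μA : Measure Fˣ) [μA.IsHaarMeasure]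

/-- The pole at `s = 0` only depends on the behaviour of the integrand near infinity: the part over
the annulus `r ≤ |a| ≤ R` is bounded, and is killed by the factor `1 - q^{-s}`. -/
theorem tendsto_integral_pole (hF : IsNormalizedAbs F) {d : ℕ} (hd : 1 ≤ d) {φ E : Fˣ → ℂ}
    (hφ : ∀ a b, φ (a * b ^ 2) = φ a) {r R C : ℝ} (hr : 0 < r) (hR : 0 < R)
    (hER : ∀ a : Fˣ, R < ‖(a : F)‖ → E a = φ a) (hEr : ∀ a : Fˣ, ‖(a : F)‖ < r → E a = 0)
    (hC : ∀ a, ‖E a‖ ≤ C)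
    (hint : ∀ s : ℝ, 0 < s →
      Integrable (fun a : Fˣ => E a * ((‖(a : F)‖ ^ d : ℝ) : ℂ) ^ (-(s : ℂ))) μA) :
    Tendsto (fun s : ℝ => ((1 - (residueCard F : ℝ) ^ (-s) : ℝ) : ℂ) *
        ∫ a, E a * ((‖(a : F)‖ ^ d : ℝ) : ℂ) ^ (-(s : ℂ)) ∂μA)
      (𝓝[>] 0) (𝓝 (((2 * d : ℝ)⁻¹ * μA.real (unitSquares F) : ℝ) *
        ∑ᶠ c : Fˣ ⧸ Subgroup.square Fˣ, φ c.out)) := by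
  have hq : (1 : ℝ) < residueCard F := by exact_mod_cast one_lt_residueCard hF
  have h1 := tendsto_setIntegral_pole μA hF hd hφ hR
  have hAmeas : MeasurableSet {a : Fˣ | R < ‖(a : F)‖} := measurableSet_norm_gt R
  set T : Set Fˣ := {a : Fˣ | r ≤ ‖(a : F)‖ ∧ ‖(a : F)‖ ≤ R} with hT
  have hTmeas : μA T < ⊤ := (isCompact_annulus hr).measure_lt_top
  have hC0 : 0 ≤ C := (norm_nonneg _).trans (hC 1)
  have hbound : ∀ᶠ s : ℝ in 𝓝[>] 0,
      ‖∫ a in {a : Fˣ | R < ‖(a : F)‖}ᶜ, E a * ((‖(a : F)‖ ^ d : ℝ) : ℂ) ^ (-(s : ℂ)) ∂μA‖ ≤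
        C * max 1 (r ^ d)⁻¹ * μA.real T := by
    filter_upwards [Ioo_mem_nhdsGT (one_pos : (0 : ℝ) < 1)] with s hs
    have hsub : ∫ a in {a : Fˣ | R < ‖(a : F)‖}ᶜ,
        E a * ((‖(a : F)‖ ^ d : ℝ) : ℂ) ^ (-(s : ℂ)) ∂μA =
        ∫ a in T, E a * ((‖(a : F)‖ ^ d : ℝ) : ℂ) ^ (-(s : ℂ)) ∂μA := by
      have hTsub : T ⊆ {a : Fˣ | R < ‖(a : F)‖}ᶜ := fun a ha => not_lt.2 ha.2
      refine setIntegral_eq_of_subset_of_forall_sdiff_eq_zero hAmeas.compl hTsub fun a ha => ?_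
      have : ‖(a : F)‖ < r := by
        by_contra! h
        exact ha.2 ⟨h, not_lt.1 ha.1⟩
      rw [hEr a this, zero_mul]
    rw [hsub]
    refine norm_setIntegral_le_of_norm_le_const hTmeas fun a ha => ?_
    rw [norm_mul, norm_pow_ofReal_cpow]
    refine mul_le_mul (hC a) ?_ (by positivity) hC0
    simp only [Complex.ofReal_re]
    rcases le_or_gt 1 ‖(a : F)‖ with h | h
    · exact (Real.rpow_le_one_of_one_le_of_nonpos (one_le_pow₀ h) (by linarith [hs.1])).trans
        (le_max_left _ _)
    · have ha0 : 0 < ‖(a : F)‖ ^ d := pow_pos (norm_pos_iff.2 a.ne_zero) d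
      refine le_trans ?_ (le_max_right _ _)
      calc (‖(a : F)‖ ^ d) ^ (-s) ≤ (‖(a : F)‖ ^ d) ^ (-1 : ℝ) :=
            Real.rpow_le_rpow_of_exponent_ge ha0 (pow_le_one₀ (norm_nonneg _) h.le)
              (by linarith [hs.2])
        _ = (‖(a : F)‖ ^ d)⁻¹ := Real.rpow_neg_one _
        _ ≤ (r ^ d)⁻¹ := inv_anti₀ (by positivity) (pow_le_pow_left₀ hr.le ha.1 d)
  have h2 : Tendsto (fun s : ℝ => ((1 - (residueCard F : ℝ) ^ (-s) : ℝ) : ℂ)) (𝓝[>] 0) (𝓝 0) := by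
    have hc : Continuous fun s : ℝ => ((1 - (residueCard F : ℝ) ^ (-s) : ℝ) : ℂ) :=
      Complex.continuous_ofReal.comp (continuous_const.sub
        (Real.continuous_const_rpow (by positivity) |>.comp continuous_neg))
    have := hc.tendsto 0
    simp only [neg_zero, Real.rpow_zero, sub_self, Complex.ofReal_zero] at this
    exact this.mono_left nhdsWithin_le_nhds
  have h3 : Tendsto (fun s : ℝ => ((1 - (residueCard F : ℝ) ^ (-s) : ℝ) : ℂ) *
      ∫ a in {a : Fˣ | R < ‖(a : F)‖}ᶜ, E a * ((‖(a : F)‖ ^ d : ℝ) : ℂ) ^ (-(s : ℂ)) ∂μA)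
      (𝓝[>] 0) (𝓝 0) :=
    h2.zero_mul_isBoundedUnder_le (isBoundedUnder_of_eventually_le hbound)
  have h4 := h1.add h3
  rw [add_zero] at h4
  refine h4.congr' ?_
  filter_upwards [self_mem_nhdsWithin] with s hs
  rw [← integral_add_compl hAmeas (hint s hs), mul_add]
  congr 2
  exact setIntegral_congr_fun hAmeas fun a ha => by
    rw [hER a ha]

end Average

/-! ### The intertwining integral -/

section Intertwining

variable {F : Type*} [NontriviallyNormedField F] {d : ℕ}
  [MeasurableSpace (G F d)] [BorelSpace (G F d)]
  (μN : Measure (N F d)) [μN.IsHaarMeasure] {Φ : G F d → ℂ}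

/-- The factor `δ(a)^{-1/2}`. -/
def centralWeight (a : Fˣ) : ℝ := modP μN (GeneralLinearGroup.scalar (Fin d) a) ^ (-(1 / 2) : ℝ)

theorem centralWeight_pos (a : Fˣ) : 0 < centralWeight μN a :=
  Real.rpow_pos_of_pos (modP_pos μN _) _

/-- The function of `u` and `a` whose integral over the centre, against `χ(a)|det a|^{-s}`, is the
convenient section at `u`. -/
def centralTranslate (Φ : G F d → ℂ) (a : Fˣ) (u : Nbar F d) : ℂ :=
  Φ (levi (GeneralLinearGroup.scalar (Fin d) a) * u) * (centralWeight μN a : ℂ)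

/-- Translates by central elements near zero are supported away from the opposite unipotent
radical, since `a u` has the diagonal entry `a⁻¹`. -/
theorem IsTestFunG.exists_eq_zero_near (hΦ : IsTestFunG Φ) (hd : 1 ≤ d) :
    ∃ r : ℝ, 0 < r ∧ ∀ a : Fˣ, ‖(a : F)‖ < r → ∀ u : Nbar F d, centralTranslate μN Φ a u = 0 := by
  obtain ⟨R, hR⟩ := hΦ.exists_norm_row_le ⟨0, hd⟩ (.inl (.inr ⟨0, hd⟩))
  refine ⟨(max R 1)⁻¹, by positivity, fun a ha u => ?_⟩
  rw [centralTranslate, mul_eq_zero]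
  left
  by_contra h
  have h1 := hR _ h
  rw [mat_scalar_mul_apply a u.2, Units.val_inv_eq_inv_val, norm_inv] at h1
  have ha0 : 0 < ‖(a : F)‖ := norm_pos_iff.2 a.ne_zero
  have h2 := (inv_lt_inv₀ (by positivity) ha0).2 ha
  rw [inv_inv] at h2
  exact absurd (h1.trans (le_max_left _ _)) (not_le.2 h2)

variable [LocallyCompactSpace F] (μNbar : Measure (Nbar F d)) [μNbar.IsHaarMeasure]

/-- The factor `δ(a)^{-1/2}` splits into the density at `u` and the factor `δ̃^{1/2}` at the form
attached to `a u`, because `δ̃(a⁻¹ B) = δ̃(B) δ(a)⁻¹`. -/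
theorem centralWeight_eq (a : Fˣ) (u : Nbar F d) :
    centralWeight μN a =
      density μN μNbar u * modTilde μN μNbar (rightA a⁻¹ (formGL (u : G F d))) ^ (1 / 2 : ℝ) := by
  have h1 := modTilde_pos μN μNbar (formGL (u : G F d))
  have h2 := modP_pos μN (GeneralLinearGroup.scalar (Fin d) a)
  rw [modTilde_rightA, map_inv, modP_inv, Real.mul_rpow h1.le (inv_pos.2 h2).le, density,
    ← mul_assoc, ← Real.rpow_add h1, centralWeight, Real.inv_rpow h2.le, Real.rpow_neg h2.le]
  norm_num

variable [IsUltrametricDist F]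

theorem continuous_centralWeight : Continuous (centralWeight μN) :=
  ((isLocallyConstant_modP μN).comp fun x : ℝ => x ^ (-(1 / 2) : ℝ)).continuous.comp
    continuous_scalar

theorem IsTestFunG.continuous_centralTranslate (hΦ : IsTestFunG Φ) :
    Continuous fun p : Nbar F d × Fˣ => centralTranslate μN Φ p.2 p.1 := by
  refine (hΦ.isLocallyConstant.continuous.comp ?_).mul
    (Complex.continuous_ofReal.comp ((continuous_centralWeight μN).comp continuous_snd))
  exact ((continuous_levi.comp continuous_scalar).comp continuous_snd).mul
    (continuous_subtype_val.comp continuous_fst)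

variable [MeasurableSpace (GL (Fin d) F)] [BorelSpace (GL (Fin d) F)]

theorem map_rightA_sq_formMeasure (a : Fˣ) :
    (formMeasure μN μNbar).map (rightA (a ^ 2)) = formMeasure μN μNbar := by
  rw [funext (rightA_sq (d := d) a), map_adM_formMeasure]

/-- The integrals of the translates are bounded uniformly in `a`: they are at most a constant times
the volume, for an invariant measure, of the forms `B` such that `a⁻¹ B` lies in a fixed compact
set. -/
theorem IsTestFunG.exists_lintegral_le (hF : IsNormalizedAbs F) [CharZero F]
    (hΦ : IsTestFunG Φ) :
    ∃ C : ℝ, 0 ≤ C ∧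
      ∀ a, ∫⁻ u, ‖centralTranslate μN Φ a u‖ₑ ∂μNbar ≤ ENNReal.ofReal C := by
  obtain ⟨K, hK, hΦK⟩ := hΦ.exists_isCompact_forms
  obtain ⟨B, hB⟩ := hΦ.exists_norm_le
  obtain ⟨D, hD⟩ := hK.exists_bound_of_continuousOn
    (continuous_modTilde_rpow μN μNbar (1 / 2)).continuousOn
  have hB0 : 0 ≤ B := (norm_nonneg _).trans (hB 1)
  -- The volume of the forms that are brought into `K` by `a⁻¹` only depends on the square class.
  set v : Fˣ → ENNReal := fun a => formMeasure μN μNbar (rightA a⁻¹ ⁻¹' K) with hv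
  have hvfin : ∀ a, v a < ⊤ := fun a => by
    have : rightA a⁻¹ ⁻¹' K = rightA a '' K := by
      ext b
      refine ⟨fun hb => ⟨_, hb, ?_⟩, ?_⟩
      · rw [← rightA_mul, mul_inv_cancel, rightA_one]
      · rintro ⟨b, hb, rfl⟩
        rwa [Set.mem_preimage, ← rightA_mul, inv_mul_cancel, rightA_one]
    rw [hv]
    simp only [this]
    exact (hK.image (continuous_rightA a)).measure_lt_top
  have hvsq : ∀ a b, v (a * b ^ 2) = v a := fun a b => by
    have h1 : (rightA (a * b ^ 2)⁻¹ : GL (Fin d) F → GL (Fin d) F) ⁻¹' K =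
        rightA (b⁻¹ ^ 2) ⁻¹' (rightA a⁻¹ ⁻¹' K) := by
      ext x
      rw [Set.mem_preimage, Set.mem_preimage, Set.mem_preimage, ← rightA_mul, _root_.mul_inv,
        inv_pow]
    rw [hv]
    simp only [h1]
    rw [← Measure.map_apply (continuous_rightA _).measurable
      ((continuous_rightA _).measurable hK.measurableSet), map_rightA_sq_formMeasure]
  obtain ⟨C, hC⟩ := bounded_of_square_invariant hF (φ := fun a => ((v a).toReal : ℂ))
    fun a b => by simp only [hvsq]
  have hC0 : 0 ≤ C := (norm_nonneg _).trans (hC 1)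
  have hvC : ∀ a, v a ≤ ENNReal.ofReal C := fun a => by
    have := hC a
    rw [Complex.norm_real, Real.norm_of_nonneg ENNReal.toReal_nonneg] at this
    exact ENNReal.le_ofReal_iff_toReal_le (hvfin a).ne hC0 |>.2 this
  have hD' : ∀ b ∈ K, modTilde μN μNbar b ^ (1 / 2 : ℝ) ≤ max D 0 := fun b hb =>
    (le_abs_self _).trans ((hD b hb).trans (le_max_left _ _))
  refine ⟨B * max D 0 * C, by positivity, fun a => ?_⟩
  have hpt : ∀ u : Nbar F d, ‖centralTranslate μN Φ a u‖ₑ ≤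
      ENNReal.ofReal (B * max D 0) *
        {u : Nbar F d | (lowerLeft (u : G F d)).det ≠ 0}.indicator
          (fun u => ENNReal.ofReal (density μN μNbar u) *
            (rightA a⁻¹ ⁻¹' K).indicator 1 (formGL (u : G F d))) u := fun u => by
    by_cases h : Φ (levi (GeneralLinearGroup.scalar (Fin d) a) * u) = 0
    · rw [centralTranslate, h, zero_mul, enorm_zero]
      exact zero_le
    obtain ⟨h1, h2⟩ := hΦK _ h
    rw [det_lowerLeft_scalar_mul_ne_zero_iff] at h1
    rw [formGL_scalar_mul a h1] at h2
    rw [Set.indicator_of_mem (by exact h1), Set.indicator_of_mem (by exact h2), Pi.one_apply,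
      mul_one, ← ENNReal.ofReal_mul (by positivity), ← ofReal_norm]
    refine ENNReal.ofReal_le_ofReal ?_
    have hden := density_pos μN μNbar u
    rw [centralTranslate, norm_mul, Complex.norm_real,
      Real.norm_of_nonneg (centralWeight_pos μN a).le, centralWeight_eq μN μNbar a u]
    calc ‖Φ _‖ * (density μN μNbar u * modTilde μN μNbar (rightA a⁻¹ (formGL (u : G F d))) ^
          (1 / 2 : ℝ)) ≤ B * (density μN μNbar u * max D 0) := by
          refine mul_le_mul (hB _) (mul_le_mul_of_nonneg_left (hD' _ h2) hden.le) ?_ hB0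
          exact mul_nonneg hden.le (Real.rpow_nonneg (modTilde_pos μN μNbar _).le _)
      _ = B * max D 0 * density μN μNbar u := by ring
  have hreg : MeasurableSet {u : Nbar F d | (lowerLeft (u : G F d)).det ≠ 0} :=
    isOpen_regular.measurableSet
  calc ∫⁻ u, ‖centralTranslate μN Φ a u‖ₑ ∂μNbar
      ≤ ∫⁻ u, ENNReal.ofReal (B * max D 0) *
        {u : Nbar F d | (lowerLeft (u : G F d)).det ≠ 0}.indicator
          (fun u => ENNReal.ofReal (density μN μNbar u) *
            (rightA a⁻¹ ⁻¹' K).indicator 1 (formGL (u : G F d))) u ∂μNbar := lintegral_mono hpt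
    _ = ENNReal.ofReal (B * max D 0) * v a := by
        rw [lintegral_const_mul' _ _ ENNReal.ofReal_ne_top, lintegral_indicator hreg,
          ← formMeasure_apply μN μNbar ((continuous_rightA _).measurable hK.measurableSet)]
    _ ≤ ENNReal.ofReal (B * max D 0) * ENNReal.ofReal C := by gcongr; exact hvC a
    _ = ENNReal.ofReal (B * max D 0 * C) := (ENNReal.ofReal_mul (by positivity)).symm

/-- For `a` near infinity the integral of the translate of `Φ` over the opposite unipotent radical
is the integral of the translate of `f` by `a⁻¹` against the invariant measure on forms. -/
theorem IsTestFunG.integral_centralTranslate_eq (hΦ : IsTestFunG Φ) {f : GL (Fin d) F → ℂ}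
    (hf : Measurable f)
    (hfΦ : ∀ b, f b = ((modTilde μN μNbar b ^ (1 / 2 : ℝ) : ℝ) : ℂ) * Φ (embB b)⁻¹) :
    ∃ R : ℝ, 0 < R ∧ ∀ a : Fˣ, R < ‖(a : F)‖ →
      ∫ u, centralTranslate μN Φ a u ∂μNbar =
        ∫ b, f (rightA a⁻¹ b) ∂formMeasure μN μNbar := by
  obtain ⟨R, hR0, hR⟩ := hΦ.exists_eq_far
  obtain ⟨K, -, hΦK⟩ := hΦ.exists_isCompact_forms
  refine ⟨R, hR0, fun a ha => ?_⟩
  rw [integral_formMeasure μN μNbar (f := fun b => f (rightA a⁻¹ b))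
    (hf.comp (continuous_rightA _).measurable)]
  have hreg : MeasurableSet {u : Nbar F d | (lowerLeft (u : G F d)).det ≠ 0} :=
    isOpen_regular.measurableSet
  rw [← setIntegral_eq_integral_of_forall_compl_eq_zero
    (s := {u : Nbar F d | (lowerLeft (u : G F d)).det ≠ 0})]
  · refine setIntegral_congr_fun hreg fun u hu => ?_
    change _ * _ = _ * f _
    rw [hR a ha u u.2 hu, hfΦ, centralWeight_eq μN μNbar a u]
    push_cast
    ring
  · intro u hu
    rw [centralTranslate, mul_eq_zero]
    left
    by_contra h
    exact hu ((det_lowerLeft_scalar_mul_ne_zero_iff a _).1 (hΦK _ h).1)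

end Intertwining

/-! ### Orbital integrals -/

section OrbitalIntegrals

variable {F : Type*} [NontriviallyNormedField F] {d : ℕ} [MeasurableSpace (GL (Fin d) F)]
  {γ : Fˣ → GL (Fin d) F} {μ : Fˣ → Measure (GL (Fin d) F)}

/-- The measure `d_t` only depends on the square class of `t`, since multiplication by `b²` is the
conjugation by a scalar. -/
theorem IsOrbitMeasures.mul_sq (hμ : IsOrbitMeasures γ μ) (t b : Fˣ) : μ (t * b ^ 2) = μ t := by
  rw [mul_comm, ← hμ.map_rightA, funext (rightA_sq (d := d) b), hμ.invariant]

/-- Substituting `-t` for `t` in the sum that defines `I_χ`. -/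
theorem IsOrbitMeasures.finsum_squareClasses_eq (hμ : IsOrbitMeasures γ μ) (χ : Fˣ →* ℤˣ)
    (f : GL (Fin d) F → ℂ) :
    ∑ᶠ c : Fˣ ⧸ Subgroup.square Fˣ, ((χ c.out : ℤ) : ℂ) * orbInt (μ (-c.out)) f = Ichi μ χ f := by
  set φ : Fˣ → ℂ := fun a => ((χ a : ℤ) : ℂ) * orbInt (μ (-a)) f with hφdef
  have hφ : ∀ a b, φ (a * b ^ 2) = φ a := fun a b => by
    simp only [hφdef, map_mul, map_pow, Int.units_sq, mul_one, ← neg_mul, hμ.mul_sq]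
  rw [Ichi, ← finsum_comp_equiv (Equiv.mulLeft (QuotientGroup.mk (s := Subgroup.square Fˣ) (-1)))]
  refine finsum_congr fun c => ?_
  have h : QuotientGroup.mk (s := Subgroup.square Fˣ) (-1) * c =
      QuotientGroup.mk (s := Subgroup.square Fˣ) (-c.out) := by
    conv_lhs => rw [← Quotient.out_eq' c]
    change QuotientGroup.mk (-1 * c.out) = _
    rw [neg_one_mul]
  simp only [Equiv.coe_mulLeft]
  rw [h]
  change φ _ = _
  rw [apply_out_of_square_invariant hφ, hφdef]
  simp

variable [BorelSpace (GL (Fin d) F)]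

theorem IsOrbitMeasures.orbInt_neg (hμ : IsOrbitMeasures γ μ) {f : GL (Fin d) F → ℂ}
    (hf : Measurable f) (a : Fˣ) : orbInt (μ (-a)) f = ∫ b, f (rightA a⁻¹ b) ∂μ (-1) := by
  rw [orbInt, ← hμ.mul_sq (-a) a⁻¹, show -a * a⁻¹ ^ 2 = a⁻¹ * -1 by rw [sq]; simp,
    ← hμ.map_rightA, integral_map (continuous_rightA _).measurable.aemeasurable
      hf.aestronglyMeasurable]

variable [LocallyCompactSpace F] [IsUltrametricDist F]
  [MeasurableSpace (G F d)] [BorelSpace (G F d)]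
  {μN : Measure (N F d)} [μN.IsHaarMeasure] {μNbar : Measure (Nbar F d)} [μNbar.IsHaarMeasure]

/-- Convergence of the orbital integrals: the measure on the class of `γ_{-1}` is locally finite on
the whole space of nondegenerate forms, and the other ones are translates of it. -/
theorem IsOrbitMeasures.integrable (hμ : IsOrbitMeasures γ μ) {c : ℝ}
    (hc : μ (-1) = ENNReal.ofReal c • formMeasure μN μNbar) {f : GL (Fin d) F → ℂ}
    (hf : IsTestFun f) (t : Fˣ) : Integrable f (μ t) := by
  have h1 : μ t = (μ (-1)).map (rightA (-t)) := by rw [hμ.map_rightA]; simp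
  have hm : Measurable (rightA (-t) : GL (Fin d) F → GL (Fin d) F) :=
    (continuous_rightA _).measurable
  rw [h1, integrable_map_measure hf.1.continuous.measurable.aestronglyMeasurable hm.aemeasurable,
    hc]
  refine Integrable.smul_measure ?_ ENNReal.ofReal_ne_top
  refine Continuous.integrable_of_hasCompactSupport (hf.1.continuous.comp (continuous_rightA _)) ?_
  have h2 : (rightA (-t) : GL (Fin d) F → GL (Fin d) F) =
      Homeomorph.mulLeft (GeneralLinearGroup.scalar (Fin d) (-t)) := funext (rightA_eq _)
  rw [h2]
  exact hf.2.comp_homeomorph _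

end OrbitalIntegrals

/-! ### Convergence and the pole of the intertwining integral -/

section Characters

variable {F : Type*} [NontriviallyNormedField F]

theorem norm_quadraticCharacter (χ : Fˣ →* ℤˣ) (a : Fˣ) : ‖((χ a : ℤ) : ℂ)‖ = 1 := by
  rcases Int.units_eq_one_or (χ a) with h | h <;> simp [h]

theorem continuous_quadraticCharacter [LocallyCompactSpace F] [CharZero F] (χ : Fˣ →* ℤˣ) :
    Continuous fun a : Fˣ => ((χ a : ℤ) : ℂ) :=
  (isLocallyConstant_of_square_invariant (φ := fun a => ((χ a : ℤ) : ℂ)) fun a b => by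
    simp only [map_mul, map_pow, Int.units_sq, mul_one]).continuous

end Characters

section Pole

variable {F : Type*} [NontriviallyNormedField F] {d : ℕ}
  [MeasurableSpace (G F d)] [BorelSpace (G F d)] (μN : Measure (N F d)) [μN.IsHaarMeasure]
  {Φ : G F d → ℂ}

/-- The integrand of the double integral over the opposite unipotent radical and the centre. -/
def doubleIntegrand (χ : Fˣ →* ℤˣ) (Φ : G F d → ℂ) (s : ℂ) (p : Nbar F d × Fˣ) : ℂ :=
  centralTranslate μN Φ p.2 p.1 *
    (((χ p.2 : ℤ) : ℂ) * ((‖(p.2 : F)‖ ^ d : ℝ) : ℂ) ^ (-s))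

theorem norm_doubleIntegrand (χ : Fˣ →* ℤˣ) (Φ : G F d → ℂ) (s : ℂ) (u : Nbar F d) (a : Fˣ) :
    ‖doubleIntegrand μN χ Φ s (u, a)‖ =
      ‖centralTranslate μN Φ a u‖ * (‖(a : F)‖ ^ d) ^ (-s.re) := by
  rw [doubleIntegrand, norm_mul, norm_mul, norm_quadraticCharacter, one_mul, norm_pow_ofReal_cpow]

theorem convSection_eq [MeasurableSpace Fˣ] (μA : Measure Fˣ) (χ : Fˣ →* ℤˣ) (Φ : G F d → ℂ)
    (s : ℂ) (u : Nbar F d) :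
    convSection μA μN χ Φ s u = ∫ a, doubleIntegrand μN χ Φ s (u, a) ∂μA := by
  refine integral_congr_ae (Eventually.of_forall fun a => ?_)
  simp only [doubleIntegrand, centralTranslate, centralWeight, ← norm_det_scalar (d := d) a]
  ring

variable [IsUltrametricDist F] [LocallyCompactSpace F] [CharZero F]

theorem IsTestFunG.continuous_doubleIntegrand (hΦ : IsTestFunG Φ) (χ : Fˣ →* ℤˣ) (s : ℂ) :
    Continuous (doubleIntegrand μN χ Φ s) := by
  have h1 : Continuous fun a : Fˣ => ((‖(a : F)‖ ^ d : ℝ) : ℂ) ^ (-s) :=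
    (continuous_norm_cpow d).comp (Continuous.prodMk_right s)
  have h2 : Continuous fun a : Fˣ => ((χ a : ℤ) : ℂ) * ((‖(a : F)‖ ^ d : ℝ) : ℂ) ^ (-s) :=
    (continuous_quadraticCharacter χ).mul h1
  exact (hΦ.continuous_centralTranslate μN).mul (h2.comp continuous_snd)

variable [MeasurableSpace Fˣ] [BorelSpace Fˣ]
  [MeasurableSpace (GL (Fin d) F)] [BorelSpace (GL (Fin d) F)]
  (μA : Measure Fˣ) [μA.IsHaarMeasure] (μNbar : Measure (Nbar F d)) [μNbar.IsHaarMeasure]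

/-- The double integral converges absolutely for `Re s > 0`: the inner integrals are bounded, and
they vanish for small `a`. -/
theorem IsTestFunG.integrable_doubleIntegrand (hF : IsNormalizedAbs F) (hd : 1 ≤ d)
    (hΦ : IsTestFunG Φ) (χ : Fˣ →* ℤˣ) {s : ℂ} (hs : 0 < s.re) :
    Integrable (doubleIntegrand μN χ Φ s) (μNbar.prod μA) := by
  have := secondCountableTopology_field (F := F)
  have : SecondCountableTopology Fˣ := secondCountableTopology_units
  have : LocallyCompactSpace Fˣ := locallyCompactSpace_units
  obtain ⟨C, hC0, hC⟩ := hΦ.exists_lintegral_le μN μNbar hF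
  obtain ⟨r, hr0, hr⟩ := hΦ.exists_eq_zero_near μN hd
  have hmeas : AEStronglyMeasurable (doubleIntegrand μN χ Φ s) (μNbar.prod μA) :=
    (hΦ.continuous_doubleIntegrand μN χ s).aestronglyMeasurable
  have hslice : ∀ a, Integrable (fun u => centralTranslate μN Φ a u) μNbar := fun a =>
    ⟨((hΦ.continuous_centralTranslate μN).comp (Continuous.prodMk_left a)).aestronglyMeasurable,
      (hC a).trans_lt ENNReal.ofReal_lt_top⟩
  have hnorm : ∀ a, ∫ u, ‖centralTranslate μN Φ a u‖ ∂μNbar ≤ C := fun a => by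
    rw [integral_norm_eq_lintegral_enorm (hslice a).1]
    exact ENNReal.toReal_le_of_le_ofReal hC0 (hC a)
  rw [integrable_prod_iff' hmeas]
  refine ⟨Eventually.of_forall fun a => ?_, ?_⟩
  · exact (hslice a).mul_const (((χ a : ℤ) : ℂ) * ((‖(a : F)‖ ^ d : ℝ) : ℂ) ^ (-s))
  have hbd : IntegrableOn (fun a : Fˣ => C * (‖(a : F)‖ ^ d) ^ (-s.re))
      {a | r / 2 < ‖(a : F)‖} μA :=
    (integrableOn_norm_rpow μA hF hd hs (half_pos hr0)).const_mul C
  rw [← integrable_indicator_iff (measurableSet_norm_gt _)] at hbd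
  refine Integrable.mono' hbd hmeas.norm.prod_swap.integral_prod_right'
    (Eventually.of_forall fun a => ?_)
  rw [Real.norm_of_nonneg (integral_nonneg fun _ => norm_nonneg _)]
  simp only [norm_doubleIntegrand]
  rw [integral_mul_const]
  by_cases ha : r / 2 < ‖(a : F)‖
  · rw [Set.indicator_of_mem (by exact ha)]
    exact mul_le_mul_of_nonneg_right (hnorm a) (by positivity)
  · rw [Set.indicator_of_notMem (by exact ha)]
    simp only [hr a (by linarith), norm_zero, integral_zero, zero_mul, le_refl]

/-- The intertwining integral has at most a simple pole at `s = 0`, with residue proportional to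
`I_χ(f)`. -/
theorem IsTestFunG.tendsto_integral_convSection (hF : IsNormalizedAbs F) (hd : 1 ≤ d)
    (hΦ : IsTestFunG Φ) {γ : Fˣ → GL (Fin d) F} {μ : Fˣ → Measure (GL (Fin d) F)}
    (hμ : IsOrbitMeasures γ μ) {c : ℝ} (hc : 0 < c)
    (hcμ : μ (-1) = ENNReal.ofReal c • formMeasure μN μNbar) (χ : Fˣ →* ℤˣ)
    {f : GL (Fin d) F → ℂ} (hf : Measurable f)
    (hfΦ : ∀ b, f b = ((modTilde μN μNbar b ^ (1 / 2 : ℝ) : ℝ) : ℂ) * Φ (embB b)⁻¹) :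
    Tendsto (fun s : ℝ => ((1 - (residueCard F : ℝ) ^ (-s) : ℝ) : ℂ) *
        ∫ u : Nbar F d, convSection μA μN χ Φ (s : ℂ) u ∂μNbar) (𝓝[>] 0)
      (𝓝 (((2 * d : ℝ)⁻¹ * μA.real (unitSquares F) * c⁻¹ : ℝ) * Ichi μ χ f)) := by
  have := secondCountableTopology_field (F := F)
  have : SecondCountableTopology Fˣ := secondCountableTopology_units
  have : LocallyCompactSpace Fˣ := locallyCompactSpace_units
  obtain ⟨C, hC0, hC⟩ := hΦ.exists_lintegral_le μN μNbar hF
  obtain ⟨r, hr0, hr⟩ := hΦ.exists_eq_zero_near μN hd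
  obtain ⟨R, hR0, hR⟩ := hΦ.integral_centralTranslate_eq μN μNbar hf hfΦ
  -- `E` is the inner integral times `χ`; at infinity it agrees with the function `φ` of the square
  -- class.
  set E : Fˣ → ℂ := fun a => (∫ u, centralTranslate μN Φ a u ∂μNbar) * ((χ a : ℤ) : ℂ) with hE
  set φ : Fˣ → ℂ := fun a => (c : ℂ)⁻¹ * (((χ a : ℤ) : ℂ) * orbInt (μ (-a)) f) with hφdef
  have hφ : ∀ a b, φ (a * b ^ 2) = φ a := fun a b => by
    simp only [hφdef, map_mul, map_pow, Int.units_sq, mul_one, ← neg_mul, hμ.mul_sq]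
  have hER : ∀ a : Fˣ, R < ‖(a : F)‖ → E a = φ a := fun a ha => by
    rw [hE, hφdef]
    simp only
    rw [hR a ha, hμ.orbInt_neg hf, hcμ, integral_smul_measure, ENNReal.toReal_ofReal hc.le,
      Complex.real_smul]
    have : (c : ℂ) ≠ 0 := by exact_mod_cast hc.ne'
    field_simp
  have hEr : ∀ a : Fˣ, ‖(a : F)‖ < r → E a = 0 := fun a ha => by
    simp only [hE, hr a ha, integral_zero, zero_mul]
  have hEC : ∀ a, ‖E a‖ ≤ C := fun a => by
    rw [hE, norm_mul, norm_quadraticCharacter, mul_one]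
    refine (norm_integral_le_lintegral_norm _).trans ?_
    simp only [ofReal_norm]
    exact ENNReal.toReal_le_of_le_ofReal hC0 (hC a)
  have hinner : ∀ (s : ℂ) (a : Fˣ), ∫ u, doubleIntegrand μN χ Φ s (u, a) ∂μNbar =
      E a * ((‖(a : F)‖ ^ d : ℝ) : ℂ) ^ (-s) := fun s a => by
    simp only [doubleIntegrand]
    rw [integral_mul_const, hE, mul_assoc]
  have hint : ∀ s : ℝ, 0 < s →
      Integrable (fun a : Fˣ => E a * ((‖(a : F)‖ ^ d : ℝ) : ℂ) ^ (-(s : ℂ))) μA := fun s hs => by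
    have h := (hΦ.integrable_doubleIntegrand μN μA μNbar hF hd χ
      (s := s) (by simpa using hs)).integral_prod_right
    simpa only [hinner] using h
  have h := tendsto_integral_pole μA hF hd hφ hr0 hR0 hER hEr hEC hint
  have hsum : ∑ᶠ c : Fˣ ⧸ Subgroup.square Fˣ, φ c.out = (c : ℂ)⁻¹ * Ichi μ χ f := by
    rw [← hμ.finsum_squareClasses_eq, mul_finsum]
  rw [hsum] at h
  have hconst : (((2 * d : ℝ)⁻¹ * μA.real (unitSquares F) * c⁻¹ : ℝ) : ℂ) * Ichi μ χ f =
      (((2 * d : ℝ)⁻¹ * μA.real (unitSquares F) : ℝ) : ℂ) * ((c : ℂ)⁻¹ * Ichi μ χ f) := by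
    push_cast
    ring
  rw [hconst]
  refine h.congr' ?_
  filter_upwards [self_mem_nhdsWithin] with s hs
  congr 1
  simp only [convSection_eq, ← hinner]
  exact (integral_integral_swap (f := fun u a => doubleIntegrand μN χ Φ s (u, a))
    (hΦ.integrable_doubleIntegrand μN μA μNbar hF hd χ (s := s) (by simpa using hs))).symm

end Pole

end OddSO

end

theorem proposition3
    {F : Type*} [NontriviallyNormedField F] [IsUltrametricDist F] [LocallyCompactSpace F]
    [CharZero F] (hF : OddSO.IsNormalizedAbs F)
    (ψ : AddChar F ℂ) (hψ : Continuous ψ) (hψ1 : ∃ x, ψ x ≠ 1)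
    (d : ℕ) (hd : 1 ≤ d)
    [MeasurableSpace Fˣ] [BorelSpace Fˣ]
    [MeasurableSpace (GL (Fin d) F)] [BorelSpace (GL (Fin d) F)]
    [MeasurableSpace (OddSO.G F d)] [BorelSpace (OddSO.G F d)]
    (μA : Measure Fˣ) [μA.IsHaarMeasure]
    (μN : Measure (OddSO.N F d)) [μN.IsHaarMeasure]
    (μNbar : Measure (OddSO.Nbar F d)) [μNbar.IsHaarMeasure]
    (γ : Fˣ → GL (Fin d) F) (hγ : ∀ t, OddSO.HasSymPart t (γ t))
    (μ : Fˣ → Measure (GL (Fin d) F)) (hμ : OddSO.IsOrbitMeasures γ μ) :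
    ∃ C₁ : ℝ, 0 < C₁ ∧
      ∀ (χ : Fˣ →* ℤˣ) (f : GL (Fin d) F → ℂ), OddSO.IsTestFun f →
      ∀ Φ : OddSO.G F d → ℂ, OddSO.IsTestFunG Φ →
        (∀ b, f b = ((OddSO.modTilde μN μNbar b ^ (1 / 2 : ℝ) : ℝ) : ℂ) *
          Φ (OddSO.embB b)⁻¹) →
        (∀ s : ℂ, 0 < s.re →
          Integrable (fun u : OddSO.Nbar F d => OddSO.convSection μA μN χ Φ s u) μNbar) ∧
        (∀ t, Integrable f (μ t)) ∧
        Tendsto (fun s : ℝ => OddSO.gammaF ψ (s : ℂ) *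
            ∫ u : OddSO.Nbar F d, OddSO.convSection μA μN χ Φ (s : ℂ) u ∂μNbar)
          (𝓝[>] 0) (𝓝 ((C₁ : ℂ) * OddSO.Ichi μ χ f)) := by
  have hd0 : (0 : ℝ) < d := by exact_mod_cast hd
  obtain ⟨cψ, hcψ, A, hA, hγA⟩ := OddSO.tendsto_gammaF hF ψ
  obtain ⟨c, hc, hcμ⟩ := OddSO.exists_orbitMeasure_eq_smul μN μNbar hd hγ hμ
  have hvol : 0 < μA.real (OddSO.unitSquares F) :=
    ENNReal.toReal_pos (OddSO.measure_unitSquares_pos μA).ne'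
      (OddSO.measure_unitSquares_lt_top μA).ne
  refine ⟨cψ * ((2 * d : ℝ)⁻¹ * μA.real (OddSO.unitSquares F) * c⁻¹), by positivity,
    fun χ f hf Φ hΦ hfΦ => ⟨fun s hs => ?_, hμ.integrable hcμ hf, ?_⟩⟩
  · simp only [OddSO.convSection_eq]
    have := OddSO.secondCountableTopology_field (F := F)
    have : SecondCountableTopology Fˣ := OddSO.secondCountableTopology_units
    have : LocallyCompactSpace Fˣ := OddSO.locallyCompactSpace_units
    exact (hΦ.integrable_doubleIntegrand μN μA μNbar hF hd χ hs).integral_prod_left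
  · have h := hA.mul (hΦ.tendsto_integral_convSection μN μA μNbar hF hd hμ hc hcμ χ
      hf.1.continuous.measurable hfΦ)
    rw [← mul_assoc, ← Complex.ofReal_mul] at h
    refine h.congr' ?_
    filter_upwards [hγA] with s hs
    rw [hs, mul_assoc]
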